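/- Let $\mathbb T=[-1/2,1/2)$, let $T_\ell f(x)=f(x-\ell)$ for $f\in L^2(\mathbb R^k)$, $\ell\in\mathbb Z^k$, and let $\Gamma f(x)=(\hat f(x+\ell))_{\ell\in\mathbb Z^k}\in\ell^2(\mathbb Z^k)$ for a.e. $x\in\mathbb T^k$, where $\hat f(\xi)=\int f(x)e^{-2\pi i\langle x,\xi\rangle}\,dx$. A finitely generated shift-invariant (FSI) subspace is the closed span of the translates $T_\ell f$ ($\ell\in\mathbb Z^k$) of finitely many $f\in L^2(\mathbb R^k)$. For an FSI subspace $\mathcal V$, let $J_{\mathcal V}$ be its measurable range function: the (a.e. unique) weakly measurable field of closed subspaces of $\ell^2(\mathbb Z^k)$ with $\mathcal V=\{f:\Gamma f(x)\in J_{\mathcal V}(x)\text{ for a.e. }x\in\mathbb T^k\}$. For a shift preserving bounded operator $S$ on $L^2(\mathbb R^k)$, let $[S]_x$ be the (a.e. unique) weakly measurable, essentially bounded field of operators on $\ell^2(\mathbb Z^k)$ with $[S]_x\Gamma f(x)=\Gamma(Sf)(x)$ a.e. for every $f$. For a positive finite rank operator $A$, $\lambda(A)=(\lambda_i(A))_{i\ge1}$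 is the non-increasing sequence of its eigenvalues, counting multiplicities and completed with zeros. For $\mathcal G=(g_i)_{i=1}^n$, put $E(\mathcal G)=\{T_\ell g_i\}_{\ell,i}$, $\Gamma\mathcal G(x)=(\Gamma g_i(x))_{i=1}^n$, and let $S_{E(\mathcal G)}$, $S_{\Gamma\mathcal G(x)}$ be the frame operators, $S_{\{h_j\}}h=\sum_j\langle h,h_j\rangle h_j$. Let $\mathcal V,\mathcal W\subseteq L^2(\mathbb R^k)$ be FSI subspaces with $\mathcal V\oplus\mathcal W^\perp=L^2(\mathbb R^k)$ (algebraic direct sum), and let $\mathcal F=(f_i)_{i=1}^n\in\mathcal W^n$ be such that $E(\mathcal F)$ is a frame for $\mathcal W$. A shift generated $\mathcal V$-dual of $E(\mathcal F)$ is a Bessel family $E(\mathcal G)$ with $\mathcal G\in\mathcal V^n$ and $f=\sum_{\ell,i}\langle f,T_\ell g_i\rangle T_\ell f_i$ for all $f\in\mathcal W$. The canonical $\mathcal V$-dual of $E(\mathcal F)$ is $E(\mathcal F)^\#_{\mathcal V}=\{T_\ell f^\#_{\mathcal V,i}\}$ with $f^\#_{\mathcal V,i}=P_{\mathcal V/\!/\mathcal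 W^\perp}S_{E(\mathcal F)}^\dagger f_i$, where $P_{\mathcal V/\!/\mathcal W^\perp}$ is the projection onto $\mathcal V$ along $\mathcal W^\perp$ and $\dagger$ is the Moore–Penrose pseudo-inverse. Let $\lambda^\#_i(x)=\lambda_i([S_{E(\mathcal F)^\#_{\mathcal V}}]_x)$, $d(x)=\dim J_{\mathcal V}(x)$, $\mathrm{Spec}(\mathcal V)=\{x\in\mathbb T^k:d(x)\ne0\}$ and $m(x)=2d(x)-n$. Theorem (Fine spectral structure of $\mathcal V$-duals). Let $\mu=(\mu_i)_{i\ge1}$ be a measurable function on $\mathbb T^k$ whose values are non-increasing, non-negative, summable sequences. The following are equivalent: 1. There exists a shift generated $\mathcal V$-dual $E(\mathcal G)$ of $E(\mathcal F)$ such that $\mu(x)=\lambda([S_{E(\mathcal G)}]_x)=\lambda(S_{\Gamma\mathcal G(x)})$ for a.e. $x\in\mathbb T^k$. 2. $\mu_1$ is essentially bounded; for a.e. $x\notin\mathrm{Spec}(\mathcal V)$, $\mu(x)=0$; and for a.e. $x\in\mathrm{Spec}(\mathcal V)$, $\mu_i(x)=0$ for $i\ge d(x)+1$ and (a) if $m(x)\le0$,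 then $\mu_i(x)\ge\lambda^\#_i(x)$ for $1\le i\le d(x)$; (b) if $m(x)\ge1$, then $\mu_i(x)\ge\lambda^\#_i(x)$ for $1\le i\le d(x)$ and $\mu_{n-d(x)+i}(x)\le\lambda^\#_i(x)$ for $1\le i\le m(x)$. -/

import Mathlib

open MeasureTheory
open scoped ENNReal

noncomputable section

namespace SIFrame

/-! ### Frames, frame operators and oblique duals in a Hilbert space -/

section Hilbert

variable {H : Type*} [NormedAddCommGroup H] [InnerProductSpace ℂ H]
variable {ι : Type*}

/-- `F` is a Bessel family: `∑ |⟨f, F i⟩|² ≤ b ‖f‖²` for every `f`, for some constant `b`. -/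
def IsBessel (F : ι → H) : Prop :=
  ∃ b : ℝ, ∀ f : H, Summable (fun i => ‖inner ℂ (F i) f‖ ^ 2) ∧
    ∑' i, ‖inner ℂ (F i) f‖ ^ 2 ≤ b * ‖f‖ ^ 2

/-- `F` is a frame for the subspace `W`: a family in `W` such that
`a ‖f‖² ≤ ∑ |⟨f, F i⟩|² ≤ b ‖f‖²` for every `f ∈ W`, for some constants `0 < a ≤ b`. -/
def IsFrameFor (F : ι → H) (W : Submodule ℂ H) : Prop :=
  (∀ i, F i ∈ W) ∧ ∃ a b : ℝ, 0 < a ∧ a ≤ b ∧ ∀ f ∈ W,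
    Summable (fun i => ‖inner ℂ (F i) f‖ ^ 2) ∧
    a * ‖f‖ ^ 2 ≤ ∑' i, ‖inner ℂ (F i) f‖ ^ 2 ∧
    ∑' i, ‖inner ℂ (F i) f‖ ^ 2 ≤ b * ‖f‖ ^ 2

/-- `G` is an oblique `V`-dual of the frame `F` for `W`: a Bessel family in `V` such that
`f = ∑ ⟨f, G i⟩ F i` for every `f ∈ W`.  (Mathlib's `inner ℂ x y` is linear in `y`.) -/
def IsObliqueDual (V W : Submodule ℂ H) (F G : ι → H) : Prop :=
  (∀ i, G i ∈ V) ∧ IsBessel G ∧ ∀ f ∈ W, HasSum (fun i => inner ℂ (G i) f • F i) f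

/-- The sequence of analysis coefficients of a Bessel family lies in `ℓ²`. -/
theorem IsBessel.memlp {F : ι → H} (h : IsBessel F) (f : H) :
    Memℓp (fun i => inner ℂ (F i) f) 2 := by
  obtain ⟨b, hb⟩ := h
  refine memℓp_gen ?_
  simpa using (hb f).1

/-- The analysis operator `f ↦ (⟨f, F i⟩)ᵢ` of a Bessel family (zero if `F` is not Bessel). -/
def analysisOp (F : ι → H) : H →L[ℂ] lp (fun _ : ι => ℂ) 2 := by
  classical
  exact if h : IsBessel F then
    LinearMap.mkContinuousOfExistsBound
      { toFun := fun f => ⟨fun i => inner ℂ (F i) f, h.memlp f⟩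
        map_add' := fun f g => by
          ext i
          exact inner_add_right _ _ _
        map_smul' := fun c f => by
          ext i
          exact inner_smul_right _ _ _ }
      (by
        obtain ⟨b, hb⟩ := h
        refine ⟨Real.sqrt b, fun f => ?_⟩
        have hsq := lp.norm_rpow_eq_tsum (p := 2) (by norm_num)
          (⟨fun i => inner ℂ (F i) f, IsBessel.memlp ⟨b, hb⟩ f⟩ : lp (fun _ : ι => ℂ) 2)
        simp only [ENNReal.toReal_ofNat, Real.rpow_ofNat] at hsq
        have h2 := (hb f).2
        rw [← hsq] at h2
        rcases le_total 0 b with hb0 | hb0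
        · refine le_of_sq_le_sq ?_ (by positivity)
          rw [mul_pow, Real.sq_sqrt hb0]
          exact h2
        · rw [Real.sqrt_eq_zero_of_nonpos hb0, zero_mul]
          have h3 : b * ‖f‖ ^ 2 ≤ 0 := mul_nonpos_of_nonpos_of_nonneg hb0 (sq_nonneg _)
          have h4 := le_trans h2 h3
          exact le_of_eq (pow_eq_zero_iff two_ne_zero |>.mp (le_antisymm h4 (sq_nonneg _))))
  else 0

variable [CompleteSpace H]

/-- The synthesis operator `T_F`, the adjoint of the analysis operator. -/
def synthesisOp (F : ι → H) : lp (fun _ : ι => ℂ) 2 →L[ℂ] H :=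
  ContinuousLinearMap.adjoint (analysisOp F)

/-- The frame operator `S_F = T_F T_F^*`. -/
def frameOp (F : ι → H) : H →L[ℂ] H :=
  synthesisOp F ∘L analysisOp F

/-- `B` satisfies the four Penrose equations for `A`; for `A` of closed range there is exactly
one such `B`. -/
def IsMoorePenrose (A B : H →L[ℂ] H) : Prop :=
  A ∘L B ∘L A = A ∧ B ∘L A ∘L B = B ∧
    ContinuousLinearMap.adjoint (A ∘L B) = A ∘L B ∧
    ContinuousLinearMap.adjoint (B ∘L A) = B ∘L A

/-- The Moore-Penrose pseudo-inverse of a closed range operator. -/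
def pinv (A : H →L[ℂ] H) : H →L[ℂ] H :=
  Classical.epsilon (IsMoorePenrose A)

/-- `μ 0 ≥ μ 1 ≥ ...` is the list of the eigenvalues of the positive finite rank
operator `A`, counting multiplicities and completed with zeros: each `t > 0` occurs in it
exactly `dim ker (A - t)` times. -/
def IsEigenvalueSeq (A : H →L[ℂ] H) (μ : ℕ → ℝ) : Prop :=
  Antitone μ ∧ (∀ j, 0 ≤ μ j) ∧ ∀ t : ℝ, 0 < t →
    {j | μ j = t}.encard = Cardinal.toENat
      (Module.rank ℂ (Module.End.eigenspace (A : H →ₗ[ℂ] H) (t : ℂ)))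

/-- The eigenvalues of a positive finite rank operator, counting multiplicities, in
non-increasing order and completed with zeros; `eigenvalueSeq A j` is `λ_{j+1}(A)`. -/
def eigenvalueSeq (A : H →L[ℂ] H) : ℕ → ℝ :=
  Classical.epsilon (IsEigenvalueSeq A)

end Hilbert

/-! ### Shift-invariant spaces -/

/-- `ℝᵏ`. -/
abbrev Space (k : ℕ) : Type := EuclideanSpace ℝ (Fin k)

/-- `L²(ℝᵏ)`. -/
abbrev L2 (k : ℕ) : Type := Lp ℂ 2 (volume : Measure (Space k))

/-- `ℓ²(ℤᵏ)`. -/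
abbrev SeqSpace (k : ℕ) : Type := lp (fun _ : Fin k → ℤ => ℂ) 2

/-- A point of `ℤᵏ`, seen in `ℝᵏ`. -/
def latticePt {k : ℕ} (l : Fin k → ℤ) : Space k := WithLp.toLp 2 (fun j => (l j : ℝ))

/-- The translation `T_l f (x) = f (x - l)` on `L²(ℝᵏ)`, for `l ∈ ℤᵏ`. -/
def shiftOp {k : ℕ} (l : Fin k → ℤ) : L2 k →ₗᵢ[ℂ] L2 k :=
  Lp.compMeasurePreservingₗᵢ ℂ (fun x => x - latticePt l)
    (measurePreserving_sub_right volume (latticePt l))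

/-- The family `E(F) = {T_l f_i}` of the integer translates of `F`. -/
def translates {k n : ℕ} (F : Fin n → L2 k) : (Fin k → ℤ) × Fin n → L2 k :=
  fun p => shiftOp p.1 (F p.2)

/-- The shift-invariant subspace generated by `A`: the closed span of its translates. -/
def shiftSpan {k : ℕ} (A : Set (L2 k)) : Submodule ℂ (L2 k) :=
  (Submodule.span ℂ {g | ∃ f ∈ A, ∃ l : Fin k → ℤ, g = shiftOp l f}).topologicalClosure

/-- `V` is a finitely generated shift-invariant (FSI) subspace. -/
def IsFSI {k : ℕ} (V : Submodule ℂ (L2 k)) : Prop :=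
  ∃ A : Set (L2 k), A.Finite ∧ V = shiftSpan A

/-- The cube `[-1/2, 1/2)ᵏ`. -/
def torus (k : ℕ) : Set (Space k) := {x | ∀ j, x j ∈ Set.Ico (-(1 / 2) : ℝ) (1 / 2)}

/-- Lebesgue measure on the cube. -/
def torusMeasure (k : ℕ) : Measure (Space k) := volume.restrict (torus k)

open Classical in
/-- `Γ f (x) = (f̂(x + l))_l`, which lies in `ℓ²(ℤᵏ)` for a.e. `x`; here `f̂` is the
`L²` Fourier transform, with kernel `exp(-2πi⟨x, ξ⟩)`. -/
def Gam {k : ℕ} (f : L2 k) (x : Space k) : SeqSpace k :=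
  if h : Memℓp (fun l : Fin k → ℤ =>
      (Lp.fourierTransformₗᵢ (Space k) ℂ f : Space k → ℂ) (x + latticePt l)) 2
  then ⟨_, h⟩ else 0

/-- `J` is a measurable range function with associated shift-invariant subspace `V`. -/
def IsRangeFunction {k : ℕ} (V : Submodule ℂ (L2 k))
    (J : Space k → ClosedSubmodule ℂ (SeqSpace k)) : Prop :=
  (∀ ξ η : SeqSpace k, AEMeasurable
    (fun x => inner ℂ η ((J x).toSubmodule.starProjection ξ)) (torusMeasure k)) ∧
  ∀ f : L2 k, f ∈ V ↔ ∀ᵐ x ∂(torusMeasure k), Gam f x ∈ J x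

/-- The measurable range function `J_V` of a shift-invariant subspace `V`; it exists and is
unique up to a null set. -/
def rangeFunction {k : ℕ} (V : Submodule ℂ (L2 k)) :
    Space k → ClosedSubmodule ℂ (SeqSpace k) :=
  Classical.epsilon (IsRangeFunction V)

/-- `d(x) = dim J_V(x)`. -/
def fiberDim {k : ℕ} (V : Submodule ℂ (L2 k)) (x : Space k) : ℕ :=
  Module.finrank ℂ (rangeFunction V x).toSubmodule

/-- `Spec(V) = {x : dim J_V(x) ≠ 0}`. -/
def Spec {k : ℕ} (V : Submodule ℂ (L2 k)) : Set (Space k) :=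
  {x | x ∈ torus k ∧ fiberDim V x ≠ 0}

/-- `s` is a weakly measurable and essentially bounded field of operators on `ℓ²(ℤᵏ)` such that
`s(x) (Γ f (x)) = Γ (S f) (x)` for a.e. `x`, for every `f`. -/
def IsFiberField {k : ℕ} (S : L2 k →L[ℂ] L2 k)
    (s : Space k → SeqSpace k →L[ℂ] SeqSpace k) : Prop :=
  (∀ ξ η : SeqSpace k, AEMeasurable (fun x => inner ℂ η (s x ξ)) (torusMeasure k)) ∧
  (∃ C : ℝ, ∀ᵐ x ∂(torusMeasure k), ‖s x‖ ≤ C) ∧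
  ∀ f : L2 k, ∀ᵐ x ∂(torusMeasure k), s x (Gam f x) = Gam (S f) x

/-- The field `x ↦ [S]_x` of a shift preserving operator `S`; it exists and is unique up to a
null set. -/
def fiber {k : ℕ} (S : L2 k →L[ℂ] L2 k) : Space k → SeqSpace k →L[ℂ] SeqSpace k :=
  Classical.epsilon (IsFiberField S)

/-- The fine spectral structure of `E(F)`: the eigenvalues of `[S_{E(F)}]_x`. -/
def fineSpectrum {k n : ℕ} (F : Fin n → L2 k) (x : Space k) : ℕ → ℝ :=
  eigenvalueSeq (fiber (frameOp (translates F)) x)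

/-- `E(G)` is a shift generated oblique `V`-dual of the frame `E(F)` for `W`. -/
def IsSGDual {k n : ℕ} (V W : Submodule ℂ (L2 k)) (F G : Fin n → L2 k) : Prop :=
  (∀ i, G i ∈ V) ∧ IsObliqueDual V W (translates F) (translates G)

/-- The generators `f^#_{V,i} = P_{V//Wᗮ} (S_{E(F)}^† f_i)` of the canonical `V`-dual of
`E(F)`, where `P_{V//Wᗮ}` is the projection onto `V` along `Wᗮ`. -/
def canonicalDual {k n : ℕ} (V W : Submodule ℂ (L2 k)) (hVW : IsCompl V Wᗮ)
    (F : Fin n → L2 k) : Fin n → L2 k :=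
  fun i => V.projection Wᗮ hVW (pinv (frameOp (translates F)) (F i))

end SIFrame

end

open SIFrame MeasureTheory

open MeasureTheory
open scoped ENNReal

noncomputable section

namespace SIFrame

/-! ### Fiberization -/

section Fiberization

open Filter Topology

variable {k : ℕ}

/-! The problem is moved to the fibres, solved there by matrix theory, and reassembled by a
measurable selection.

Plancherel and the tiling of ℝᵏ by lattice translates of the cube make Γ an isometry onto L²(𝕋ᵏ;
ℓ²(ℤᵏ)) (`GamLI`, `exists_Gam_eq`), and it turns translations into multiplication by characters
(`Gam_shiftOp`). Inner products with translates are therefore Fourier coefficients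
(`inner_shiftOp`). By Parseval, translates form a Bessel family exactly when the generators have
essentially bounded fibres, and mixed synthesis-analysis operators act fibrewise as finite sums
(`Gam_mixed`). Since J_V(x) is the span of the fibres of finitely many generators
(`rangeFunction_shiftSpan`), being a V-dual is a pointwise condition on finite families
(`isSGDual_iff`).

In one fibre let f and g come from F and its canonical dual, and let d = dim J_V(x) = dim J_W(x) ≤
n. If h is another dual, the coefficients of h - g lie in the space of linear relations of f, which
has dimension n - d, and those of g are orthogonal to it. Hence S_h = S_g + Z*Z with Z of rank at
most n - d (`norm_coeffs_eq`), and Courant-Fischer gives, with indices from 0, λ_j ≤ μ_j and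
μ_{j+n-d} ≤ λ_j. Conversely, `exists_rank_perturbation` realises every spectrum allowed by these
inequalities: it peels off one rank at a time, the rank one case being the secular equation, solved
by Lagrange interpolation. `exists_dual_charpoly_gram` spreads the perturbation along an orthonormal
basis of the relations and so obtains a dual.

To choose these duals measurably, only their coefficients in the generators of V are selected.
Duality and the spectrum of the n × n Gram matrix are polynomial conditions on the coefficients,
their conjugates, finitely many measurable inner products and μ, so they cut out a closed subset of
a finite-dimensional space; `exists_measurable_selection` applies and nothing has to be diagonalised
measurably. Finally ‖h_i‖² ≤ μ_0, so the bound on the top eigenvalue makes the selected fields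
bounded, and surjectivity of Γ turns them into generators. -/

theorem seqSpace_aestronglyMeasurable {X : Type*} [MeasurableSpace X] {μ : Measure X}
    {h : X → SeqSpace k} (hm : ∀ l, AEStronglyMeasurable (fun x => h x l) μ) :
    AEStronglyMeasurable h μ := by
  refine aestronglyMeasurable_of_tendsto_ae (u := (atTop : Filter (Finset (Fin k → ℤ))))
    (f := fun s x => ∑ l ∈ s, lp.single 2 l (h x l)) ?_ ?_
  · intro s
    refine Finset.aestronglyMeasurable_fun_sum _ fun l _ => ?_
    exact (lp.singleContinuousLinearMap ℂ (fun _ : Fin k → ℤ => ℂ) 2 l).continuous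
      |>.comp_aestronglyMeasurable (hm l)
  · exact Eventually.of_forall fun x => lp.hasSum_single (by norm_num) (h x)

theorem seqSpace_continuous_apply (l : Fin k → ℤ) : Continuous fun a : SeqSpace k => a l :=
  (continuous_apply l).comp (lp.uniformContinuous_coe).continuous

theorem latticePt_apply (l : Fin k → ℤ) (j : Fin k) : latticePt l j = l j := rfl

theorem measurableSet_torus : MeasurableSet (torus k) := by
  unfold torus
  rw [Set.ofPred_forall]
  refine MeasurableSet.iInter fun j => ?_
  have hm : Measurable fun x : Space k => x j := by fun_prop
  exact hm measurableSet_Ico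

/-- The lattice point of the translate of the cube that contains `y`. -/
def latticePart (y : Space k) : Fin k → ℤ := fun j => ⌊y j + 1 / 2⌋

theorem measurable_latticePart : Measurable (latticePart (k := k)) := by
  refine measurable_pi_lambda _ fun j => ?_
  have hm : Measurable fun x : Space k => x j + 1 / 2 := by fun_prop
  exact Int.measurable_floor.comp hm

theorem sub_latticePt_mem_torus_iff (y : Space k) (l : Fin k → ℤ) :
    y - latticePt l ∈ torus k ↔ latticePart y = l := by
  simp only [torus, latticePart, Set.mem_ofPred_eq, PiLp.sub_apply, latticePt_apply, Set.mem_Ico,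
    funext_iff, Int.floor_eq_iff]
  exact forall_congr' fun j => ⟨fun h => ⟨by linarith [h.1], by linarith [h.2]⟩,
    fun h => ⟨by linarith [h.1], by linarith [h.2]⟩⟩

theorem latticePart_add {x : Space k} (hx : x ∈ torus k) (l : Fin k → ℤ) :
    latticePart (x + latticePt l) = l := by
  rw [← sub_latticePt_mem_torus_iff]; simpa using hx

/-- The level sets of `latticePart` partition the space into translates of the cube, and Lebesgue
measure is translation invariant. -/
theorem lintegral_eq_tsum_torus (h : Space k → ℝ≥0∞) :
    ∫⁻ y, h y = ∑' l : Fin k → ℤ, ∫⁻ x, h (x + latticePt l) ∂(torusMeasure k) := by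
  have hU : (⋃ l : Fin k → ℤ, latticePart (k := k) ⁻¹' {l}) = Set.univ := by
    ext y; simp
  have hms : ∀ l : Fin k → ℤ, MeasurableSet (latticePart (k := k) ⁻¹' {l}) := fun l =>
    measurable_latticePart (measurableSet_singleton l)
  rw [← setLIntegral_univ, ← hU, lintegral_iUnion hms]
  · refine tsum_congr fun l => ?_
    have hp := measurePreserving_add_right (volume : Measure (Space k)) (latticePt l)
    have he := (MeasurableEquiv.addRight (latticePt l : Space k)).measurableEmbedding
    rw [← hp.setLIntegral_comp_preimage_emb he]
    have : (fun x : Space k => x + latticePt l) ⁻¹' (latticePart ⁻¹' {l}) = torus k := by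
      ext x
      simp only [Set.mem_preimage, Set.mem_singleton_iff, ← sub_latticePt_mem_torus_iff]
      simp
    rw [this]; rfl
  · intro l m hlm
    exact Disjoint.preimage _ (by simpa using hlm)

theorem ae_torus_of_ae {P : Space k → Prop} (h : ∀ᵐ y, P y) :
    ∀ᵐ x ∂(torusMeasure k), ∀ l : Fin k → ℤ, P (x + latticePt l) := by
  rw [ae_all_iff]
  intro l
  have hp := measurePreserving_add_right (volume : Measure (Space k)) (latticePt l)
  exact ae_restrict_of_ae (hp.quasiMeasurePreserving.ae h)

theorem ae_mem_torus : ∀ᵐ x ∂(torusMeasure k), x ∈ torus k :=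
  ae_restrict_mem measurableSet_torus

theorem seqSpace_enorm_sq (a : SeqSpace k) : ‖a‖ₑ ^ 2 = ∑' l, ‖a l‖ₑ ^ 2 := by
  have h := lp.norm_rpow_eq_tsum (p := 2) (by norm_num) a
  have hs := (lp.memℓp a).summable (by norm_num)
  simp only [ENNReal.toReal_ofNat, Real.rpow_ofNat] at h hs
  rw [← ofReal_norm, ← ENNReal.ofReal_pow (norm_nonneg _), h,
    ENNReal.ofReal_tsum_of_nonneg (fun _ => by positivity) hs]
  exact tsum_congr fun l => by rw [ENNReal.ofReal_pow (norm_nonneg _), ofReal_norm]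

theorem memℓp_two_of_tsum_ne_top {ι : Type*} {a : ι → ℂ} (h : ∑' l, ‖a l‖ₑ ^ 2 ≠ ∞) :
    Memℓp a 2 := by
  refine memℓp_gen ?_
  have := ENNReal.summable_toReal h
  simpa using this

/-- The `L²` Fourier transform. -/
abbrev fourierL2 (k : ℕ) : L2 k ≃ₗᵢ[ℂ] L2 k := Lp.fourierTransformₗᵢ (Space k) ℂ

theorem lintegral_enorm_sq_L2 {X E : Type*} [MeasurableSpace X] [NormedAddCommGroup E]
    {μ : Measure X} (f : Lp E 2 μ) : ∫⁻ y, ‖f y‖ₑ ^ 2 ∂μ = ‖f‖ₑ ^ 2 := by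
  rw [Lp.enorm_def, eLpNorm_eq_lintegral_rpow_enorm_toReal (by norm_num) (by norm_num)]
  simp only [ENNReal.toReal_ofNat, ENNReal.rpow_ofNat, one_div]
  rw [← ENNReal.rpow_natCast, ← ENNReal.rpow_mul]
  simp

/-- Plancherel combined with the tiling. It is stated in `ℝ≥0∞` because its finiteness is what shows
that almost every fibre lies in ℓ². -/
theorem lintegral_tsum_fourier (f : L2 k) :
    ∫⁻ x, ∑' l : Fin k → ℤ, ‖(fourierL2 k f : Space k → ℂ) (x + latticePt l)‖ₑ ^ 2
      ∂(torusMeasure k) = ‖f‖ₑ ^ 2 := by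
  rw [lintegral_tsum]
  · rw [← lintegral_eq_tsum_torus (fun y => ‖(fourierL2 k f : Space k → ℂ) y‖ₑ ^ 2),
      lintegral_enorm_sq_L2, LinearIsometryEquiv.enorm_map]
  · intro l
    have := (Lp.stronglyMeasurable (fourierL2 k f)).measurable
    fun_prop

theorem ae_memℓp_fourier (f : L2 k) : ∀ᵐ x ∂(torusMeasure k), Memℓp (fun l : Fin k → ℤ =>
      (fourierL2 k f : Space k → ℂ) (x + latticePt l)) 2 := by
  have hm := (Lp.stronglyMeasurable (fourierL2 k f)).measurable
  have := ae_lt_top' (μ := torusMeasure k) (f := fun x => ∑' l : Fin k → ℤ,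
    ‖(fourierL2 k f : Space k → ℂ) (x + latticePt l)‖ₑ ^ 2)
    (Measurable.tsum fun l => by fun_prop).aemeasurable
    (by rw [lintegral_tsum_fourier]; simp)
  filter_upwards [this] with x hx
  exact memℓp_two_of_tsum_ne_top hx.ne

theorem Gam_apply_ae (f : L2 k) : ∀ᵐ x ∂(torusMeasure k), ∀ l : Fin k → ℤ,
    Gam f x l = (fourierL2 k f : Space k → ℂ) (x + latticePt l) := by
  filter_upwards [ae_memℓp_fourier f] with x hx l
  simp only [Gam]
  rw [dif_pos hx]

theorem aestronglyMeasurable_Gam (f : L2 k) : AEStronglyMeasurable (Gam f) (torusMeasure k) := by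
  refine seqSpace_aestronglyMeasurable fun l => ?_
  have hm := (Lp.stronglyMeasurable (fourierL2 k f)).measurable
  have h2 : Measurable fun x => (fourierL2 k f : Space k → ℂ) (x + latticePt l) := by fun_prop
  refine h2.aestronglyMeasurable.congr ?_
  filter_upwards [Gam_apply_ae f] with x hx
  exact (hx l).symm

theorem lintegral_Gam (f : L2 k) : ∫⁻ x, ‖Gam f x‖ₑ ^ 2 ∂(torusMeasure k) = ‖f‖ₑ ^ 2 := by
  rw [← lintegral_tsum_fourier]
  refine lintegral_congr_ae ?_
  filter_upwards [Gam_apply_ae f] with x hx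
  simp [seqSpace_enorm_sq, hx]

theorem memLp_two_of_lintegral {X E : Type*} [MeasurableSpace X] [NormedAddCommGroup E]
    {μ : Measure X} {f : X → E} (hf : AEStronglyMeasurable f μ)
    (h : ∫⁻ x, ‖f x‖ₑ ^ 2 ∂μ < ∞) : MemLp f 2 μ := by
  refine ⟨hf, ?_⟩
  rw [eLpNorm_lt_top_iff_lintegral_rpow_enorm_lt_top (by norm_num) (by norm_num)]
  simpa using h

theorem memLp_Gam (f : L2 k) : MemLp (Gam f) 2 (torusMeasure k) :=
  memLp_two_of_lintegral (aestronglyMeasurable_Gam f) (by rw [lintegral_Gam]; simp)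

theorem Gam_congr {f g h : L2 k} {c d : ℂ}
    (e : ∀ᵐ y, (fourierL2 k h : Space k → ℂ) y =
      c * (fourierL2 k f : Space k → ℂ) y + d * (fourierL2 k g : Space k → ℂ) y) :
    ∀ᵐ x ∂(torusMeasure k), Gam h x = c • Gam f x + d • Gam g x := by
  filter_upwards [Gam_apply_ae f, Gam_apply_ae g, Gam_apply_ae h, ae_torus_of_ae e]
    with x h1 h2 h3 h4
  ext l
  rw [h3 l, h4 l, ← h1 l, ← h2 l]
  rfl

theorem Gam_add (f g : L2 k) :
    ∀ᵐ x ∂(torusMeasure k), Gam (f + g) x = Gam f x + Gam g x := by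
  have := Gam_congr (f := f) (g := g) (h := f + g) (c := 1) (d := 1) (by
    rw [map_add]
    filter_upwards [Lp.coeFn_add (fourierL2 k f) (fourierL2 k g)] with y hy
    rw [hy, one_mul, one_mul]
    rfl)
  simpa using this

theorem Gam_smul (c : ℂ) (f : L2 k) :
    ∀ᵐ x ∂(torusMeasure k), Gam (c • f) x = c • Gam f x := by
  have := Gam_congr (f := f) (g := f) (h := c • f) (c := c) (d := 0) (by
    rw [map_smul]
    filter_upwards [Lp.coeFn_smul c (fourierL2 k f)] with y hy
    rw [hy, zero_mul, add_zero]
    rfl)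
  simpa using this

/-- `Γ` as an isometry into `L²(𝕋ᵏ; ℓ²(ℤᵏ))`. -/
def GamLI (k : ℕ) : L2 k →ₗᵢ[ℂ] Lp (SeqSpace k) 2 (torusMeasure k) where
  toFun f := (memLp_Gam f).toLp
  map_add' f g := by
    rw [← MemLp.toLp_add]
    exact MemLp.toLp_congr _ _ (Gam_add f g)
  map_smul' c f := by
    rw [RingHom.id_apply, ← MemLp.toLp_const_smul]
    exact MemLp.toLp_congr _ _ (Gam_smul c f)
  norm_map' f := by
    have h : ‖(memLp_Gam f).toLp‖ₑ ^ 2 = ‖f‖ₑ ^ 2 := by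
      rw [← lintegral_enorm_sq_L2, ← lintegral_Gam]
      refine lintegral_congr_ae ?_
      filter_upwards [(memLp_Gam f).coeFn_toLp] with x hx
      rw [hx]
    have h2 := congrArg ENNReal.toReal h
    simp only [ENNReal.toReal_pow, toReal_enorm] at h2
    exact (sq_eq_sq₀ (norm_nonneg _) (norm_nonneg _)).1 h2

theorem coeFn_GamLI (f : L2 k) : GamLI k f =ᵐ[torusMeasure k] Gam f :=
  (memLp_Gam f).coeFn_toLp

theorem inner_eq_integral_Gam (f g : L2 k) :
    inner ℂ f g = ∫ x, inner ℂ (Gam f x) (Gam g x) ∂(torusMeasure k) := by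
  rw [← (GamLI k).inner_map_map, L2.inner_def]
  refine integral_congr_ae ?_
  filter_upwards [coeFn_GamLI f, coeFn_GamLI g] with x h1 h2
  rw [h1, h2]

theorem integrable_inner_Gam (f g : L2 k) :
    Integrable (fun x => inner ℂ (Gam f x) (Gam g x)) (torusMeasure k) := by
  refine (L2.integrable_inner (𝕜 := ℂ) (GamLI k f) (GamLI k g)).congr ?_
  filter_upwards [coeFn_GamLI f, coeFn_GamLI g] with x h1 h2
  rw [h1, h2]

theorem norm_sq_eq_integral_Gam (f : L2 k) :
    ‖f‖ ^ 2 = ∫ x, ‖Gam f x‖ ^ 2 ∂(torusMeasure k) := by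
  have h := inner_eq_integral_Gam f f
  simp only [inner_self_eq_norm_sq_to_K] at h
  have h2 : ((‖f‖ ^ 2 : ℝ) : ℂ) = ((∫ x, ‖Gam f x‖ ^ 2 ∂(torusMeasure k) : ℝ) : ℂ) := by
    rw [← integral_complex_ofReal]
    simpa using h
  exact_mod_cast h2

theorem Gam_injective {f g : L2 k} (h : ∀ᵐ x ∂(torusMeasure k), Gam f x = Gam g x) : f = g := by
  apply (GamLI k).injective
  refine Lp.ext ?_
  filter_upwards [coeFn_GamLI f, coeFn_GamLI g, h] with x h1 h2 h3
  rw [h1, h2, h3]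

/-- Surjectivity of Γ: coordinate `l` of the field is laid out on the cube translated by `l`, and
the resulting L² function is inverted under the Fourier transform. Every later construction made
fibre by fibre returns to L²(ℝᵏ) through this lemma. -/
theorem exists_Gam_eq {h : Space k → SeqSpace k} (hm : MemLp h 2 (torusMeasure k)) :
    ∃ f : L2 k, ∀ᵐ x ∂(torusMeasure k), Gam f x = h x := by
  set g : Lp (SeqSpace k) 2 (torusMeasure k) := hm.toLp with hg
  have hgm : StronglyMeasurable g := Lp.stronglyMeasurable g
  set F : Space k → ℂ := fun y => g (y - latticePt (latticePart y)) (latticePart y) with hF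
  have hFx : ∀ x ∈ torus k, ∀ l, F (x + latticePt l) = g x l := by
    intro x hx l
    simp only [hF, latticePart_add hx l, add_sub_cancel_right]
  have hFm : Measurable F := by
    have h1 : Measurable fun p : Space k × (Fin k → ℤ) => g (p.1 - latticePt p.2) p.2 := by
      refine measurable_from_prod_countable_left fun l => ?_
      have h2 : StronglyMeasurable fun x => g (x - latticePt l) :=
        hgm.comp_measurable (by fun_prop)
      exact ((seqSpace_continuous_apply l).comp_stronglyMeasurable h2).measurable
    exact h1.comp (measurable_id.prodMk measurable_latticePart)
  have hFL : MemLp F 2 (volume : Measure (Space k)) := by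
    refine memLp_two_of_lintegral hFm.aestronglyMeasurable ?_
    rw [lintegral_eq_tsum_torus, ← lintegral_tsum (fun l => by fun_prop)]
    have : ∫⁻ x, ∑' l : Fin k → ℤ, ‖F (x + latticePt l)‖ₑ ^ 2 ∂(torusMeasure k) =
        ‖g‖ₑ ^ 2 := by
      rw [← lintegral_enorm_sq_L2]
      refine lintegral_congr_ae ?_
      filter_upwards [ae_mem_torus] with x hx
      simp [seqSpace_enorm_sq, hFx x hx]
    rw [this]; simp
  refine ⟨(fourierL2 k).symm hFL.toLp, ?_⟩
  filter_upwards [Gam_apply_ae ((fourierL2 k).symm hFL.toLp), ae_torus_of_ae hFL.coeFn_toLp,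
    ae_mem_torus, hm.coeFn_toLp] with x h1 h2 h3 h4
  ext l
  rw [h1 l, LinearIsometryEquiv.apply_symm_apply, h2 l, hFx x h3 l, hg, h4]

end Fiberization

/-! ### Fourier series on the cube -/

section TorusFourier

open Filter Topology UnitAddTorus

attribute [local instance] instMeasureSpaceUnitAddCircle

instance : IsProbabilityMeasure (volume : Measure UnitAddCircle) :=
  inferInstanceAs (IsProbabilityMeasure AddCircle.haarAddCircle)

theorem measurePreserving_coe_unitAddCircle (a : ℝ) :
    MeasurePreserving (fun x : ℝ => (x : UnitAddCircle)) (volume.restrict (Set.Ioc a (a + 1)))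
      volume := by
  refine ⟨AddCircle.measurable_mk', (AddCircle.measurePreserving_mk 1 a).map_eq.trans ?_⟩
  refine (AddCircle.volume_eq_smul_haarAddCircle (T := 1)).trans ?_
  rw [ENNReal.ofReal_one, one_smul]
  rfl

variable {k : ℕ}

/-- Integration against `U` is a continuous functional on continuous functions; it kills the
characters, whose span is dense. -/
theorem integral_mul_eq_zero_of_mFourierCoeff_eq_zero {d : Type*} [Fintype d]
    {U : UnitAddTorus d → ℂ} (hU : Integrable U) (h : ∀ n, mFourierCoeff U n = 0)
    (g : C(UnitAddTorus d, ℂ)) : ∫ t, g t * U t = 0 := by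
  have hi : ∀ g : C(UnitAddTorus d, ℂ), Integrable fun t => g t * U t := fun g =>
    hU.bdd_mul g.continuous.aestronglyMeasurable (Eventually.of_forall fun t => g.norm_coe_le_norm t)
  let Φ : C(UnitAddTorus d, ℂ) →L[ℂ] ℂ := LinearMap.mkContinuous
    { toFun := fun g => ∫ t, g t * U t
      map_add' := fun a b => by
        simp only [ContinuousMap.add_apply, add_mul]
        exact integral_add (hi a) (hi b)
      map_smul' := fun c a => by
        simp only [ContinuousMap.smul_apply, smul_eq_mul, mul_assoc, RingHom.id_apply]
        exact integral_const_mul _ _ } (∫ t, ‖U t‖) (fun g => by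
      refine (norm_integral_le_integral_norm _).trans ?_
      rw [← integral_mul_const]
      refine integral_mono (hi g).norm (hU.norm.mul_const _) fun t => ?_
      simp only [norm_mul]
      rw [mul_comm]
      exact mul_le_mul_of_nonneg_left (g.norm_coe_le_norm t) (norm_nonneg _))
  have hker : Submodule.span ℂ (Set.range (mFourier (d := d))) ≤ LinearMap.ker Φ.toLinearMap := by
    rw [Submodule.span_le]
    rintro _ ⟨n, rfl⟩
    have := h (-n)
    change ∫ t, mFourier n t * U t = 0
    simpa [mFourierCoeff] using this
  have hcl := Submodule.topologicalClosure_minimal _ hker Φ.isClosed_ker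
  rw [span_mFourier_closure_eq_top] at hcl
  exact hcl (Submodule.mem_top (x := g))

/-- Uniqueness of Fourier coefficients in L¹ rather than L²: the products ⟨Γf, Γg⟩ to which it is
applied are in general only integrable. Continuous test functions are upgraded to indicators of
closed sets by dominated convergence. -/
theorem ae_eq_zero_of_mFourierCoeff_eq_zero {d : Type*} [Fintype d]
    {U : UnitAddTorus d → ℂ} (hU : Integrable U) (h : ∀ n, mFourierCoeff U n = 0) :
    U =ᵐ[volume] 0 := by
  refine ae_eq_zero_of_forall_setIntegral_isClosed_eq_zero hU fun s hs => ?_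
  have h1 : Tendsto (fun n => ∫ t, ((hs.apprSeq n t : ℝ) : ℂ) * U t) atTop
      (𝓝 (∫ t, s.indicator (fun _ => (1 : ℂ)) t * U t)) := by
    refine tendsto_integral_of_dominated_convergence (fun t => ‖U t‖) ?_ hU.norm ?_ ?_
    · intro n
      refine AEStronglyMeasurable.mul ?_ hU.aestronglyMeasurable
      exact (Complex.continuous_ofReal.comp (NNReal.continuous_coe.comp
        (hs.apprSeq n).continuous)).aestronglyMeasurable
    · intro n
      refine Eventually.of_forall fun t => ?_
      rw [norm_mul]
      have := HasOuterApproxClosed.apprSeq_apply_le_one hs n t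
      have h2 : ‖((hs.apprSeq n t : ℝ) : ℂ)‖ ≤ 1 := by
        simpa using this
      exact mul_le_of_le_one_left (norm_nonneg _) h2
    · refine Eventually.of_forall fun t => ?_
      refine Tendsto.mul_const _ ?_
      have := (tendsto_pi_nhds.1 (HasOuterApproxClosed.tendsto_apprSeq hs)) t
      have h3 := (Complex.continuous_ofReal.comp NNReal.continuous_coe).tendsto _ |>.comp this
      have h4 : (((s.indicator (fun _ => (1 : NNReal)) t : NNReal) : ℝ) : ℂ) =
          s.indicator (fun _ => (1 : ℂ)) t := by
        by_cases ht : t ∈ s <;> simp [ht]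
      rw [← h4]
      exact h3
  have h2 : ∀ n, ∫ t, ((hs.apprSeq n t : ℝ) : ℂ) * U t = 0 := fun n =>
    integral_mul_eq_zero_of_mFourierCoeff_eq_zero hU h
      ⟨fun t => ((hs.apprSeq n t : ℝ) : ℂ), Complex.continuous_ofReal.comp
        (NNReal.continuous_coe.comp (hs.apprSeq n).continuous)⟩
  simp only [h2] at h1
  have h3 := tendsto_nhds_unique h1 tendsto_const_nhds
  rw [← integral_indicator hs.measurableSet, ← h3]
  refine integral_congr_ae (Eventually.of_forall fun t => ?_)
  by_cases ht : t ∈ s <;> simp [ht]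

/-- The covering map of the torus. -/
def toTorus (x : Space k) : UnitAddTorus (Fin k) := fun i => (x i : UnitAddCircle)

/-- The inverse of the covering map on the cube. -/
def ofTorus (t : UnitAddTorus (Fin k)) : Space k :=
  WithLp.toLp 2 fun i => (AddCircle.measurableEquivIco (1 : ℝ) (-(1 / 2)) (t i) : ℝ)

theorem measurable_toTorus : Measurable (toTorus (k := k)) := by
  refine measurable_pi_lambda _ fun i => ?_
  exact AddCircle.measurable_mk'.comp (by fun_prop)

theorem measurable_ofTorus : Measurable (ofTorus (k := k)) := by
  refine (WithLp.measurable_toLp 2 _).comp (measurable_pi_lambda _ fun i => ?_)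
  exact measurable_subtype_coe.comp ((AddCircle.measurableEquivIco (1 : ℝ) (-(1 / 2))).measurable.comp
    (measurable_pi_apply i))

theorem ofTorus_toTorus {x : Space k} (hx : x ∈ torus k) : ofTorus (toTorus x) = x := by
  ext i
  have h := (AddCircle.measurableEquivIco (1 : ℝ) (-(1 / 2))).apply_symm_apply
    ⟨x i, by have := hx i; constructor <;> [linarith [this.1]; linarith [this.2]]⟩
  exact congrArg Subtype.val h

theorem measurePreserving_toTorus :
    MeasurePreserving (toTorus (k := k)) (torusMeasure k) volume := by
  have h1 : MeasurePreserving (fun x : Fin k → ℝ => fun i => (x i : UnitAddCircle))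
      (volume.restrict (Set.univ.pi fun _ => Set.Ico (-(1 / 2)) (1 / 2))) volume := by
    have := measurePreserving_pi _ _ (fun _ : Fin k => measurePreserving_coe_unitAddCircle (-(1 / 2)))
    -- The circle is modelled on a left-open interval and the cube on right-open ones; they differ
    -- by a null set.
    have e : (Measure.pi fun _ : Fin k => (volume : Measure ℝ).restrict
        (Set.Ioc (-(1 / 2)) (-(1 / 2) + 1))) =
        volume.restrict (Set.univ.pi fun _ => Set.Ico (-(1 / 2)) (1 / 2)) := by
      have h3 : (-(1 / 2) + 1 : ℝ) = 1 / 2 := by norm_num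
      rw [h3, volume_pi, Measure.restrict_pi_pi]
      congr 1
      funext i
      exact (Measure.restrict_congr_set Ico_ae_eq_Ioc).symm
    rw [e] at this
    exact this
  have h2 := (PiLp.volume_preserving_ofLp (Fin k)).restrict_preimage
    (s := Set.univ.pi fun _ => Set.Ico (-(1 / 2)) (1 / 2))
    (MeasurableSet.univ_pi fun _ => measurableSet_Ico)
  have h3 : (@WithLp.ofLp 2 (Fin k → ℝ)) ⁻¹' (Set.univ.pi fun _ => Set.Ico (-(1 / 2)) (1 / 2)) =
      torus k := by
    ext x; simp [torus]
  rw [h3] at h2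
  exact h1.comp h2

theorem measurePreserving_ofTorus :
    MeasurePreserving (ofTorus (k := k)) volume (torusMeasure k) := by
  refine ⟨measurable_ofTorus, ?_⟩
  rw [← measurePreserving_toTorus.map_eq, Measure.map_map measurable_ofTorus measurable_toTorus]
  conv_rhs => rw [← Measure.map_id (μ := torusMeasure k)]
  refine Measure.map_congr ?_
  filter_upwards [ae_mem_torus] with x hx
  exact ofTorus_toTorus hx

instance : IsProbabilityMeasure (torusMeasure k) := by
  rw [← measurePreserving_ofTorus.map_eq]
  exact Measure.isProbabilityMeasure_map measurable_ofTorus.aemeasurable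

/-- The character `x ↦ exp(2πi⟨l, x⟩)`. -/
def chr (l : Fin k → ℤ) (x : Space k) : ℂ := mFourier l (toTorus x)

theorem norm_chr (l : Fin k → ℤ) (x : Space k) : ‖chr l x‖ = 1 := by
  simp only [chr, mFourier, ContinuousMap.coe_mk, norm_prod, fourier_apply, Circle.norm_coe,
    Finset.prod_const_one]

theorem measurable_chr (l : Fin k → ℤ) : Measurable (chr l) :=
  (mFourier l).continuous.measurable.comp measurable_toTorus

theorem chr_neg (l : Fin k → ℤ) (x : Space k) : chr (-l) x = starRingEnd ℂ (chr l x) :=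
  mFourier_neg

theorem toTorus_add_latticePt (x : Space k) (m : Fin k → ℤ) :
    toTorus (x + latticePt m) = toTorus x := by
  funext i
  have h : ((m i : ℝ) : UnitAddCircle) = 0 :=
    (AddCircle.coe_eq_zero_iff _).2 ⟨m i, by simp⟩
  simp only [toTorus, PiLp.add_apply, latticePt_apply, AddCircle.coe_add, h, add_zero]

theorem chr_add_latticePt (l m : Fin k → ℤ) (x : Space k) :
    chr l (x + latticePt m) = chr l x := by
  simp [chr, toTorus_add_latticePt]

theorem chr_eq_exp (l : Fin k → ℤ) (x : Space k) :
    chr l x = Complex.exp (2 * Real.pi * Complex.I * ∑ i, (l i : ℂ) * x i) := by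
  simp only [chr, mFourier, toTorus, ContinuousMap.coe_mk, fourier_coe_apply]
  rw [← Complex.exp_sum, Finset.mul_sum]
  congr 1
  refine Finset.sum_congr rfl fun i _ => ?_
  simp [mul_assoc]

/-- Fourier coefficients of a function on the cube. -/
def torusCoeff (u : Space k → ℂ) (l : Fin k → ℤ) : ℂ :=
  ∫ x, chr (-l) x * u x ∂(torusMeasure k)

theorem mFourierCoeff_comp_ofTorus (u : Space k → ℂ)
    (hu : AEStronglyMeasurable u (torusMeasure k)) (l : Fin k → ℤ) :
    mFourierCoeff (u ∘ ofTorus) l = torusCoeff u l := by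
  have hm : AEStronglyMeasurable (fun t => mFourier (-l) t • (u ∘ ofTorus) t)
      (volume : Measure (UnitAddTorus (Fin k))) :=
    (mFourier (-l)).continuous.aestronglyMeasurable.smul
      (hu.comp_measurePreserving measurePreserving_ofTorus)
  unfold mFourierCoeff torusCoeff
  rw [← measurePreserving_toTorus.map_eq] at hm ⊢
  rw [integral_map measurable_toTorus.aemeasurable hm]
  refine integral_congr_ae ?_
  filter_upwards [ae_mem_torus] with x hx
  simp [chr, ofTorus_toTorus hx]

theorem ae_eq_zero_of_torusCoeff_eq_zero {u : Space k → ℂ} (hu : Integrable u (torusMeasure k))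
    (h : ∀ l, torusCoeff u l = 0) : ∀ᵐ x ∂(torusMeasure k), u x = 0 := by
  have h1 : Integrable (u ∘ ofTorus) (volume : Measure (UnitAddTorus (Fin k))) :=
    measurePreserving_ofTorus.integrable_comp_of_integrable hu
  have h2 := ae_eq_zero_of_mFourierCoeff_eq_zero h1 fun n => by
    rw [mFourierCoeff_comp_ofTorus u hu.aestronglyMeasurable, h n]
  filter_upwards [measurePreserving_toTorus.quasiMeasurePreserving.ae h2, ae_mem_torus] with x hx hx2
  simpa [ofTorus_toTorus hx2] using hx

theorem hasSum_torusCoeff {u v : Space k → ℂ} (hu : MemLp u 2 (torusMeasure k))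
    (hv : MemLp v 2 (torusMeasure k)) :
    HasSum (fun l => starRingEnd ℂ (torusCoeff u l) * torusCoeff v l)
      (∫ x, starRingEnd ℂ (u x) * v x ∂(torusMeasure k)) := by
  have hu' := hu.comp_measurePreserving measurePreserving_ofTorus
  have hv' := hv.comp_measurePreserving measurePreserving_ofTorus
  have h := hasSum_prod_mFourierCoeff hu'.toLp hv'.toLp
  have hc : ∀ {w : UnitAddTorus (Fin k) → ℂ} (hw : MemLp w 2 volume) (n : Fin k → ℤ),
      mFourierCoeff (hw.toLp : UnitAddTorus (Fin k) → ℂ) n = mFourierCoeff w n := by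
    intro w hw n
    refine integral_congr_ae ?_
    filter_upwards [hw.coeFn_toLp] with t ht
    rw [ht]
  have hI : ∫ t, starRingEnd ℂ ((hu'.toLp : UnitAddTorus (Fin k) → ℂ) t) *
      (hv'.toLp : UnitAddTorus (Fin k) → ℂ) t =
      ∫ x, starRingEnd ℂ (u x) * v x ∂(torusMeasure k) := by
    have hm : AEStronglyMeasurable (fun x => starRingEnd ℂ (u x) * v x) (torusMeasure k) :=
      (RCLike.continuous_conj.comp_aestronglyMeasurable hu.aestronglyMeasurable).mul
        hv.aestronglyMeasurable
    rw [← measurePreserving_ofTorus.map_eq] at hm ⊢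
    rw [integral_map measurable_ofTorus.aemeasurable hm]
    refine integral_congr_ae ?_
    filter_upwards [hu'.coeFn_toLp, hv'.coeFn_toLp] with t h1 h2
    rw [h1, h2]; rfl
  rw [hI] at h
  refine h.congr_fun fun l => ?_
  rw [hc, hc, mFourierCoeff_comp_ofTorus u hu.aestronglyMeasurable,
    mFourierCoeff_comp_ofTorus v hv.aestronglyMeasurable]

end TorusFourier

/-! ### Translations -/

section Shift

open FourierTransform SchwartzMap

variable {k : ℕ}

theorem memLp_chr (l : Fin k → ℤ) : MemLp (chr l) ∞ (volume : Measure (Space k)) :=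
  memLp_top_of_bound (measurable_chr l).aestronglyMeasurable 1
    (Filter.Eventually.of_forall fun x => (norm_chr l x).le)

theorem schwartz_fourier_translate (f : 𝓢(Space k, ℂ)) (l : Fin k → ℤ) (ξ : Space k) :
    𝓕 (f.compSubConstCLM ℂ (latticePt l)) ξ = chr (-l) ξ * 𝓕 f ξ := by
  rw [SchwartzMap.fourier_coe, SchwartzMap.fourier_coe]
  have h := VectorFourier.fourierIntegral_comp_add_right Real.fourierChar
    (volume : Measure (Space k)) (innerₗ (Space k)) f (-latticePt l)
  have h2 := congrFun h ξ
  rw [Real.fourier_eq, Real.fourier_eq]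
  simp only [VectorFourier.fourierIntegral, innerₗ_apply_apply, Function.comp_def] at h2
  simp only [compSubConstCLM_apply, sub_eq_add_neg]
  rw [h2, Circle.smul_def, smul_eq_mul, Real.fourierChar_apply, chr_eq_exp]
  congr 2
  simp [PiLp.inner_apply, latticePt_apply, Finset.mul_sum, Finset.sum_mul]
  refine Finset.sum_congr rfl fun i _ => ?_
  ring

theorem fourierL2_toLp (ψ : 𝓢(Space k, ℂ)) :
    ∀ᵐ ξ, (fourierL2 k (ψ.toLp 2) : Space k → ℂ) ξ = (𝓕 ψ : 𝓢(Space k, ℂ)) ξ := by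
  have e : fourierL2 k (ψ.toLp 2) = (𝓕 ψ : 𝓢(Space k, ℂ)).toLp 2 := SchwartzMap.toLp_fourier_eq ψ
  rw [e]
  exact (𝓕 ψ : 𝓢(Space k, ℂ)).coeFn_toLp 2 volume

/-- Both sides are continuous in `f`, so the classical formula for Schwartz functions extends by
density. -/
theorem fourierL2_shiftOp (l : Fin k → ℤ) (f : L2 k) :
    ∀ᵐ ξ, (fourierL2 k (shiftOp l f) : Space k → ℂ) ξ =
      chr (-l) ξ * (fourierL2 k f : Space k → ℂ) ξ := by
  set M : L2 k →L[ℂ] L2 k :=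
    (ContinuousLinearMap.lsmul ℂ ℂ).holderL volume ∞ 2 2 (memLp_chr (-l)).toLp with hM
  have hMf : ∀ g : L2 k, ∀ᵐ ξ, (M g : Space k → ℂ) ξ = chr (-l) ξ * (g : Space k → ℂ) ξ := by
    intro g
    filter_upwards [(ContinuousLinearMap.lsmul ℂ ℂ).coeFn_holder (r := 2)
      (memLp_chr (-l)).toLp g, (memLp_chr (-l)).coeFn_toLp] with ξ h1 h2
    rw [← h2]
    exact h1
  have key : fourierL2 k (shiftOp l f) = M (fourierL2 k f) := by
    refine DenseRange.induction_on (p := fun f => fourierL2 k (shiftOp l f) = M (fourierL2 k f))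
      (SchwartzMap.denseRange_toLpCLM (p := 2) (F := ℂ) (E := Space k) (μ := volume)
        ENNReal.ofNat_ne_top) f ?_ ?_
    · exact isClosed_eq ((fourierL2 k).continuous.comp (shiftOp l).continuous)
        (M.continuous.comp (fourierL2 k).continuous)
    · intro φ
      have e1 : shiftOp l (φ.toLp 2) = (φ.compSubConstCLM ℂ (latticePt l)).toLp 2 := by
        refine Lp.ext ?_
        have hp := measurePreserving_sub_right (volume : Measure (Space k)) (latticePt l)
        refine (Lp.coeFn_compMeasurePreserving (φ.toLp 2) hp).trans ?_
        filter_upwards [hp.quasiMeasurePreserving.ae (φ.coeFn_toLp 2 volume),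
          (φ.compSubConstCLM ℂ (latticePt l)).coeFn_toLp 2 volume] with x h1 h2
        rw [h2, Function.comp_apply, h1]; rfl
      change fourierL2 k (shiftOp l (φ.toLp 2)) = M (fourierL2 k (φ.toLp 2))
      refine Lp.ext ?_
      rw [e1]
      filter_upwards [hMf (fourierL2 k (φ.toLp 2)), fourierL2_toLp φ,
        fourierL2_toLp (φ.compSubConstCLM ℂ (latticePt l))] with x h1 h2 h3
      rw [h1, h2, h3]
      exact schwartz_fourier_translate φ l x
  rw [key]
  exact hMf _

/-- The modulation factor is lattice periodic, hence constant along a fibre. -/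
theorem Gam_shiftOp (l : Fin k → ℤ) (f : L2 k) :
    ∀ᵐ x ∂(torusMeasure k), Gam (shiftOp l f) x = chr (-l) x • Gam f x := by
  filter_upwards [Gam_apply_ae f, Gam_apply_ae (shiftOp l f),
    ae_torus_of_ae (fourierL2_shiftOp l f)] with x h1 h2 h3
  ext m
  rw [h2 m, h3 m, chr_add_latticePt, ← h1 m]
  rfl

/-- The bridge to Fourier series: sums over translates become Parseval sums on the cube. -/
theorem inner_shiftOp (l : Fin k → ℤ) (f g : L2 k) :
    inner ℂ (shiftOp l g) f = torusCoeff (fun x => inner ℂ (Gam g x) (Gam f x)) (-l) := by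
  rw [inner_eq_integral_Gam, torusCoeff, neg_neg]
  refine integral_congr_ae ?_
  filter_upwards [Gam_shiftOp l g] with x hx
  rw [hx, inner_smul_left, chr_neg, Complex.conj_conj]

end Shift

/-! ### Bessel families -/

section Bessel

variable {H : Type*} [NormedAddCommGroup H] [InnerProductSpace ℂ H] {ι : Type*}

theorem analysisOp_apply {F : ι → H} (hF : IsBessel F) (f : H) (i : ι) :
    analysisOp F f i = inner ℂ (F i) f := by
  unfold analysisOp
  rw [dif_pos hF]
  rfl

theorem isBessel_of_finite [Finite ι] (F : ι → H) : IsBessel F := by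
  have := Fintype.ofFinite ι
  refine ⟨∑ i, ‖F i‖ ^ 2, fun f => ⟨Summable.of_finite, ?_⟩⟩
  rw [tsum_fintype, Finset.sum_mul]
  refine Finset.sum_le_sum fun i _ => ?_
  rw [← mul_pow]
  exact pow_le_pow_left₀ (norm_nonneg _) (norm_inner_le_norm _ _) 2

variable [CompleteSpace H]

theorem hasSum_inner_mixed {F G : ι → H} (hF : IsBessel F) (hG : IsBessel G) (h f : H) :
    HasSum (fun i => inner ℂ h (F i) * inner ℂ (G i) f)
      (inner ℂ h (synthesisOp F (analysisOp G f))) := by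
  unfold synthesisOp
  rw [ContinuousLinearMap.adjoint_inner_right]
  refine (lp.hasSum_inner (analysisOp F h) (analysisOp G f)).congr_fun fun i => ?_
  rw [analysisOp_apply hF, analysisOp_apply hG]
  simp [mul_comm]

theorem hasSum_mixed {F G : ι → H} (hF : IsBessel F) (hG : IsBessel G) (f : H) :
    HasSum (fun i => inner ℂ (G i) f • F i) (synthesisOp F (analysisOp G f)) := by
  classical
  have h := (lp.hasSum_single (by norm_num) (analysisOp G f)).mapL (synthesisOp F)
  refine h.congr_fun fun i => ?_
  refine ext_inner_left ℂ fun v => ?_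
  rw [synthesisOp, ContinuousLinearMap.adjoint_inner_right, lp.inner_single_right,
    analysisOp_apply hF, analysisOp_apply hG]
  simp [inner_smul_right, mul_comm]

theorem frameOp_apply [Fintype ι] (F : ι → H) (f : H) :
    frameOp F f = ∑ i, inner ℂ (F i) f • F i := by
  have h := hasSum_mixed (isBessel_of_finite F) (isBessel_of_finite F) f
  exact h.unique (hasSum_fintype _)

theorem frameOp_norm_le [Fintype ι] (F : ι → H) : ‖frameOp F‖ ≤ ∑ i, ‖F i‖ ^ 2 := by
  refine ContinuousLinearMap.opNorm_le_bound _ (Finset.sum_nonneg fun _ _ => sq_nonneg _)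
    fun f => ?_
  rw [frameOp_apply, Finset.sum_mul]
  refine (norm_sum_le _ _).trans (Finset.sum_le_sum fun i _ => ?_)
  rw [norm_smul]
  nlinarith [norm_inner_le_norm (𝕜 := ℂ) (F i) f, norm_nonneg (F i)]

theorem isObliqueDual_iff {V W : Submodule ℂ H} {F G : ι → H} (hF : IsBessel F) :
    IsObliqueDual V W F G ↔ (∀ i, G i ∈ V) ∧ IsBessel G ∧
      ∀ f ∈ W, synthesisOp F (analysisOp G f) = f := by
  refine and_congr_right fun _ => and_congr_right fun hG => forall₂_congr fun f _ => ?_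
  exact ⟨fun h => (hasSum_mixed hF hG f).unique h, fun h => by
    have := hasSum_mixed hF hG f
    rwa [h] at this⟩

end Bessel

theorem hasSum_prod_fin {β M : Type*} [AddCommMonoid M] [TopologicalSpace M] [ContinuousAdd M]
    {n : ℕ} {f : β × Fin n → M} {a : Fin n → M} (h : ∀ i, HasSum (fun l => f (l, i)) (a i)) :
    HasSum f (∑ i, a i) := by
  classical
  have h1 : ∀ i, HasSum (fun p : β × Fin n => if p.2 = i then f p else 0) (a i) := by
    intro i
    have hinj : Function.Injective fun l : β => (l, i) := fun l m hlm => (Prod.ext_iff.1 hlm).1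
    rw [← hinj.hasSum_iff]
    · exact (h i).congr_fun fun l => by simp
    · rintro ⟨l, j⟩ hp
      by_cases hj : j = i
      · subst hj; exact absurd ⟨l, rfl⟩ hp
      · simp [hj]
  exact (hasSum_sum fun i (_ : i ∈ Finset.univ) => h1 i).congr_fun fun p => by simp

/-! ### Families of translates and their fibers -/

section Translates

open Filter Topology

variable {k n : ℕ}

/-- The fibers of `G` are essentially bounded. -/
def IsBddFam (G : Fin n → L2 k) : Prop :=
  ∃ C : ℝ, 0 ≤ C ∧ ∀ᵐ x ∂(torusMeasure k), ∀ i, ‖Gam (G i) x‖ ≤ C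

theorem memLp_inner_Gam {g : L2 k} {C : ℝ} (hg : ∀ᵐ x ∂(torusMeasure k), ‖Gam g x‖ ≤ C)
    (f : L2 k) : MemLp (fun x => inner ℂ (Gam g x) (Gam f x)) 2 (torusMeasure k) := by
  refine MemLp.of_le_mul (c := C) (memLp_Gam f).norm
    ((aestronglyMeasurable_Gam g).inner (aestronglyMeasurable_Gam f)) ?_
  filter_upwards [hg] with x hx
  rw [norm_norm]
  exact (norm_inner_le_norm _ _).trans (mul_le_mul_of_nonneg_right hx (norm_nonneg _))

theorem hasSum_translates_single {g g' : L2 k} (f h : L2 k)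
    (hg : MemLp (fun x => inner ℂ (Gam g x) (Gam h x)) 2 (torusMeasure k))
    (hg' : MemLp (fun x => inner ℂ (Gam g' x) (Gam f x)) 2 (torusMeasure k)) :
    HasSum (fun l => inner ℂ h (shiftOp l g) * inner ℂ (shiftOp l g') f)
      (∫ x, inner ℂ (Gam h x) (Gam g x) * inner ℂ (Gam g' x) (Gam f x) ∂(torusMeasure k)) := by
  have h1 := hasSum_torusCoeff hg hg'
  rw [← (Equiv.neg (Fin k → ℤ)).hasSum_iff] at h1
  simp only [inner_conj_symm] at h1
  refine h1.congr_fun fun l => ?_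
  simp only [Function.comp_apply, Equiv.neg_apply, ← inner_shiftOp, inner_conj_symm]

theorem IsBddFam.isBessel {G : Fin n → L2 k} (hG : IsBddFam G) : IsBessel (translates G) := by
  obtain ⟨C, hC, hb⟩ := hG
  have hi : ∀ i, ∀ᵐ x ∂(torusMeasure k), ‖Gam (G i) x‖ ≤ C := ae_all_iff.1 hb
  refine ⟨∑ i : Fin n, C ^ 2, fun f => ?_⟩
  have hs : HasSum (fun p => ‖inner ℂ (translates G p) f‖ ^ 2)
      (∑ i, ∫ x, ‖inner ℂ (Gam (G i) x) (Gam f x)‖ ^ 2 ∂(torusMeasure k)) := by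
    refine hasSum_prod_fin fun i => ?_
    have h1 := hasSum_translates_single f f (memLp_inner_Gam (hi i) f) (memLp_inner_Gam (hi i) f)
    have e : ∀ a b : ℂ, (starRingEnd ℂ) a = b → b * a = ((‖a‖ ^ 2 : ℝ) : ℂ) := by
      rintro a _ rfl
      rw [mul_comm, Complex.mul_conj, Complex.normSq_eq_norm_sq]
    simp only [e _ _ (inner_conj_symm _ _)] at h1
    rw [integral_complex_ofReal] at h1
    exact Complex.hasSum_ofReal.1 h1
  refine ⟨hs.summable, ?_⟩
  rw [hs.tsum_eq, Finset.sum_mul]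
  refine Finset.sum_le_sum fun i _ => ?_
  rw [norm_sq_eq_integral_Gam, ← integral_const_mul]
  refine integral_mono_ae (memLp_inner_Gam (hi i) f).norm.integrable_sq
    ((memLp_Gam f).norm.integrable_sq.const_mul _) ?_
  filter_upwards [hi i] with x hx
  rw [← mul_pow]
  exact pow_le_pow_left₀ (norm_nonneg _) ((norm_inner_le_norm _ _).trans
    (mul_le_mul_of_nonneg_right hx (norm_nonneg _))) 2

theorem exists_Gam_eq_indicator (g : L2 k) {E : Set (Space k)} (hE : MeasurableSet E) :
    ∃ f : L2 k, ∀ᵐ x ∂(torusMeasure k), Gam f x = E.indicator (Gam g) x :=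
  exists_Gam_eq ((memLp_Gam g).indicator hE)

/-- The Bessel inequality is tested on the function with fibres 1_E Γg, where E is a set on which
‖Γg‖² exceeds `b`. Parseval turns it into ∫_E ‖Γg‖²(‖Γg‖² - b) ≤ 0 with a positive integrand, so E
is null. -/
theorem ae_norm_sq_Gam_le {g : L2 k} {b : ℝ} (hb0 : 0 ≤ b) (hb : ∀ f : L2 k,
    Summable (fun l => ‖inner ℂ (shiftOp l g) f‖ ^ 2) ∧
      ∑' l, ‖inner ℂ (shiftOp l g) f‖ ^ 2 ≤ b * ‖f‖ ^ 2) :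
    ∀ᵐ x ∂(torusMeasure k), ‖Gam g x‖ ^ 2 ≤ b := by
  obtain ⟨g', hg'm, hg'⟩ := aestronglyMeasurable_Gam g
  have key : ∀ M : ℕ, ∀ᵐ x ∂(torusMeasure k), ‖Gam g x‖ ≤ M → ‖Gam g x‖ ^ 2 ≤ b := by
    intro M
    -- The cut at `M` keeps the product ⟨Γg, Γf⟩ bounded, so that Parseval applies before Γg is
    -- known to be bounded. The representative `g'` makes E measurable.
    set E : Set (Space k) := {x | ‖g' x‖ ≤ M ∧ b < ‖g' x‖ ^ 2} with hE
    have hEm : MeasurableSet E :=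
      (measurableSet_le hg'm.norm.measurable measurable_const).inter
        (measurableSet_lt measurable_const (hg'm.norm.measurable.pow_const 2))
    obtain ⟨f, hf⟩ := exists_Gam_eq_indicator g hEm
    have hu : ∀ᵐ x ∂(torusMeasure k), inner ℂ (Gam g x) (Gam f x) =
        ((E.indicator (fun x => ‖Gam g x‖ ^ 2) x : ℝ) : ℂ) := by
      filter_upwards [hf] with x hx
      rw [hx]
      by_cases hxE : x ∈ E
      · simp [hxE, inner_self_eq_norm_sq_to_K]
      · simp [hxE]
    have hum : MemLp (fun x => inner ℂ (Gam g x) (Gam f x)) 2 (torusMeasure k) := by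
      refine MemLp.of_bound ((aestronglyMeasurable_Gam g).inner (aestronglyMeasurable_Gam f))
        ((M : ℝ) ^ 2) ?_
      filter_upwards [hu, hg'] with x hx hx'
      rw [hx]
      by_cases hxE : x ∈ E
      · simp only [hxE, Set.indicator_of_mem, Complex.norm_real, norm_pow, norm_norm]
        have := hxE.1
        rw [← hx'] at this
        exact pow_le_pow_left₀ (norm_nonneg _) this 2
      · simp [hxE]
    have hs := hasSum_translates_single f f hum hum
    have e : ∀ a b : ℂ, (starRingEnd ℂ) a = b → b * a = ((‖a‖ ^ 2 : ℝ) : ℂ) := by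
      rintro a _ rfl
      rw [mul_comm, Complex.mul_conj, Complex.normSq_eq_norm_sq]
    simp only [e _ _ (inner_conj_symm _ _)] at hs
    rw [integral_complex_ofReal] at hs
    have hs2 := (Complex.hasSum_ofReal.1 hs).tsum_eq
    have h1 := (hb f).2
    rw [hs2, norm_sq_eq_integral_Gam, ← integral_const_mul] at h1
    have hi1 := hum.norm.integrable_sq
    have hi2 := (memLp_Gam f).norm.integrable_sq.const_mul b
    have h2 : ∫ x, (‖inner ℂ (Gam g x) (Gam f x)‖ ^ 2 - b * ‖Gam f x‖ ^ 2) ∂(torusMeasure k)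
        ≤ 0 := by
      rw [integral_sub hi1 hi2]; linarith
    have hval : ∀ᵐ x ∂(torusMeasure k),
        ‖inner ℂ (Gam g x) (Gam f x)‖ ^ 2 - b * ‖Gam f x‖ ^ 2 =
          E.indicator (fun x => ‖Gam g x‖ ^ 2 * (‖Gam g x‖ ^ 2 - b)) x := by
      filter_upwards [hu, hf] with x h1 h2
      rw [h1, h2]
      by_cases hxE : x ∈ E
      · simp [hxE]; ring
      · simp [hxE]
    have hnn : 0 ≤ᵐ[torusMeasure k] fun x =>
        ‖inner ℂ (Gam g x) (Gam f x)‖ ^ 2 - b * ‖Gam f x‖ ^ 2 := by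
      filter_upwards [hval, hg'] with x hx hx'
      rw [hx]
      refine Set.indicator_apply_nonneg fun hxE => ?_
      have := hxE.2
      rw [← hx'] at this
      exact mul_nonneg (sq_nonneg _) (by linarith)
    have h0 := (integral_eq_zero_iff_of_nonneg_ae hnn (hi1.sub hi2)).1
      (le_antisymm h2 (integral_nonneg_of_ae hnn))
    filter_upwards [h0, hval, hg'] with x h1 h2 h3 hM
    by_contra hcon
    push Not at hcon
    have hxE : x ∈ E := by rw [hE, Set.mem_ofPred_eq, ← h3]; exact ⟨hM, hcon⟩
    rw [h1] at h2
    simp only [hxE, Set.indicator_of_mem, Pi.zero_apply] at h2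
    have : 0 < ‖Gam g x‖ ^ 2 * (‖Gam g x‖ ^ 2 - b) := mul_pos (by linarith) (by linarith)
    linarith
  filter_upwards [ae_all_iff.2 key] with x hx
  obtain ⟨M, hM⟩ := exists_nat_ge ‖Gam g x‖
  exact hx M hM

theorem isBddFam_of_isBessel {G : Fin n → L2 k} (hG : IsBessel (translates G)) : IsBddFam G := by
  obtain ⟨b, hb⟩ := hG
  have hi : ∀ i, ∀ᵐ x ∂(torusMeasure k), ‖Gam (G i) x‖ ^ 2 ≤ max b 0 := by
    intro i
    refine ae_norm_sq_Gam_le (le_max_right _ _) fun f => ?_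
    have hinj : Function.Injective fun l : Fin k → ℤ => (l, i) :=
      fun l m hlm => (Prod.ext_iff.1 hlm).1
    have hs := (hb f).1
    have h1 := hs.comp_injective hinj
    refine ⟨h1, ?_⟩
    refine (h1.tsum_le_tsum_of_inj _ hinj (fun _ _ => by positivity) (fun _ => le_rfl) hs).trans ?_
    exact (hb f).2.trans (mul_le_mul_of_nonneg_right (le_max_left _ _) (sq_nonneg _))
  refine ⟨√(max b 0), Real.sqrt_nonneg _, ?_⟩
  filter_upwards [ae_all_iff.2 hi] with x hx i
  exact Real.le_sqrt_of_sq_le (hx i)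

theorem Gam_eq_of_inner_eq {f : L2 k} {v : Space k → SeqSpace k}
    (hv : MemLp v 2 (torusMeasure k))
    (h : ∀ g : L2 k, inner ℂ g f = ∫ x, inner ℂ (Gam g x) (v x) ∂(torusMeasure k)) :
    ∀ᵐ x ∂(torusMeasure k), Gam f x = v x := by
  obtain ⟨f', hf'⟩ := exists_Gam_eq hv
  have : f = f' := by
    refine ext_inner_left ℂ fun g => ?_
    rw [h g, inner_eq_integral_Gam]
    refine integral_congr_ae ?_
    filter_upwards [hf'] with x hx
    rw [hx]
  rw [this]; exact hf'

theorem hasSum_inner_translates {F G : Fin n → L2 k} {C D : ℝ} (f h : L2 k)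
    (hF : ∀ i, ∀ᵐ x ∂(torusMeasure k), ‖Gam (F i) x‖ ≤ C)
    (hG : ∀ i, ∀ᵐ x ∂(torusMeasure k), ‖Gam (G i) x‖ ≤ D) :
    HasSum (fun p => inner ℂ h (translates F p) * inner ℂ (translates G p) f)
      (∑ i, ∫ x, inner ℂ (Gam h x) (Gam (F i) x) * inner ℂ (Gam (G i) x) (Gam f x)
        ∂(torusMeasure k)) := by
  refine hasSum_prod_fin fun i => ?_
  have h3 := hasSum_translates_single f h (memLp_inner_Gam (hF i) h) (memLp_inner_Gam (hG i) f)
  simp only [translates]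
  exact h3

/-- Tested against an arbitrary `h`, the sum over translates is by Parseval the integral of the
finite fibrewise sum, and Γ is onto. -/
theorem Gam_mixed {F G : Fin n → L2 k} (hF : IsBddFam F) (hG : IsBddFam G) (f : L2 k) :
    ∀ᵐ x ∂(torusMeasure k), Gam (synthesisOp (translates F) (analysisOp (translates G) f)) x =
      ∑ i, inner ℂ (Gam (G i) x) (Gam f x) • Gam (F i) x := by
  have hF' := hF
  have hG' := hG
  obtain ⟨C, hC, hb⟩ := hF'
  obtain ⟨D, hD, hd⟩ := hG'
  have hbi : ∀ i, ∀ᵐ x ∂(torusMeasure k), ‖Gam (F i) x‖ ≤ C := ae_all_iff.1 hb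
  have hdi : ∀ i, ∀ᵐ x ∂(torusMeasure k), ‖Gam (G i) x‖ ≤ D := ae_all_iff.1 hd
  refine Gam_eq_of_inner_eq ?_ fun h => ?_
  · refine memLp_finsetSum _ fun i _ => ?_
    refine MemLp.of_le_mul (c := C) (memLp_inner_Gam (hdi i) f)
      (((aestronglyMeasurable_Gam (G i)).inner (𝕜 := ℂ) (aestronglyMeasurable_Gam f)).smul
        (aestronglyMeasurable_Gam (F i))) ?_
    filter_upwards [hbi i] with x hx
    rw [norm_smul, mul_comm]
    exact mul_le_mul_of_nonneg_right hx (norm_nonneg _)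
  · have h1 := hasSum_inner_mixed hF.isBessel hG.isBessel h f
    have h2 := hasSum_inner_translates f h hbi hdi
    rw [h1.unique h2, ← integral_finsetSum]
    · refine integral_congr_ae (Eventually.of_forall fun x => ?_)
      simp [mul_comm]
    · intro i _
      have h3 : MemLp (fun x => inner ℂ (Gam h x) (Gam (F i) x)) 2 (torusMeasure k) :=
        (memLp_inner_Gam (hbi i) h).congr_norm
          ((aestronglyMeasurable_Gam h).inner (aestronglyMeasurable_Gam (F i)))
          (Eventually.of_forall fun x => norm_inner_symm _ _)
      exact h3.integrable_mul (memLp_inner_Gam (hdi i) f)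

end Translates

/-! ### Fiber fields -/

section FiberField

open Filter Topology

variable {k n : ℕ}

theorem exists_Gam_eq_const (ξ : SeqSpace k) :
    ∃ f : L2 k, ∀ᵐ x ∂(torusMeasure k), Gam f x = ξ :=
  exists_Gam_eq (memLp_const ξ)

theorem seqSpace_dense_single {M : Submodule ℂ (SeqSpace k)} (hM : IsClosed (M : Set (SeqSpace k)))
    (h : ∀ l, lp.single 2 l 1 ∈ M) : M = ⊤ := by
  rw [eq_top_iff]
  intro a _
  refine hM.mem_of_tendsto (lp.hasSum_single (by norm_num) a)
    (Eventually.of_forall fun s => Submodule.sum_mem _ fun l _ => ?_)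
  have : lp.single 2 l (a l) = a l • (lp.single 2 l 1 : SeqSpace k) := by
    rw [← lp.single_smul]; simp
  rw [this]
  exact M.smul_mem _ (h l)

/-- The constant fields given by the unit vectors are fibres of L² functions. There are countably
many, so a single null set suffices, and they span a dense subspace. -/
theorem IsFiberField.unique {S : L2 k →L[ℂ] L2 k} {s s' : Space k → SeqSpace k →L[ℂ] SeqSpace k}
    (hs : IsFiberField S s) (hs' : IsFiberField S s') : ∀ᵐ x ∂(torusMeasure k), s x = s' x := by
  choose e he using fun l : Fin k → ℤ => exists_Gam_eq_const (lp.single 2 l 1 : SeqSpace k)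
  filter_upwards [ae_all_iff.2 fun l => hs.2.2 (e l), ae_all_iff.2 fun l => hs'.2.2 (e l),
    ae_all_iff.2 he] with x h1 h2 h3
  have h4 : LinearMap.ker (s x - s' x).toLinearMap = ⊤ := by
    refine seqSpace_dense_single (ContinuousLinearMap.isClosed_ker _) fun l => ?_
    have := (h1 l).trans (h2 l).symm
    rw [h3 l] at this
    simpa [sub_eq_zero] using this
  ext1 a
  have h5 : a ∈ LinearMap.ker (s x - s' x).toLinearMap := by rw [h4]; trivial
  simpa [sub_eq_zero] using h5

theorem isFiberField_frameOp {G : Fin n → L2 k} (hG : IsBddFam G) :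
    IsFiberField (frameOp (translates G)) fun x => frameOp fun i => Gam (G i) x := by
  refine ⟨fun ξ η => ?_, ?_, fun f => ?_⟩
  · simp only [frameOp_apply, inner_sum, inner_smul_right]
    have := fun i => aestronglyMeasurable_Gam (G i)
    refine AEStronglyMeasurable.aemeasurable ?_
    refine Finset.aestronglyMeasurable_fun_sum _ fun i _ => ?_
    exact ((this i).inner aestronglyMeasurable_const).mul (aestronglyMeasurable_const.inner (this i))
  · obtain ⟨C, hC, hb⟩ := hG
    refine ⟨∑ i : Fin n, C ^ 2, ?_⟩
    filter_upwards [hb] with x hx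
    exact (frameOp_norm_le _).trans (Finset.sum_le_sum fun i _ =>
      pow_le_pow_left₀ (norm_nonneg _) (hx i) 2)
  · filter_upwards [Gam_mixed hG hG f] with x hx
    rw [frameOp_apply]
    exact hx.symm

theorem fiber_frameOp {G : Fin n → L2 k} (hG : IsBddFam G) :
    ∀ᵐ x ∂(torusMeasure k), fiber (frameOp (translates G)) x = frameOp fun i => Gam (G i) x :=
  (Classical.epsilon_spec ⟨_, isFiberField_frameOp hG⟩ :
    IsFiberField _ (fiber (frameOp (translates G)))).unique (isFiberField_frameOp hG)

end FiberField

/-! ### Range functions -/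

section Projection

/-- One Gram-Schmidt step. The formula also covers `v ∈ U`: the remainder is then 0 and so is the
added term. -/
theorem starProjection_span_singleton_sup {H : Type*} [NormedAddCommGroup H]
    [InnerProductSpace ℂ H] (U : Submodule ℂ H) [U.HasOrthogonalProjection] (v ξ : H)
    [(Submodule.span ℂ {v} ⊔ U).HasOrthogonalProjection] :
    (Submodule.span ℂ {v} ⊔ U).starProjection ξ = U.starProjection ξ +
      (inner ℂ (v - U.starProjection v) ξ / (‖v - U.starProjection v‖ : ℂ) ^ 2) •
        (v - U.starProjection v) := by
  set w := v - U.starProjection v with hw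
  have hwU : ∀ u ∈ U, inner ℂ u w = 0 := fun u hu =>
    (U.sub_starProjection_mem_orthogonal v) u hu
  have hwm : w ∈ Submodule.span ℂ {v} ⊔ U := Submodule.sub_mem _
    (Submodule.mem_sup_left (Submodule.mem_span_singleton_self v))
    (Submodule.mem_sup_right (U.starProjection_apply_mem v))
  have hξ : ∀ u ∈ U, inner ℂ u (ξ - U.starProjection ξ) = 0 := fun u hu =>
    (U.sub_starProjection_mem_orthogonal ξ) u hu
  refine Submodule.eq_starProjection_of_mem_orthogonal (K := Submodule.span ℂ {v} ⊔ U) ?_ ?_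
  · exact Submodule.add_mem _ (Submodule.mem_sup_right (U.starProjection_apply_mem ξ))
      (Submodule.smul_mem _ _ hwm)
  · set c := inner ℂ w ξ / (‖w‖ : ℂ) ^ 2 with hc
    have hU : ∀ u ∈ U, inner ℂ u (ξ - (U.starProjection ξ + c • w)) = 0 := by
      intro u hu
      rw [← sub_sub, inner_sub_right, hξ u hu, inner_smul_right, hwU u hu]; simp
    have hW : inner ℂ w (ξ - (U.starProjection ξ + c • w)) = 0 := by
      rw [inner_sub_right, inner_add_right, inner_smul_right, inner_self_eq_norm_sq_to_K,
        ← inner_conj_symm w (U.starProjection ξ), hwU _ (U.starProjection_apply_mem ξ)]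
      by_cases h0 : w = 0
      · simp [h0]
      · have : (‖w‖ : ℂ) ≠ 0 := by simpa using h0
        rw [hc]
        field_simp
        simp
    rw [Submodule.mem_orthogonal]
    intro y hy
    obtain ⟨a, ha, u, hu, rfl⟩ := Submodule.mem_sup.1 hy
    obtain ⟨t, rfl⟩ := Submodule.mem_span_singleton.1 ha
    have hv : v = w + U.starProjection v := by rw [hw]; abel
    rw [inner_add_left, hU u hu, inner_smul_left, hv, inner_add_left, hW,
      hU _ (U.starProjection_apply_mem v)]
    simp

instance finiteDimensional_span_range {ι H : Type*} [Finite ι] [AddCommGroup H] [Module ℂ H]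
    (v : ι → H) : FiniteDimensional ℂ (Submodule.span ℂ (Set.range v)) :=
  FiniteDimensional.span_of_finite ℂ (Set.finite_range _)

/-- Iterating the Gram-Schmidt step writes the projection through measurable operations, even where
the dimension of the span jumps. -/
theorem aestronglyMeasurable_starProjection_span {X H : Type*} [MeasurableSpace X] {μ : Measure X}
    [NormedAddCommGroup H] [InnerProductSpace ℂ H] {N : ℕ} :
    ∀ (v : Fin N → X → H) (_ : ∀ i, AEStronglyMeasurable (v i) μ) (ξ : X → H)
      (_ : AEStronglyMeasurable ξ μ), AEStronglyMeasurable
        (fun x => (Submodule.span ℂ (Set.range fun i => v i x)).starProjection (ξ x)) μ := by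
  induction N with
  | zero =>
    intro v _ ξ _
    have : ∀ x, Submodule.span ℂ (Set.range fun i => v i x) = ⊥ := fun x => by simp
    have h2 : (fun x => (Submodule.span ℂ (Set.range fun i => v i x)).starProjection (ξ x)) =
        fun _ => 0 := by
      funext x
      have h := (Submodule.span ℂ (Set.range fun i => v i x)).starProjection_apply_mem (ξ x)
      exact (Submodule.mem_bot ℂ).1 ((this x).le h)
    rw [h2]
    exact aestronglyMeasurable_const
  | succ N ih =>
    intro v hv ξ hξ
    have hP : ∀ {η : X → H}, AEStronglyMeasurable η μ → AEStronglyMeasurable (fun x =>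
        (Submodule.span ℂ (Set.range fun i : Fin N => v i.succ x)).starProjection (η x)) μ :=
      fun {η} hη => ih (fun i => v i.succ) (fun i => hv _) η hη
    have hw := (hv 0).sub (hP (hv 0))
    have h1 := (hP hξ).add (((hw.inner (𝕜 := ℂ) hξ).div₀
      ((Complex.continuous_ofReal.comp_aestronglyMeasurable hw.norm).pow 2)).smul hw)
    refine h1.congr (Filter.Eventually.of_forall fun x => ?_)
    have e : Submodule.span ℂ (Set.range fun i => v i x) = Submodule.span ℂ {v 0 x} ⊔
        Submodule.span ℂ (Set.range fun i : Fin N => v i.succ x) := by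
      rw [← Submodule.span_union]
      congr 1
      ext y
      simp [Fin.exists_fin_succ, eq_comm]
    have h2 := starProjection_span_singleton_sup
      (Submodule.span ℂ (Set.range fun i : Fin N => v i.succ x)) (v 0 x) (ξ x)
    simp only [← e] at h2
    exact h2.symm

end Projection

section RangeFunction

open Filter Topology

variable {k N : ℕ}

/-- The span of the fibers of a finite family. -/
def fiberSpan (Φ : Fin N → L2 k) (x : Space k) : Submodule ℂ (SeqSpace k) :=
  Submodule.span ℂ (Set.range fun a => Gam (Φ a) x)

instance (Φ : Fin N → L2 k) (x : Space k) : FiniteDimensional ℂ (fiberSpan Φ x) :=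
  finiteDimensional_span_range _

theorem Gam_mem_fiberSpan (Φ : Fin N → L2 k) (a : Fin N) (x : Space k) :
    Gam (Φ a) x ∈ fiberSpan Φ x := Submodule.subset_span ⟨a, rfl⟩

theorem mem_fiberSpan_orthogonal {Φ : Fin N → L2 k} {x : Space k} {η : SeqSpace k} :
    η ∈ (fiberSpan Φ x)ᗮ ↔ ∀ a, inner ℂ (Gam (Φ a) x) η = 0 := by
  refine ⟨fun h a => h _ (Gam_mem_fiberSpan Φ a x), fun h => ?_⟩
  rw [Submodule.mem_orthogonal]
  intro u hu
  induction hu using Submodule.span_induction with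
  | mem u hu => obtain ⟨a, rfl⟩ := hu; exact h a
  | zero => simp
  | add a b _ _ ha hb => rw [inner_add_left, ha, hb, add_zero]
  | smul c a _ ha => rw [inner_smul_left, ha, mul_zero]

/-- Orthogonality to all translates of Φ_a says that every Fourier coefficient of ⟨ΓΦ_a, Γg⟩
vanishes. -/
theorem mem_shiftSpan_orthogonal {Φ : Fin N → L2 k} {g : L2 k} :
    g ∈ (shiftSpan (Set.range Φ))ᗮ ↔ ∀ᵐ x ∂(torusMeasure k), Gam g x ∈ (fiberSpan Φ x)ᗮ := by
  have h1 : g ∈ (shiftSpan (Set.range Φ))ᗮ ↔ ∀ a l, inner ℂ (shiftOp l (Φ a)) g = 0 := by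
    rw [shiftSpan, Submodule.orthogonal_closure]
    refine ⟨fun h a l => h _ (Submodule.subset_span ⟨Φ a, ⟨a, rfl⟩, l, rfl⟩), fun h => ?_⟩
    rw [Submodule.mem_orthogonal]
    intro u hu
    induction hu using Submodule.span_induction with
    | mem u hu => obtain ⟨_, ⟨a, rfl⟩, l, rfl⟩ := hu; exact h a l
    | zero => simp
    | add a b _ _ ha hb => rw [inner_add_left, ha, hb, add_zero]
    | smul c a _ ha => rw [inner_smul_left, ha, mul_zero]
  simp only [h1, mem_fiberSpan_orthogonal, ae_all_iff, inner_shiftOp]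
  refine forall_congr' fun a => ⟨fun h => ?_, fun h l => ?_⟩
  · exact ae_eq_zero_of_torusCoeff_eq_zero (integrable_inner_Gam _ _) fun l => by
      simpa using h (-l)
  · rw [torusCoeff]
    refine integral_eq_zero_of_ae ?_
    filter_upwards [h] with x hx
    simp [hx]

/-- A closed subspace is its double orthogonal. If `f` lies in it, the fibrewise residual of Γf off
the span of fibres is Γg for some `g` orthogonal to the space, and ⟨g, f⟩ = ‖g‖² forces g = 0. -/
theorem mem_shiftSpan_iff {Φ : Fin N → L2 k} {f : L2 k} :
    f ∈ shiftSpan (Set.range Φ) ↔ ∀ᵐ x ∂(torusMeasure k), Gam f x ∈ fiberSpan Φ x := by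
  have hc : (shiftSpan (Set.range Φ))ᗮᗮ = shiftSpan (Set.range Φ) :=
    Submodule.orthogonal_orthogonal_eq_closure _ |>.trans
      (Submodule.isClosed_topologicalClosure _).submodule_topologicalClosure_eq
  rw [← hc]
  constructor
  · intro h
    have hm : MemLp (fun x => Gam f x - (fiberSpan Φ x).starProjection (Gam f x)) 2
        (torusMeasure k) := by
      refine MemLp.of_le_mul (c := 1) (memLp_Gam f) ((aestronglyMeasurable_Gam f).sub
        (aestronglyMeasurable_starProjection_span (fun a => Gam (Φ a))
          (fun a => aestronglyMeasurable_Gam _) _ (aestronglyMeasurable_Gam f))) ?_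
      refine Eventually.of_forall fun x => ?_
      rw [one_mul, ← Submodule.starProjection_orthogonal_val]
      exact Submodule.norm_starProjection_apply_le _ _
    obtain ⟨g, hg⟩ := exists_Gam_eq hm
    have hgo : g ∈ (shiftSpan (Set.range Φ))ᗮ := by
      rw [mem_shiftSpan_orthogonal]
      filter_upwards [hg] with x hx
      rw [hx]
      exact Submodule.sub_starProjection_mem_orthogonal _
    have h0 := h g hgo
    have h1 : inner ℂ g f = inner ℂ g g := by
      rw [inner_eq_integral_Gam, inner_eq_integral_Gam]
      refine integral_congr_ae ?_
      filter_upwards [hg] with x hx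
      have h2 : inner ℂ (Gam g x) ((fiberSpan Φ x).starProjection (Gam f x)) = 0 := by
        rw [hx]
        exact Submodule.inner_left_of_mem_orthogonal (Submodule.starProjection_apply_mem _ _)
          (Submodule.sub_starProjection_mem_orthogonal _)
      have h3 : inner ℂ (Gam g x) (Gam g x) = inner ℂ (Gam g x) (Gam f x) -
          inner ℂ (Gam g x) ((fiberSpan Φ x).starProjection (Gam f x)) := by
        rw [← inner_sub_right, ← hx]
      rw [h3, h2, sub_zero]
    rw [h0] at h1
    have hg0 : g = 0 := inner_self_eq_zero.1 h1.symm
    filter_upwards [hg, Gam_smul 0 g] with x hx h3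
    rw [hg0] at hx h3
    simp only [smul_zero, zero_smul] at h3
    rw [h3] at hx
    rw [sub_eq_zero.1 hx.symm]
    exact Submodule.starProjection_apply_mem _ _
  · intro h
    rw [Submodule.mem_orthogonal]
    intro g hg
    rw [inner_eq_integral_Gam]
    refine integral_eq_zero_of_ae ?_
    filter_upwards [h, mem_shiftSpan_orthogonal.1 hg] with x h1 h2
    exact Submodule.inner_left_of_mem_orthogonal h1 h2

theorem isRangeFunction_fiberSpan (Φ : Fin N → L2 k) :
    IsRangeFunction (shiftSpan (Set.range Φ))
      fun x => ⟨fiberSpan Φ x, (fiberSpan Φ x).closed_of_finiteDimensional⟩ := by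
  refine ⟨fun ξ η => ?_, fun f => mem_shiftSpan_iff⟩
  exact (aestronglyMeasurable_const.inner (𝕜 := ℂ) (aestronglyMeasurable_starProjection_span
    (fun a => Gam (Φ a)) (fun a => aestronglyMeasurable_Gam _) (fun _ => ξ)
      aestronglyMeasurable_const)).aemeasurable

/-- Projecting the unit vectors onto J(x) gives fibres of countably many elements of V, so these
projections also lie in J'(x); by density the whole of J(x) does. -/
theorem IsRangeFunction.ae_le {V : Submodule ℂ (L2 k)}
    {J J' : Space k → ClosedSubmodule ℂ (SeqSpace k)} (hJ : IsRangeFunction V J)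
    (hJ' : IsRangeFunction V J') : ∀ᵐ x ∂(torusMeasure k), (J x).toSubmodule ≤ (J' x).toSubmodule := by
  have hm : ∀ l : Fin k → ℤ, MemLp (fun x => (J x).toSubmodule.starProjection (lp.single 2 l 1)) 2
      (torusMeasure k) := by
    intro l
    refine MemLp.of_bound (seqSpace_aestronglyMeasurable fun m => ?_)
      ‖(lp.single 2 l 1 : SeqSpace k)‖
      (Eventually.of_forall fun x => Submodule.norm_starProjection_apply_le _ _)
    refine (hJ.1 (lp.single 2 l 1) (lp.single 2 m 1)).aestronglyMeasurable.congr
      (Eventually.of_forall fun x => ?_)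
    simp only [lp.inner_single_left]
    simp
  choose f hf using fun l => exists_Gam_eq (hm l)
  have hfV : ∀ l, f l ∈ V := fun l => by
    rw [hJ.2]
    filter_upwards [hf l] with x hx
    rw [hx]
    exact Submodule.starProjection_apply_mem _ _
  filter_upwards [ae_all_iff.2 hf, ae_all_iff.2 fun l => (hJ'.2 (f l)).1 (hfV l)] with x h1 h2
  have h4 : ((J' x).toSubmodule.comap ((J x).toSubmodule.starProjection : SeqSpace k →ₗ[ℂ] _)) = ⊤ := by
    refine seqSpace_dense_single ?_ fun l => ?_
    · exact (J' x).isClosed.preimage ((J x).toSubmodule.starProjection).continuous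
    · have := h2 l
      rw [h1 l] at this
      exact this
  intro ξ hξ
  have h5 : ξ ∈ ((J' x).toSubmodule.comap
      ((J x).toSubmodule.starProjection : SeqSpace k →ₗ[ℂ] _)) := by rw [h4]; trivial
  have h6 : (J x).toSubmodule.starProjection ξ = ξ := Submodule.starProjection_eq_self_iff.2 hξ
  rw [Submodule.mem_comap] at h5
  change (J x).toSubmodule.starProjection ξ ∈ _ at h5
  rwa [h6] at h5

theorem rangeFunction_shiftSpan (Φ : Fin N → L2 k) : ∀ᵐ x ∂(torusMeasure k),
    (rangeFunction (shiftSpan (Set.range Φ)) x).toSubmodule = fiberSpan Φ x := by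
  have h1 := isRangeFunction_fiberSpan Φ
  have h2 : IsRangeFunction _ (rangeFunction (shiftSpan (Set.range Φ))) :=
    Classical.epsilon_spec ⟨_, h1⟩
  filter_upwards [h1.ae_le h2, h2.ae_le h1] with x h3 h4
  exact le_antisymm h4 h3

theorem IsFSI.exists_generators {V : Submodule ℂ (L2 k)} (hV : IsFSI V) :
    ∃ (N : ℕ) (Φ : Fin N → L2 k), V = shiftSpan (Set.range Φ) := by
  obtain ⟨A, hA, rfl⟩ := hV
  obtain ⟨N, Φ, hΦ⟩ := hA.fin_embedding
  exact ⟨N, Φ, by rw [hΦ]⟩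

theorem isClosed_shiftSpan (A : Set (L2 k)) : IsClosed (shiftSpan A : Set (L2 k)) :=
  Submodule.isClosed_topologicalClosure _

theorem shiftOp_mem_shiftSpan {Φ : Fin N → L2 k} {f : L2 k} (l : Fin k → ℤ)
    (hf : f ∈ shiftSpan (Set.range Φ)) : shiftOp l f ∈ shiftSpan (Set.range Φ) := by
  rw [mem_shiftSpan_iff] at hf ⊢
  filter_upwards [hf, Gam_shiftOp l f] with x h1 h2
  rw [h2]
  exact Submodule.smul_mem _ _ h1

theorem shiftOp_mem_shiftSpan_orthogonal {Φ : Fin N → L2 k} {f : L2 k} (l : Fin k → ℤ)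
    (hf : f ∈ (shiftSpan (Set.range Φ))ᗮ) : shiftOp l f ∈ (shiftSpan (Set.range Φ))ᗮ := by
  rw [mem_shiftSpan_orthogonal] at hf ⊢
  filter_upwards [hf, Gam_shiftOp l f] with x h1 h2
  rw [h2]
  exact Submodule.smul_mem _ _ h1

end RangeFunction

/-! ### The pseudo-inverse of a frame operator -/

section Pinv

variable {H : Type*} [NormedAddCommGroup H] [InnerProductSpace ℂ H] {ι : Type*}
  {W : Submodule ℂ H} {F : ι → H}

theorem IsFrameFor.inner_starProjection [W.HasOrthogonalProjection] (hF : IsFrameFor F W) (i : ι)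
    (f : H) : inner ℂ (F i) (W.starProjection f) = inner ℂ (F i) f := by
  rw [← sub_eq_zero, ← inner_sub_right, ← neg_sub, inner_neg_right, neg_eq_zero]
  exact W.sub_starProjection_mem_orthogonal f _ (hF.1 i)

theorem IsFrameFor.isBessel [W.HasOrthogonalProjection] (hF : IsFrameFor F W) : IsBessel F := by
  obtain ⟨a, b, ha, hab, h⟩ := hF.2
  refine ⟨b, fun f => ?_⟩
  have h1 := h _ (W.starProjection_apply_mem f)
  simp only [hF.inner_starProjection] at h1
  refine ⟨h1.1, h1.2.2.trans ?_⟩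
  have : ‖W.starProjection f‖ ≤ ‖f‖ := W.norm_starProjection_apply_le f
  exact mul_le_mul_of_nonneg_left (pow_le_pow_left₀ (norm_nonneg _) this 2) (by linarith)

variable [CompleteSpace H]

theorem IsBessel.map {H' : Type*} [NormedAddCommGroup H'] [InnerProductSpace ℂ H']
    [CompleteSpace H'] (hF : IsBessel F) (R : H →L[ℂ] H') : IsBessel fun i => R (F i) := by
  obtain ⟨b, h⟩ := hF
  refine ⟨max b 0 * ‖ContinuousLinearMap.adjoint R‖ ^ 2, fun f => ?_⟩
  simp only [← ContinuousLinearMap.adjoint_inner_right]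
  refine ⟨(h _).1, (h _).2.trans ?_⟩
  rw [mul_assoc, ← mul_pow]
  exact mul_le_mul (le_max_left _ _) (pow_le_pow_left₀ (norm_nonneg _)
    ((ContinuousLinearMap.adjoint R).le_opNorm f) 2) (sq_nonneg _) (le_max_right _ _)

theorem frameOp_eq (F : ι → H) (f : H) : frameOp F f = synthesisOp F (analysisOp F f) := rfl

theorem frameOp_mem [W.HasOrthogonalProjection] (hF : IsFrameFor F W) (f : H) :
    frameOp F f ∈ W := by
  rw [← W.orthogonal_orthogonal, Submodule.mem_orthogonal]
  intro u hu
  have h := hasSum_inner_mixed hF.isBessel hF.isBessel u f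
  have h0 : ∀ i, inner ℂ u (F i) = 0 := fun i => Submodule.inner_left_of_mem_orthogonal (hF.1 i) hu
  simp only [h0, zero_mul] at h
  exact h.unique hasSum_zero

theorem frameOp_starProjection [W.HasOrthogonalProjection] (hF : IsFrameFor F W) (f : H) :
    frameOp F (W.starProjection f) = frameOp F f := by
  have h1 := hasSum_mixed hF.isBessel hF.isBessel (W.starProjection f)
  simp only [hF.inner_starProjection] at h1
  exact h1.unique (hasSum_mixed hF.isBessel hF.isBessel f)

theorem inner_frameOp_self (hF : IsBessel F) (f : H) :
    HasSum (fun i => ((‖inner ℂ (F i) f‖ ^ 2 : ℝ) : ℂ)) (inner ℂ f (frameOp F f)) := by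
  refine (hasSum_inner_mixed hF hF f f).congr_fun fun i => ?_
  rw [← inner_conj_symm f (F i), mul_comm, Complex.mul_conj, Complex.normSq_eq_norm_sq]

theorem frameOp_adjoint (F : ι → H) : ContinuousLinearMap.adjoint (frameOp F) = frameOp F := by
  simp [frameOp, synthesisOp, ContinuousLinearMap.adjoint_comp]

theorem frameOp_bddBelow [W.HasOrthogonalProjection] (hF : IsFrameFor F W) :
    ∃ a : ℝ, 0 < a ∧ ∀ f ∈ W, ∃ t : ℝ, inner ℂ f (frameOp F f) = (t : ℂ) ∧ a * ‖f‖ ^ 2 ≤ t := by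
  obtain ⟨a, b, ha, hab, h⟩ := hF.2
  refine ⟨a, ha, fun f hf => ⟨_, ?_, (h f hf).2.1⟩⟩
  have h1 := (inner_frameOp_self hF.isBessel f).tsum_eq
  rw [← h1, Complex.ofReal_tsum]

theorem frameOp_injOn [W.HasOrthogonalProjection] (hF : IsFrameFor F W) {f : H} (hf : f ∈ W)
    (h0 : frameOp F f = 0) : f = 0 := by
  obtain ⟨a, ha, h⟩ := frameOp_bddBelow hF
  obtain ⟨t, h1, h2⟩ := h f hf
  rw [h0, inner_zero_right] at h1
  have : t = 0 := by exact_mod_cast h1.symm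
  have h3 : ‖f‖ ^ 2 ≤ 0 := by nlinarith
  simpa using le_antisymm h3 (sq_nonneg _)

/-- With P the orthogonal projection onto W, T = S + (1 - P) has a quadratic form bounded below by
min(a, 1), so T is invertible, and T⁻¹P is the pseudo-inverse. -/
theorem exists_isMoorePenrose [W.HasOrthogonalProjection] (hF : IsFrameFor F W) :
    ∃ B, IsMoorePenrose (frameOp F) B ∧ ∀ w ∈ W, frameOp F (B w) = w := by
  set P := W.starProjection
  set T : H →L[ℂ] H := frameOp F + (ContinuousLinearMap.id ℂ H - P) with hT
  obtain ⟨a, ha, h⟩ := frameOp_bddBelow hF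
  have hunit : IsUnit T := by
    refine ContinuousLinearMap.isUnit_of_forall_le_norm_inner_map T
      (c := (min a 1).toNNReal) (by simp [ha]) fun f => ?_
    obtain ⟨t, h1, h2⟩ := h (P f) (W.starProjection_apply_mem f)
    have h3 : inner ℂ (P f) (f - P f) = 0 :=
      W.sub_starProjection_mem_orthogonal f _ (W.starProjection_apply_mem f)
    have h4 : inner ℂ f (frameOp F f) = (t : ℂ) := by
      rw [← h1, frameOp_starProjection hF]
      conv_lhs => rw [← add_sub_cancel (P f) f]
      rw [inner_add_left, Submodule.inner_left_of_mem_orthogonal (frameOp_mem hF _)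
        (W.sub_starProjection_mem_orthogonal f), add_zero]
      simp
    have h5 : inner ℂ f (f - P f) = ((‖f - P f‖ ^ 2 : ℝ) : ℂ) := by
      conv_lhs => rw [← add_sub_cancel (P f) f]
      rw [inner_add_left]
      simp only [add_sub_cancel]
      rw [h3, zero_add, inner_self_eq_norm_sq_to_K]
      simp
    have h6 : ‖f‖ ^ 2 = ‖P f‖ ^ 2 + ‖f - P f‖ ^ 2 := by
      have := norm_add_sq_eq_norm_sq_add_norm_sq_of_inner_eq_zero (𝕜 := ℂ) (P f) (f - P f) h3
      rw [add_sub_cancel] at this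
      nlinarith [this]
    have h7 : inner ℂ f (T f) = ((t + ‖f - P f‖ ^ 2 : ℝ) : ℂ) := by
      rw [hT]
      simp only [add_apply, sub_apply,
        ContinuousLinearMap.id_apply, inner_add_right, h4, h5]
      push_cast; rfl
    rw [norm_inner_symm, h7, Complex.norm_real]
    refine le_trans ?_ (le_abs_self _)
    rw [h6, Real.coe_toNNReal _ (le_min ha.le zero_le_one)]
    nlinarith [min_le_left a 1, min_le_right a 1, sq_nonneg ‖P f‖, sq_nonneg ‖f - P f‖]
  obtain ⟨u, hu⟩ := hunit
  have hTu : ∀ y, T ((↑u⁻¹ : H →L[ℂ] H) y) = y := fun y => by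
    rw [← hu]; exact congrArg (fun g : H →L[ℂ] H => g y) u.mul_inv
  have huT : ∀ y, (↑u⁻¹ : H →L[ℂ] H) (T y) = y := fun y => by
    rw [← hu]; exact congrArg (fun g : H →L[ℂ] H => g y) u.inv_mul
  have hPw : ∀ w ∈ W, P w = w := fun w hw => Submodule.starProjection_eq_self_iff.2 hw
  have hPm : ∀ f, P f ∈ W := W.starProjection_apply_mem
  have hw : ∀ w ∈ W, (↑u⁻¹ : H →L[ℂ] H) w ∈ W ∧ frameOp F ((↑u⁻¹ : H →L[ℂ] H) w) = w := by
    intro w hw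
    set y := (↑u⁻¹ : H →L[ℂ] H) w with hy
    have h1 : frameOp F y + (y - P y) = w := hTu w
    have h2 : y - P y = 0 := by
      have h3 : y - P y ∈ W := by
        rw [← eq_sub_iff_add_eq'] at h1
        rw [h1]; exact W.sub_mem hw (frameOp_mem hF _)
      exact inner_self_eq_zero.1 (W.sub_starProjection_mem_orthogonal y _ h3)
    rw [h2, add_zero] at h1
    refine ⟨?_, h1⟩
    rw [sub_eq_zero.1 h2]; exact hPm y
  set B : H →L[ℂ] H := (↑u⁻¹ : H →L[ℂ] H) ∘L P with hB
  have hAB : frameOp F ∘L B = P := by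
    ext1 f; exact (hw _ (hPm f)).2
  have hBA : B ∘L frameOp F = P := by
    ext1 f
    have h1 : T (P f) = frameOp F f := by
      rw [hT]
      simp [hPw _ (hPm f), P, frameOp_starProjection hF]
    change (↑u⁻¹ : H →L[ℂ] H) (P (frameOp F f)) = P f
    rw [hPw _ (frameOp_mem hF f), ← h1, huT]
  have hPa : ContinuousLinearMap.adjoint P = P :=
    (ContinuousLinearMap.isSelfAdjoint_iff'.1 (isSelfAdjoint_starProjection W))
  refine ⟨B, ⟨?_, ?_, ?_, ?_⟩, fun w hw' => ?_⟩
  · rw [hBA]; ext1 f; exact frameOp_starProjection hF f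
  · rw [hAB]; ext1 f
    change (↑u⁻¹ : H →L[ℂ] H) (P (P f)) = (↑u⁻¹ : H →L[ℂ] H) (P f)
    rw [hPw _ (hPm f)]
  · rw [hAB, hPa]
  · rw [hBA, hPa]
  · have := congrArg (fun g : H →L[ℂ] H => g w) hAB
    exact this.trans (hPw w hw')

theorem isMoorePenrose_pinv [W.HasOrthogonalProjection] (hF : IsFrameFor F W) :
    IsMoorePenrose (frameOp F) (pinv (frameOp F)) :=
  let ⟨_, hB, _⟩ := exists_isMoorePenrose hF
  Classical.epsilon_spec ⟨_, hB⟩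

/-- Only the Penrose equations are used. BAB = B and self-adjointness of BA put the range of B in W,
because A kills Wᗮ; ABA = A at a preimage of `w` gives the second claim. -/
theorem pinv_frameOp_apply [W.HasOrthogonalProjection] (hF : IsFrameFor F W) {w : H} (hw : w ∈ W) :
    pinv (frameOp F) w ∈ W ∧ frameOp F (pinv (frameOp F) w) = w := by
  obtain ⟨B, -, hB⟩ := exists_isMoorePenrose hF
  obtain ⟨h1, h2, -, h4⟩ := isMoorePenrose_pinv hF
  constructor
  · rw [← W.orthogonal_orthogonal, Submodule.mem_orthogonal]
    intro u hu
    have e : pinv (frameOp F) w =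
        (pinv (frameOp F) ∘L frameOp F) (pinv (frameOp F) w) :=
      (congrArg (fun g : H →L[ℂ] H => g w) h2).symm
    rw [e, ← h4, ContinuousLinearMap.adjoint_inner_right]
    have h0 : frameOp F u = 0 := by
      rw [← frameOp_starProjection hF, (W.starProjection_apply_eq_zero_iff).2 hu, map_zero]
    simp [h0]
  · have h5 := congrArg (fun g : H →L[ℂ] H => g (B w)) h1
    simp only [ContinuousLinearMap.comp_apply, hB w hw] at h5
    exact h5

theorem pinv_frameOp_frameOp [W.HasOrthogonalProjection] (hF : IsFrameFor F W) (f : H) :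
    pinv (frameOp F) (frameOp F f) = W.starProjection f := by
  have h1 := pinv_frameOp_apply hF (frameOp_mem hF f)
  rw [← sub_eq_zero]
  refine frameOp_injOn hF (W.sub_mem h1.1 (W.starProjection_apply_mem f)) ?_
  rw [map_sub, h1.2, frameOp_starProjection hF, sub_self]

end Pinv

/-! ### The canonical oblique dual -/

section CanonicalDual

variable {k n N M : ℕ} {Φ : Fin N → L2 k} {Ψ : Fin M → L2 k} {F : Fin n → L2 k}

theorem shiftOp_zero (f : L2 k) : shiftOp 0 f = f := by
  refine Gam_injective ?_
  filter_upwards [Gam_shiftOp 0 f] with x hx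
  rw [hx, chr_eq_exp]
  simp

theorem frameOp_shiftOp (hF : IsBddFam F) (l : Fin k → ℤ) (f : L2 k) :
    frameOp (translates F) (shiftOp l f) = shiftOp l (frameOp (translates F) f) := by
  refine Gam_injective ?_
  filter_upwards [Gam_mixed hF hF f, Gam_mixed hF hF (shiftOp l f), Gam_shiftOp l f,
    Gam_shiftOp l (frameOp (translates F) f)] with x h1 h2 h3 h4
  rw [h4, frameOp_eq, frameOp_eq, h1, h2, h3, Finset.smul_sum]
  simp only [inner_smul_right, smul_smul]

/-- The data that determine the canonical dual: `S w i = F i` and `g i` is the oblique projection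
of `w i`. -/
theorem canonicalDual_spec {V W : Submodule ℂ (L2 k)} (hV : V = shiftSpan (Set.range Φ))
    (hW : W = shiftSpan (Set.range Ψ)) (hVW : IsCompl V Wᗮ) (hF : IsFrameFor (translates F) W) :
    IsBddFam F ∧ IsBddFam (canonicalDual V W hVW F) ∧ (∀ i, canonicalDual V W hVW F i ∈ V) ∧
    (∀ i, F i ∈ W) ∧
    (∃ w : Fin n → L2 k, ∀ i, w i ∈ W ∧ canonicalDual V W hVW F i - w i ∈ Wᗮ ∧
      frameOp (translates F) (w i) = F i) ∧
    ∀ v ∈ V, synthesisOp (translates (canonicalDual V W hVW F))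
      (analysisOp (translates F) v) = v := by
  have hVc : IsClosed (V : Set (L2 k)) := hV ▸ isClosed_shiftSpan _
  have hWc : IsClosed (W : Set (L2 k)) := hW ▸ isClosed_shiftSpan _
  have hVs : ∀ l {f}, f ∈ V → shiftOp l f ∈ V := fun l f hf => by
    rw [hV] at hf ⊢; exact shiftOp_mem_shiftSpan l hf
  have hWs : ∀ l {f}, f ∈ W → shiftOp l f ∈ W := fun l f hf => by
    rw [hW] at hf ⊢; exact shiftOp_mem_shiftSpan l hf
  have hWos : ∀ l {f}, f ∈ Wᗮ → shiftOp l f ∈ Wᗮ := fun l f hf => by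
    rw [hW] at hf ⊢; exact shiftOp_mem_shiftSpan_orthogonal l hf
  have : CompleteSpace W := hWc.completeSpace_coe
  set S := frameOp (translates F) with hS
  have hFb := isBddFam_of_isBessel hF.isBessel
  have hFW : ∀ i, F i ∈ W := fun i => by
    have := hF.1 (0, i)
    simpa [translates, shiftOp_zero] using this
  have htop := Submodule.IsCompl.isTopCompl_of_isClosed hVW hVc (Submodule.isClosed_orthogonal _)
  set Q : L2 k →L[ℂ] L2 k := ⟨V.projection Wᗮ hVW, htop.continuous_projection⟩ with hQ
  have hQm : ∀ f, Q f ∈ V := fun f => Submodule.projection_apply_mem hVW f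
  have hQs : ∀ f, f - Q f ∈ Wᗮ := fun f => Submodule.sub_projection_mem hVW f
  -- The oblique projection is characterised by membership in V and a residual in Wᗮ. Both
  -- conditions are shift invariant, so it commutes with shifts.
  have hQu : ∀ {f v}, v ∈ V → f - v ∈ Wᗮ → Q f = v := by
    intro f v hv hfv
    have h1 : Q f - v ∈ V ⊓ Wᗮ := ⟨V.sub_mem (hQm f) hv, by
      have := Wᗮ.sub_mem hfv (hQs f); simpa using this⟩
    rw [hVW.inf_eq_bot] at h1
    exact sub_eq_zero.1 ((Submodule.mem_bot ℂ).1 h1)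
  set w : Fin n → L2 k := fun i => pinv S (F i) with hw
  have hwi : ∀ i, w i ∈ W ∧ S (w i) = F i := fun i => pinv_frameOp_apply hF (hFW i)
  have hg : ∀ i, canonicalDual V W hVW F i = Q (w i) := fun i => rfl
  -- As a bounded image of the family E(F), the dual inherits the Bessel property.
  have htr : translates (canonicalDual V W hVW F) = fun p => (Q ∘L pinv S) (translates F p) := by
    funext ⟨l, i⟩
    have h1 : pinv S (shiftOp l (F i)) = shiftOp l (w i) := by
      have h2 := pinv_frameOp_apply hF (hWs l (hFW i))
      rw [← sub_eq_zero]
      refine frameOp_injOn hF (W.sub_mem h2.1 (hWs l (hwi i).1)) ?_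
      rw [map_sub, h2.2, frameOp_shiftOp hFb, (hwi i).2, sub_self]
    change shiftOp l (Q (w i)) = Q (pinv S (shiftOp l (F i)))
    rw [h1]
    refine (hQu (hVs l (hQm _)) ?_).symm
    rw [← map_sub]
    exact hWos l (hQs _)
  have hgB : IsBessel (translates (canonicalDual V W hVW F)) := by
    rw [htr]
    exact hF.isBessel.map _
  refine ⟨hFb, isBddFam_of_isBessel hgB, fun i => hQm _, hFW, ⟨w, fun i => ⟨(hwi i).1, ?_, (hwi i).2⟩⟩,
    fun v hv => ?_⟩
  · rw [hg, ← neg_sub]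
    exact Wᗮ.neg_mem (hQs _)
  · have h1 := hasSum_mixed hgB hF.isBessel v
    have h2 := (hasSum_mixed hF.isBessel hF.isBessel v).mapL (Q ∘L pinv S)
    simp only [map_smul] at h2
    rw [htr] at h1 ⊢
    rw [h1.unique h2]
    -- S†S is the orthogonal projection onto W, and `v` differs from its image by an element of Wᗮ,
    -- which Q removes.
    change Q (pinv S (S v)) = v
    rw [hS, pinv_frameOp_frameOp hF]
    refine hQu hv ?_
    rw [← neg_sub]
    exact Wᗮ.neg_mem (W.sub_starProjection_mem_orthogonal v)

end CanonicalDual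

/-! ### Interlacing and finite rank perturbations of Hermitian matrices -/

section Interlacing

open Filter Topology Polynomial Matrix

/-- The leading terms cancel, so the difference of products has degree below `d` and is its Lagrange
interpolant at the nodes `a i`. The order b₀ > a₀ > b₁ > a₁ > ... makes the coefficients
nonnegative. -/
theorem exists_coeff_of_strict_interlacing {d : ℕ} {a b : Fin d → ℝ} (hab : ∀ i, a i < b i)
    (hba : ∀ i j, i < j → b j < a i) :
    ∃ c : Fin d → ℝ, (∀ i, 0 ≤ c i) ∧ ∀ t : ℝ, ∏ i, (t - a i) - ∏ i, (t - b i) =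
      ∑ i, c i * ∏ j ∈ Finset.univ.erase i, (t - a j) := by
  have haa : ∀ i j, i < j → a j < a i := fun i j hij => (hab j).trans (hba i j hij)
  set c : Fin d → ℝ := fun i =>
    (b i - a i) * ∏ j ∈ Finset.univ.erase i, ((a i - b j) / (a i - a j)) with hc
  refine ⟨c, fun i => mul_nonneg (sub_nonneg.2 (hab i).le) (Finset.prod_nonneg fun j hj => ?_), ?_⟩
  · rcases lt_or_gt_of_ne (Finset.ne_of_mem_erase hj) with h | h
    · exact div_nonneg_of_nonpos (by linarith [haa j i h, hab j]) (by linarith [haa j i h])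
    · exact div_nonneg (by linarith [hba i j h]) (by linarith [haa i j h])
  · set p : ℝ[X] := ∏ i, (X - C (a i)) - ∏ i, (X - C (b i)) with hp
    set q : ℝ[X] := ∑ i, C (c i) * ∏ j ∈ Finset.univ.erase i, (X - C (a j)) with hq
    have hpq : p = q := by
      refine eq_of_degrees_lt_of_eval_index_eq Finset.univ (v := a) ?_ ?_ ?_ ?_
      · intro i _ j _ hij
        by_contra hne
        rcases lt_or_gt_of_ne hne with h | h
        · exact (haa i j h).ne hij.symm
        · exact (haa j i h).ne hij
      · have h1 : (∏ i, (X - C (a i))).degree = ((Finset.univ : Finset (Fin d)).card : WithBot ℕ) := by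
          rw [degree_prod]; simp
        have h2 : (∏ i, (X - C (b i))).degree = ((Finset.univ : Finset (Fin d)).card : WithBot ℕ) := by
          rw [degree_prod]; simp
        rw [hp, ← h1]
        refine degree_sub_lt_left (h1.trans h2.symm) (Finset.prod_ne_zero_iff.2 fun i _ =>
          X_sub_C_ne_zero _) ?_
        rw [(monic_prod_of_monic _ _ fun i _ => monic_X_sub_C (a i)).leadingCoeff,
          (monic_prod_of_monic _ _ fun i _ => monic_X_sub_C (b i)).leadingCoeff]
      · rw [hq]
        refine (degree_sum_le _ _).trans_lt ?_
        rw [Finset.sup_lt_iff (by exact_mod_cast WithBot.bot_lt_coe _)]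
        intro i _
        refine (degree_mul_le _ _).trans_lt ?_
        refine (add_le_add_left degree_C_le _).trans_lt ?_
        rw [zero_add, degree_prod]
        simp only [degree_X_sub_C, Finset.sum_const, nsmul_one]
        exact_mod_cast Finset.card_erase_lt_of_mem (Finset.mem_univ i)
      · intro i _
        rw [hp, hq, eval_sub, eval_finsetSum, eval_prod, eval_prod,
          Finset.prod_eq_zero (Finset.mem_univ i) (by simp), Finset.sum_eq_single i]
        · simp only [eval_mul, eval_C, eval_prod, eval_sub, eval_X, hc]
          rw [mul_assoc, ← Finset.prod_mul_distrib, ← Finset.mul_prod_erase _ _ (Finset.mem_univ i)]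
          have : ∏ j ∈ Finset.univ.erase i, ((a i - b j) / (a i - a j) * (a i - a j)) =
              ∏ j ∈ Finset.univ.erase i, (a i - b j) := by
            refine Finset.prod_congr rfl fun j hj => div_mul_cancel₀ _ ?_
            rcases lt_or_gt_of_ne (Finset.ne_of_mem_erase hj) with h | h
            · linarith [haa j i h]
            · linarith [haa i j h]
          rw [this]; ring
        · intro j _ hj
          rw [eval_mul, eval_prod, Finset.prod_eq_zero (Finset.mem_erase.2 ⟨hj.symm,
            Finset.mem_univ i⟩) (by simp), mul_zero]
        · intro h; exact absurd (Finset.mem_univ i) h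
    intro t
    have := congrArg (eval t) hpq
    simpa [hp, hq, eval_finsetSum, eval_prod] using this

theorem exists_coeff_of_interlacing {d : ℕ} {a b : Fin d → ℝ} (hab : ∀ i, a i ≤ b i)
    (hba : ∀ i j, i < j → b j ≤ a i) :
    ∃ c : Fin d → ℝ, (∀ i, 0 ≤ c i) ∧ ∀ t : ℝ, ∏ i, (t - a i) - ∏ i, (t - b i) =
      ∑ i, c i * ∏ j ∈ Finset.univ.erase i, (t - a j) := by
  -- Shifting the merged list b₀, a₀, b₁, a₁, ... by ε, 0, -ε, -2ε, ... makes the interlacing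
  -- strict.
  set A : ℝ → Fin d → ℝ := fun ε i => a i - 2 * i * ε with hA
  set B : ℝ → Fin d → ℝ := fun ε i => b i - (2 * i - 1) * ε with hB
  set ε : ℕ → ℝ := fun m => 1 / ((m : ℝ) + 1) with hε
  have hε0 : ∀ m, 0 < ε m := fun m => Nat.one_div_pos_of_nat
  have hεt : Tendsto ε atTop (𝓝 0) := tendsto_one_div_add_atTop_nhds_zero_nat
  have hex : ∀ m, ∃ c : Fin d → ℝ, (∀ i, 0 ≤ c i) ∧ ∀ t : ℝ,
      ∏ i, (t - A (ε m) i) - ∏ i, (t - B (ε m) i) =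
      ∑ i, c i * ∏ j ∈ Finset.univ.erase i, (t - A (ε m) j) := by
    intro m
    refine exists_coeff_of_strict_interlacing (fun i => ?_) fun i j hij => ?_
    · simp only [hA, hB]; nlinarith [hab i, hε0 m]
    · have h1 : (i : ℝ) + 1 ≤ j := by exact_mod_cast hij
      simp only [hA, hB]; nlinarith [hba i j hij, hε0 m]
  choose c hc0 hc using hex
  have hAt : ∀ i, Tendsto (fun m => A (ε m) i) atTop (𝓝 (a i)) := fun i => by
    have : Tendsto (fun m => a i - 2 * i * ε m) atTop (𝓝 (a i - 2 * i * 0)) :=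
      tendsto_const_nhds.sub (hεt.const_mul _)
    simpa using this
  have hBt : ∀ i, Tendsto (fun m => B (ε m) i) atTop (𝓝 (b i)) := fun i => by
    have : Tendsto (fun m => b i - (2 * i - 1) * ε m) atTop (𝓝 (b i - (2 * i - 1) * 0)) :=
      tendsto_const_nhds.sub (hεt.const_mul _)
    simpa using this
  have hL : ∀ t : ℝ, Tendsto (fun m => ∏ i, (t - A (ε m) i) - ∏ i, (t - B (ε m) i)) atTop
      (𝓝 (∏ i, (t - a i) - ∏ i, (t - b i))) := fun t =>
    (tendsto_finsetProd _ fun i _ => tendsto_const_nhds.sub (hAt i)).sub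
      (tendsto_finsetProd _ fun i _ => tendsto_const_nhds.sub (hBt i))
  -- At T every factor is at least 1, so each coefficient is bounded by the convergent left side at
  -- T; compactness then gives a limit of coefficients.
  set T : ℝ := 1 + ∑ i, |a i| with hT
  have hTA : ∀ m j, 1 ≤ T - A (ε m) j := fun m j => by
    have h1 : a j ≤ ∑ i, |a i| := (le_abs_self _).trans
      (Finset.single_le_sum (f := fun i => |a i|) (fun i _ => abs_nonneg _) (Finset.mem_univ j))
    have h2 : 0 ≤ 2 * (j : ℝ) * ε m := by have := (hε0 m).le; positivity
    simp only [hA, hT]; linarith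
  obtain ⟨M, hM⟩ := (hL T).bddAbove_range
  have hcM : ∀ m, c m ∈ Set.Icc (0 : Fin d → ℝ) fun _ => M := by
    intro m
    refine ⟨fun i => hc0 m i, fun i => ?_⟩
    have h1 := hM ⟨m, rfl⟩
    simp only at h1
    rw [hc m T] at h1
    have hp : ∀ i, 1 ≤ ∏ j ∈ Finset.univ.erase i, (T - A (ε m) j) := fun i =>
      Finset.one_le_prod fun j _ => hTA m j
    have h2 : c m i * ∏ j ∈ Finset.univ.erase i, (T - A (ε m) j) ≤
        ∑ i, c m i * ∏ j ∈ Finset.univ.erase i, (T - A (ε m) j) :=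
      Finset.single_le_sum (f := fun i => c m i * ∏ j ∈ Finset.univ.erase i, (T - A (ε m) j))
        (fun i _ => mul_nonneg (hc0 m i) (zero_le_one.trans (hp i))) (Finset.mem_univ i)
    nlinarith [hp i, hc0 m i]
  obtain ⟨c', hc', φ, hφ, hlim⟩ := isCompact_Icc.tendsto_subseq hcM
  refine ⟨c', fun i => hc'.1 i, fun t => ?_⟩
  refine tendsto_nhds_unique ((hL t).comp hφ.tendsto_atTop) ?_
  have h3 : Tendsto (fun m => ∑ i, c (φ m) i * ∏ j ∈ Finset.univ.erase i, (t - A (ε (φ m)) j))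
      atTop (𝓝 (∑ i, c' i * ∏ j ∈ Finset.univ.erase i, (t - a j))) :=
    tendsto_finsetSum _ fun i _ => ((tendsto_pi_nhds.1 hlim) i).mul
      (tendsto_finsetProd _ fun j _ => tendsto_const_nhds.sub
        ((hAt j).comp hφ.tendsto_atTop))
  refine h3.congr fun m => ?_
  exact (hc (φ m) t).symm

theorem det_diagonal_sub_vecMulVec {d : ℕ} {u : Fin d → ℂ} (hu : ∀ i, u i ≠ 0) (v w : Fin d → ℂ) :
    (diagonal u - vecMulVec v w).det = (∏ i, u i) * (1 - ∑ i, w i * v i / u i) := by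
  have e : diagonal u - vecMulVec v w =
      diagonal u * (1 + replicateCol Unit (fun i => -(v i / u i)) * replicateRow Unit w) := by
    rw [Matrix.mul_add, Matrix.mul_one, sub_eq_add_neg]
    congr 1
    ext i j
    rw [diagonal_mul]
    simp only [Matrix.neg_apply, vecMulVec_apply, Matrix.mul_apply, Finset.univ_unique,
      replicateCol_apply, replicateRow_apply, Finset.sum_const, Finset.card_singleton, one_smul]
    field_simp [hu i]
  rw [e, det_mul, det_diagonal, det_one_add_replicateCol_mul_replicateRow]
  congr 1
  rw [sub_eq_add_neg, ← Finset.sum_neg_distrib]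
  congr 1
  refine Finset.sum_congr rfl fun i _ => ?_
  ring

/-- The secular equation: for real t off the `a i`, the determinant is ∏(t - a_i)(1 - ∑|v_i|²/(t -
a_i)), so v_i = √c_i with the interpolation coefficients. Infinitely many such t determine the
polynomial. -/
theorem exists_rank_one_perturbation {d : ℕ} {a b : Fin d → ℝ} (hab : ∀ i, a i ≤ b i)
    (hba : ∀ i j, i < j → b j ≤ a i) :
    ∃ v : Fin d → ℂ, (diagonal (fun i => (a i : ℂ)) + vecMulVec v (star v)).charpoly =
      ∏ i, (X - C (b i : ℂ)) := by
  obtain ⟨c, hc0, hc⟩ := exists_coeff_of_interlacing hab hba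
  refine ⟨fun i => (√(c i) : ℂ), eq_of_infinite_eval_eq _ _ ?_⟩
  have hinf : Set.Infinite ((fun t : ℝ => (t : ℂ)) '' (Set.range a)ᶜ) :=
    (Set.Finite.infinite_compl (Set.finite_range a)).image Complex.ofReal_injective.injOn
  refine hinf.mono ?_
  rintro _ ⟨t, ht, rfl⟩
  have hta : ∀ i, t - a i ≠ 0 := fun i h => ht ⟨i, (sub_eq_zero.1 h).symm⟩
  rw [Set.mem_ofPred_eq, eval_charpoly]
  have e : (scalar (Fin d)) (t : ℂ) - (diagonal (fun i => (a i : ℂ)) +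
      vecMulVec (fun i => (√(c i) : ℂ)) (star fun i => (√(c i) : ℂ))) =
      diagonal (fun i => ((t - a i : ℝ) : ℂ)) -
        vecMulVec (fun i => (√(c i) : ℂ)) (star fun i => (√(c i) : ℂ)) := by
    rw [← sub_sub]
    congr 1
    ext i j
    by_cases hij : i = j
    · subst hij; simp
    · simp [hij]
  rw [e, det_diagonal_sub_vecMulVec fun i => by exact_mod_cast hta i]
  have e2 : ∀ i, (star fun i => (√(c i) : ℂ)) i * (√(c i) : ℂ) / ((t - a i : ℝ) : ℂ) =
      ((c i / (t - a i) : ℝ) : ℂ) := fun i => by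
    rw [Pi.star_apply, RCLike.star_def, Complex.conj_ofReal, ← Complex.ofReal_mul,
      Real.mul_self_sqrt (hc0 i), Complex.ofReal_div]
  simp only [e2, eval_prod, eval_sub, eval_X, eval_C]
  rw [← Complex.ofReal_sum, ← Complex.ofReal_prod, ← Complex.ofReal_one, ← Complex.ofReal_sub,
    ← Complex.ofReal_mul]
  simp only [← Complex.ofReal_sub]
  rw [← Complex.ofReal_prod]
  congr 1
  rw [mul_sub, mul_one, sub_eq_iff_eq_add, ← sub_eq_iff_eq_add', hc t, Finset.mul_sum]
  refine Finset.sum_congr rfl fun i _ => ?_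
  rw [← Finset.mul_prod_erase _ _ (Finset.mem_univ i)]
  have := hta i
  field_simp

theorem exists_unitary_conj_of_charpoly_eq {d : ℕ} {A B : Matrix (Fin d) (Fin d) ℂ}
    (hA : A.IsHermitian) (hB : B.IsHermitian) (h : A.charpoly = B.charpoly) :
    ∃ U : Matrix (Fin d) (Fin d) ℂ, Uᴴ * U = 1 ∧ A = U * B * Uᴴ := by
  have he := (IsHermitian.eigenvalues_eq_eigenvalues_iff hA hB).2 h
  have hA1 := hA.spectral_theorem
  have hB1 := hB.spectral_theorem
  rw [Unitary.conjStarAlgAut_apply] at hA1 hB1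
  rw [he] at hA1
  set D := diagonal ((RCLike.ofReal : ℝ → ℂ) ∘ hB.eigenvalues)
  set P := (hA.eigenvectorUnitary : Matrix (Fin d) (Fin d) ℂ) with hP
  set Q := (hB.eigenvectorUnitary : Matrix (Fin d) (Fin d) ℂ) with hQ
  have hP1 : Pᴴ * P = 1 := Unitary.star_mul_self_of_mem hA.eigenvectorUnitary.2
  have hQ1 : Qᴴ * Q = 1 := Unitary.star_mul_self_of_mem hB.eigenvectorUnitary.2
  have hQ2 : Q * Qᴴ = 1 := Unitary.mul_star_self_of_mem hB.eigenvectorUnitary.2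
  refine ⟨P * Qᴴ, ?_, ?_⟩
  · rw [conjTranspose_mul, conjTranspose_conjTranspose, Matrix.mul_assoc, ← Matrix.mul_assoc Pᴴ,
      hP1, Matrix.one_mul, hQ2]
  · rw [conjTranspose_mul, conjTranspose_conjTranspose]
    have hA2 : A = P * D * Pᴴ := hA1
    have hB2 : B = Q * D * Qᴴ := hB1
    calc A = P * (Qᴴ * Q) * D * (Qᴴ * Q) * Pᴴ := by
            rw [hQ1, Matrix.mul_one, Matrix.mul_one, hA2]
      _ = P * Qᴴ * B * (Q * Pᴴ) := by rw [hB2]; simp only [Matrix.mul_assoc]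

/-- Induction on the rank through an intermediate spectrum ν that is reachable from `a` with rank r
and interlaces with `b`. -/
theorem exists_rank_perturbation {d : ℕ} (r : ℕ) : ∀ (a b : Fin d → ℝ) (_ : Antitone a)
    (_ : Antitone b) (_ : ∀ i, a i ≤ b i) (_ : ∀ i j : Fin d, (i : ℕ) + r ≤ j → b j ≤ a i),
    ∃ S : Matrix (Fin r) (Fin d) ℂ, (diagonal (fun i => (a i : ℂ)) + Sᴴ * S).charpoly =
      ∏ i, (X - C (b i : ℂ)) := by
  induction r with
  | zero =>
    intro a b _ _ hab hba
    have : a = b := funext fun i => le_antisymm (hab i) (hba i i (by simp))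
    subst this
    refine ⟨0, ?_⟩
    rw [Matrix.mul_zero, add_zero, charpoly_diagonal]
  | succ r ih =>
    intro a b ha hb hab hba
    -- The smallest ν with ν ≥ a and ν_i ≥ b_{i+1}; the last index has no successor and keeps `a i`.
    set ν : Fin d → ℝ := fun i => if h : (i : ℕ) + 1 < d then max (a i) (b ⟨i + 1, h⟩) else a i
      with hν
    have haν : ∀ i, a i ≤ ν i := fun i => by
      simp only [hν]; split_ifs
      · exact le_max_left _ _
      · exact le_rfl
    have hνanti : Antitone ν := by
      intro i j hij
      have hij' : (i : ℕ) ≤ j := hij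
      by_cases hj : (j : ℕ) + 1 < d
      · have hi : (i : ℕ) + 1 < d := by omega
        simp only [hν, dif_pos hj, dif_pos hi]
        exact max_le_max (ha hij) (hb (by simpa using hij'))
      · simp only [hν, dif_neg hj]
        exact (ha hij).trans (haν i)
    have hνa : ∀ i j : Fin d, (i : ℕ) + r ≤ j → ν j ≤ a i := by
      intro i j hij
      have h1 : a j ≤ a i := ha (Fin.le_def.2 (by omega))
      simp only [hν]; split_ifs with h
      · exact max_le h1 (hba i _ (by simp; omega))
      · exact h1
    have hνb : ∀ i, ν i ≤ b i := fun i => by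
      simp only [hν]; split_ifs with h
      · exact max_le (hab i) (hb (Fin.le_def.2 (by simp)))
      · exact hab i
    have hbν : ∀ i j, i < j → b j ≤ ν i := fun i j hij => by
      have hij' : (i : ℕ) < j := hij
      have h : (i : ℕ) + 1 < d := by have := j.2; omega
      simp only [hν, dif_pos h]
      exact (hb (Fin.le_def.2 (by simpa using hij'))).trans (le_max_right _ _)
    obtain ⟨S, hS⟩ := ih a ν ha hνanti haν hνa
    obtain ⟨v, hv⟩ := exists_rank_one_perturbation hνb hbν
    have hreal : ∀ e : Fin d → ℝ, (diagonal fun i => (e i : ℂ)).IsHermitian := fun e => by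
      refine isHermitian_diagonal_of_self_adjoint _ ?_
      ext i
      simp
    have hM : (diagonal (fun i => (a i : ℂ)) + Sᴴ * S).IsHermitian :=
      (hreal a).add (isHermitian_conjTranspose_mul_self S)
    obtain ⟨U, hU, hUM⟩ := exists_unitary_conj_of_charpoly_eq hM (hreal ν)
      (hS.trans (charpoly_diagonal _).symm)
    -- The rank one vector was found for diag(ν); U carries it to the matrix already built, and it
    -- becomes one extra row of S.
    refine ⟨Matrix.of (Fin.cons (star (U *ᵥ v)) fun i => S i), ?_⟩
    have e1 : (Matrix.of (Fin.cons (star (U *ᵥ v)) fun i => S i))ᴴ *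
        (Matrix.of (Fin.cons (star (U *ᵥ v)) fun i => S i)) =
        vecMulVec (U *ᵥ v) (star (U *ᵥ v)) + Sᴴ * S := by
      ext i j
      simp [Matrix.mul_apply, Fin.sum_univ_succ, vecMulVec_apply]
    have e2 : vecMulVec (U *ᵥ v) (star (U *ᵥ v)) = U * vecMulVec v (star v) * Uᴴ := by
      rw [Matrix.mul_vecMulVec, Matrix.vecMulVec_mul, star_mulVec]
    rw [e1, add_left_comm, hUM, e2, add_comm, ← Matrix.add_mul, ← Matrix.mul_add, charpoly_mul_comm,
      ← Matrix.mul_assoc, hU, Matrix.one_mul, hv]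

end Interlacing

/-! ### Eigenvalue sequences of positive finite rank operators -/

section EigenvalueSeq

variable {H : Type*} [NormedAddCommGroup H] [InnerProductSpace ℂ H]

/-- `A = ∑ μ j ⟨e j, ·⟩ e j` with `e` orthonormal and `μ` nonnegative, non-increasing, and zero
from `N` on. -/
structure IsEigenExpansion {N : ℕ} (A : H →L[ℂ] H) (μ : ℕ → ℝ) (e : Fin N → H) : Prop where
  orthonormal : Orthonormal ℂ e
  apply_eq : ∀ ξ, A ξ = ∑ j : Fin N, ((μ j : ℂ) * inner ℂ (e j) ξ) • e j
  antitone : Antitone μ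
  nonneg : ∀ j, 0 ≤ μ j
  eq_zero : ∀ j, N ≤ j → μ j = 0

namespace IsEigenExpansion

variable {N : ℕ} {A : H →L[ℂ] H} {μ : ℕ → ℝ} {e : Fin N → H}

theorem inner_apply (h : IsEigenExpansion A μ e) (i : Fin N) (ξ : H) :
    inner ℂ (e i) (A ξ) = (μ i : ℂ) * inner ℂ (e i) ξ := by
  rw [h.apply_eq, h.orthonormal.inner_right_fintype]

theorem apply_basis (h : IsEigenExpansion A μ e) (i : Fin N) : A (e i) = (μ i : ℂ) • e i := by
  rw [h.apply_eq, Finset.sum_eq_single i]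
  · rw [orthonormal_iff_ite.1 h.orthonormal]; simp
  · intro j _ hj
    rw [orthonormal_iff_ite.1 h.orthonormal, if_neg hj]; simp
  · simp

theorem inner_self (h : IsEigenExpansion A μ e) (ξ : H) :
    inner ℂ ξ (A ξ) = ((∑ j : Fin N, μ j * ‖inner ℂ (e j) ξ‖ ^ 2 : ℝ) : ℂ) := by
  rw [h.apply_eq, inner_sum, Complex.ofReal_sum]
  refine Finset.sum_congr rfl fun j _ => ?_
  rw [inner_smul_right, mul_assoc, ← inner_conj_symm ξ (e j), Complex.mul_conj,
    Complex.normSq_eq_norm_sq, ← Complex.ofReal_mul]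

theorem eigenspace_eq (h : IsEigenExpansion A μ e) {t : ℝ} (ht : 0 < t) :
    Module.End.eigenspace (A : H →ₗ[ℂ] H) (t : ℂ) =
      Submodule.span ℂ (Set.range fun j : {j : Fin N // μ j = t} => e j) := by
  refine le_antisymm (fun ξ hξ => ?_) (Submodule.span_le.2 ?_)
  · rw [Module.End.mem_eigenspace_iff] at hξ
    have hA : A ξ = (t : ℂ) • ξ := hξ
    have htc : (t : ℂ) ≠ 0 := by exact_mod_cast ht.ne'
    have h1 : ξ = (t : ℂ)⁻¹ • A ξ := by rw [hA, smul_smul, inv_mul_cancel₀ htc, one_smul]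
    rw [h1, h.apply_eq]
    refine Submodule.smul_mem _ _ (Submodule.sum_mem _ fun j _ => ?_)
    by_cases hj : μ j = t
    · exact Submodule.smul_mem _ _ (Submodule.subset_span ⟨⟨j, hj⟩, rfl⟩)
    · have h2 := h.inner_apply j ξ
      rw [hA, inner_smul_right] at h2
      have h3 : ((t : ℂ) - μ j) * inner ℂ (e j) ξ = 0 := by rw [sub_mul, h2, sub_self]
      have h4 : (t : ℂ) - μ j ≠ 0 := by
        rw [← Complex.ofReal_sub]
        exact_mod_cast sub_ne_zero.2 (Ne.symm hj)
      rw [(mul_eq_zero.1 h3).resolve_left h4]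
      simp
  · rintro _ ⟨⟨j, hj⟩, rfl⟩
    rw [SetLike.mem_coe, Module.End.mem_eigenspace_iff]
    exact (h.apply_basis j).trans (by rw [hj])

theorem isEigenvalueSeq (h : IsEigenExpansion A μ e) : IsEigenvalueSeq A μ := by
  refine ⟨h.antitone, h.nonneg, fun t ht => ?_⟩
  have hli : LinearIndependent ℂ fun j : {j : Fin N // μ j = t} => e j :=
    h.orthonormal.linearIndependent.comp _ Subtype.val_injective
  rw [h.eigenspace_eq ht, rank_span hli]
  change ENat.card {j | μ j = t} = ENat.card _
  rw [ENat.card_congr (Equiv.ofInjective _ hli.injective).symm]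
  refine ENat.card_congr ⟨fun j => ⟨⟨j, ?_⟩, j.2⟩, fun j => ⟨j.1, j.2⟩, fun _ => rfl, fun _ => rfl⟩
  by_contra hN
  have := h.eq_zero j (not_lt.1 hN)
  have h2 : μ j = t := j.2
  linarith

end IsEigenExpansion

/-- At the first j with μ j < ν j = t, every index where μ equals t lies before j, and ν equals t
there too; but j itself is counted for ν alone, so the counts differ. -/
theorem le_of_encard_eq {μ ν : ℕ → ℝ} (hμ : Antitone μ) (hν : Antitone ν) (hμ0 : ∀ j, 0 ≤ μ j)
    (h : ∀ t : ℝ, 0 < t → {j | μ j = t}.encard = {j | ν j = t}.encard) : ν ≤ μ := by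
  by_contra hcon
  rw [Pi.le_def] at hcon
  push Not at hcon
  have hex : ∃ j, μ j < ν j := hcon
  classical
  set j := Nat.find hex with hj
  have hjlt : μ j < ν j := Nat.find_spec hex
  have hmin : ∀ i < j, ν i ≤ μ i := fun i hi => not_lt.1 (Nat.find_min hex hi)
  have ht : 0 < ν j := (hμ0 j).trans_lt hjlt
  set t := ν j with htdef
  have hsub : {i | μ i = t} ⊂ {i | ν i = t} := by
    refine ⟨fun i hi => ?_, fun hc => hjlt.ne (hc (rfl : j ∈ {i | ν i = t}))⟩
    have hij : i < j := by
      by_contra hle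
      have := hμ (not_lt.1 hle)
      rw [Set.mem_ofPred_eq] at hi
      linarith
    exact le_antisymm ((hmin i hij).trans (le_of_eq hi)) (hν hij.le)
  have hfin1 : {i | μ i = t}.Finite := (Set.finite_Iio j).subset fun i hi => by
    by_contra hle
    have := hμ (not_lt.1 hle)
    rw [Set.mem_ofPred_eq] at hi
    linarith
  exact (hfin1.encard_lt_encard hsub).ne (h _ ht)

theorem eq_of_encard_eq {μ ν : ℕ → ℝ} (hμ : Antitone μ) (hν : Antitone ν) (hμ0 : ∀ j, 0 ≤ μ j)
    (hν0 : ∀ j, 0 ≤ ν j)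
    (h : ∀ t : ℝ, 0 < t → {j | μ j = t}.encard = {j | ν j = t}.encard) : μ = ν :=
  le_antisymm (le_of_encard_eq hν hμ hν0 fun t ht => (h t ht).symm) (le_of_encard_eq hμ hν hμ0 h)

theorem IsEigenvalueSeq.unique {A : H →L[ℂ] H} {μ ν : ℕ → ℝ} (hμ : IsEigenvalueSeq A μ)
    (hν : IsEigenvalueSeq A ν) : μ = ν :=
  eq_of_encard_eq hμ.1 hν.1 hμ.2.1 hν.2.1 fun t ht => (hμ.2.2 t ht).trans (hν.2.2 t ht).symm

theorem IsEigenExpansion.eigenvalueSeq_eq {N : ℕ} {A : H →L[ℂ] H} {μ : ℕ → ℝ} {e : Fin N → H}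
    (h : IsEigenExpansion A μ e) : eigenvalueSeq A = μ :=
  (Classical.epsilon_spec ⟨_, h.isEigenvalueSeq⟩ : IsEigenvalueSeq A (eigenvalueSeq A)).unique
    h.isEigenvalueSeq

variable [CompleteSpace H]

theorem frameOp_inner {n : ℕ} (g : Fin n → H) (ξ η : H) :
    inner ℂ ξ (frameOp g η) = ∑ i, inner ℂ ξ (g i) * inner ℂ (g i) η := by
  rw [frameOp_apply, inner_sum]
  exact Finset.sum_congr rfl fun i _ => by rw [inner_smul_right, mul_comm]

theorem frameOp_inner_self {n : ℕ} (g : Fin n → H) (ξ : H) :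
    inner ℂ ξ (frameOp g ξ) = ((∑ i, ‖inner ℂ (g i) ξ‖ ^ 2 : ℝ) : ℂ) := by
  rw [frameOp_inner, Complex.ofReal_sum]
  refine Finset.sum_congr rfl fun i _ => ?_
  rw [← inner_conj_symm ξ (g i), mul_comm, Complex.mul_conj, Complex.normSq_eq_norm_sq]

/-- Spectral theorem on U; the operator vanishes on Uᗮ. Kernel vectors inside U are kept, so that
`e` is a basis of U. -/
theorem exists_isEigenExpansion {n : ℕ} {U : Submodule ℂ H} [FiniteDimensional ℂ U] {g : Fin n → H}
    (hg : ∀ i, g i ∈ U) {d : ℕ} (hd : Module.finrank ℂ U = d) :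
    ∃ (μ : ℕ → ℝ) (e : Fin d → H), (∀ j, e j ∈ U) ∧ IsEigenExpansion (frameOp g) μ e := by
  have hmap : ∀ ξ, frameOp g ξ ∈ U := fun ξ => by
    rw [frameOp_apply]
    exact Submodule.sum_mem _ fun i _ => U.smul_mem _ (hg i)
  set T : U →ₗ[ℂ] U := ((frameOp g : H →ₗ[ℂ] H).restrict fun ξ _ => hmap ξ) with hT
  have hTv : ∀ u : U, ((T u : U) : H) = frameOp g (u : H) := fun u => rfl
  have hadj : ∀ ξ η, inner ℂ (frameOp g ξ) η = inner ℂ ξ (frameOp g η) := fun ξ η => by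
    conv_rhs => rw [← frameOp_adjoint, ContinuousLinearMap.adjoint_inner_right]
  have hsym : T.IsSymmetric := fun u v => hadj u v
  have hnn : ∀ i, 0 ≤ hsym.eigenvalues hd i := by
    intro i
    refine eigenvalue_nonneg_of_nonneg (hsym.hasEigenvalue_eigenvalues hd i) fun u => ?_
    change 0 ≤ RCLike.re (inner ℂ (u : H) (frameOp g (u : H)))
    rw [frameOp_inner_self]
    simp only [RCLike.re_to_complex, Complex.ofReal_re]
    positivity
  set b := hsym.eigenvectorBasis hd with hb
  have hbo : Orthonormal ℂ fun j => (b j : H) :=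
    b.orthonormal.comp_linearIsometry U.subtypeₗᵢ
  refine ⟨fun j => if h : j < d then hsym.eigenvalues hd ⟨j, h⟩ else 0, fun j => b j,
    fun j => (b j).2, ⟨hbo, fun ξ => ?_, fun i j hij => ?_, fun j => ?_, fun j hj => ?_⟩⟩
  · have h1 : frameOp g ξ = frameOp g (U.starProjection ξ) := by
      rw [frameOp_apply, frameOp_apply]
      refine Finset.sum_congr rfl fun i _ => ?_
      congr 1
      rw [← sub_eq_zero, ← inner_sub_right]
      exact U.sub_starProjection_mem_orthogonal ξ _ (hg i)
    set p : U := ⟨U.starProjection ξ, U.starProjection_apply_mem ξ⟩ with hp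
    have h2 : T p = ∑ j, inner ℂ (b j) p • ((hsym.eigenvalues hd j : ℂ) • b j) := by
      conv_lhs => rw [← b.sum_repr' p]
      rw [map_sum]
      refine Finset.sum_congr rfl fun j _ => ?_
      rw [map_smul, hsym.apply_eigenvectorBasis]
      rfl
    have h3 := congrArg (fun u : U => (u : H)) h2
    rw [h1]
    refine (hTv p).symm.trans (h3.trans ?_)
    simp only [Submodule.coe_sum, Submodule.coe_smul]
    refine Finset.sum_congr rfl fun j _ => ?_
    rw [dif_pos j.2, smul_smul, mul_comm]
    congr 2
    change inner ℂ (b j : H) (U.starProjection ξ) = _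
    rw [← sub_eq_zero, ← inner_sub_right, ← neg_sub, inner_neg_right, neg_eq_zero]
    exact U.sub_starProjection_mem_orthogonal ξ _ (b j).2
  · by_cases hj : j < d
    · have hi : i < d := hij.trans_lt hj
      simp only [dif_pos hi, dif_pos hj]
      exact hsym.eigenvalues_antitone hd hij
    · simp only [dif_neg hj]
      split_ifs
      · exact hnn _
      · exact le_rfl
  · split_ifs
    · exact hnn _
    · exact le_rfl
  · simp [not_lt.2 hj]

end EigenvalueSeq

/-! ### Eigenvalue inequalities -/

section CourantFischer

variable {H : Type*} [NormedAddCommGroup H] [InnerProductSpace ℂ H]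

/-- Courant-Fischer: by dimension, E contains a nonzero vector orthogonal to the first j
eigenvectors, where the form is at most μ_j‖ξ‖². -/
theorem IsEigenExpansion.le_of_subspace {N : ℕ} {A : H →L[ℂ] H} {μ : ℕ → ℝ} {e : Fin N → H}
    (h : IsEigenExpansion A μ e) {E : Submodule ℂ H} [FiniteDimensional ℂ E] {j : ℕ}
    (hE : j < Module.finrank ℂ E) {t : ℝ}
    (ht : ∀ ξ ∈ E, t * ‖ξ‖ ^ 2 ≤ (inner ℂ ξ (A ξ)).re) : t ≤ μ j := by
  set L : E →ₗ[ℂ] (Fin j → ℂ) := LinearMap.pi fun i =>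
    if h : (i : ℕ) < N then ((innerSL ℂ (e ⟨i, h⟩) : H →L[ℂ] ℂ) : H →ₗ[ℂ] ℂ) ∘ₗ E.subtype else 0
    with hL
  have hker : LinearMap.ker L ≠ ⊥ := LinearMap.ker_ne_bot_of_finrank_lt (by simpa using hE)
  obtain ⟨ξ, hξ, hξ0⟩ := Submodule.exists_mem_ne_zero_of_ne_bot hker
  have hLi : ∀ i : Fin N, (i : ℕ) < j → inner ℂ (e i) (ξ : H) = 0 := by
    intro i hi
    have h1 := congrFun (LinearMap.mem_ker.1 hξ) ⟨i, hi⟩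
    simpa [hL] using h1
  have h1 := ht ξ ξ.2
  rw [h.inner_self, Complex.ofReal_re] at h1
  have h2 : ∑ i : Fin N, μ i * ‖inner ℂ (e i) (ξ : H)‖ ^ 2 ≤
      ∑ i : Fin N, μ j * ‖inner ℂ (e i) (ξ : H)‖ ^ 2 := by
    refine Finset.sum_le_sum fun i _ => ?_
    by_cases hi : (i : ℕ) < j
    · rw [hLi i hi]; simp
    · exact mul_le_mul_of_nonneg_right (h.antitone (not_lt.1 hi)) (sq_nonneg _)
  rw [← Finset.mul_sum] at h2
  have h3 := h.orthonormal.sum_inner_products_le (ξ : H) (s := Finset.univ)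
  have h4 : 0 < ‖(ξ : H)‖ ^ 2 := by
    have : (ξ : H) ≠ 0 := fun hc => hξ0 (Subtype.ext hc)
    positivity
  have h5 := h1.trans (h2.trans (mul_le_mul_of_nonneg_left h3 (h.nonneg j)))
  exact le_of_mul_le_mul_right h5 h4

theorem IsEigenExpansion.exists_subspace {N : ℕ} {A : H →L[ℂ] H} {μ : ℕ → ℝ} {e : Fin N → H}
    (h : IsEigenExpansion A μ e) {j : ℕ} (hj : j < N) :
    ∃ E : Submodule ℂ H, FiniteDimensional ℂ E ∧ Module.finrank ℂ E = j + 1 ∧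
      ∀ ξ ∈ E, μ j * ‖ξ‖ ^ 2 ≤ (inner ℂ ξ (A ξ)).re := by
  set e' : Fin (j + 1) → H := fun i => e ⟨i, by omega⟩ with he'
  have ho : Orthonormal ℂ e' := h.orthonormal.comp _ fun a b hab => by
    simpa [Fin.ext_iff] using hab
  refine ⟨Submodule.span ℂ (Set.range e'), inferInstance, ?_, fun ξ hξ => ?_⟩
  · rw [finrank_span_eq_card ho.linearIndependent, Fintype.card_fin]
  · obtain ⟨c, rfl⟩ := (Submodule.mem_span_range_iff_exists_fun ℂ).1 hξ
    set ξ := ∑ i, c i • e' i with hξdef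
    have hAξ : A ξ = ∑ i, ((μ (i : Fin (j + 1)) : ℂ) * c i) • e' i := by
      rw [hξdef, map_sum]
      refine Finset.sum_congr rfl fun i _ => ?_
      rw [map_smul, he', h.apply_basis, smul_smul, mul_comm]
    have h1 : inner ℂ ξ (A ξ) = ((∑ i : Fin (j + 1), μ i * ‖c i‖ ^ 2 : ℝ) : ℂ) := by
      rw [hAξ, hξdef, ho.inner_sum, Complex.ofReal_sum]
      refine Finset.sum_congr rfl fun i _ => ?_
      rw [mul_comm, mul_assoc, Complex.mul_conj, Complex.normSq_eq_norm_sq, ← Complex.ofReal_mul]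
    have h2 : ‖ξ‖ ^ 2 = ∑ i, ‖c i‖ ^ 2 := by
      have h3 : inner ℂ ξ ξ = ((∑ i, ‖c i‖ ^ 2 : ℝ) : ℂ) := by
        rw [hξdef, ho.inner_sum, Complex.ofReal_sum]
        refine Finset.sum_congr rfl fun i _ => ?_
        rw [mul_comm, Complex.mul_conj, Complex.normSq_eq_norm_sq]
      rw [inner_self_eq_norm_sq_to_K, RCLike.ofReal_eq_complex_ofReal] at h3
      exact_mod_cast h3
    rw [h1, Complex.ofReal_re, h2, Finset.mul_sum]
    refine Finset.sum_le_sum fun i _ => mul_le_mul_of_nonneg_right ?_ (sq_nonneg _)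
    exact h.antitone (by have := i.2; omega)

variable {N N' r : ℕ} {A B : H →L[ℂ] H} {μ ν : ℕ → ℝ} {e : Fin N → H} {e' : Fin N' → H}

theorem IsEigenExpansion.le_of_le (hA : IsEigenExpansion A μ e) (hB : IsEigenExpansion B ν e')
    (hAB : ∀ ξ, (inner ℂ ξ (A ξ)).re ≤ (inner ℂ ξ (B ξ)).re) (j : ℕ) : μ j ≤ ν j := by
  by_cases hj : j < N
  · obtain ⟨E, hfin, hE, h⟩ := hA.exists_subspace hj
    exact hB.le_of_subspace (by omega) fun ξ hξ => (h ξ hξ).trans (hAB ξ)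
  · rw [hA.eq_zero j (not_lt.1 hj)]
    exact hB.nonneg j

/-- Cutting the span of the leading eigenvectors of B with ker Z costs at most dim K dimensions. -/
theorem IsEigenExpansion.le_of_finrank {K : Type*} [AddCommGroup K] [Module ℂ K]
    [FiniteDimensional ℂ K] (hA : IsEigenExpansion A μ e) (hB : IsEigenExpansion B ν e')
    (Z : H →ₗ[ℂ] K) (hAB : ∀ ξ, Z ξ = 0 → (inner ℂ ξ (B ξ)).re ≤ (inner ℂ ξ (A ξ)).re) (j : ℕ) :
    ν (j + Module.finrank ℂ K) ≤ μ j := by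
  set r := Module.finrank ℂ K with hr
  by_cases hj : j + r < N'
  · obtain ⟨E, hfin, hE, h⟩ := hB.exists_subspace hj
    set L : E →ₗ[ℂ] K := Z ∘ₗ E.subtype with hL
    have h1 := LinearMap.finrank_range_add_finrank_ker L
    have h2 : Module.finrank ℂ (LinearMap.range L) ≤ r := Submodule.finrank_le _
    set E' := (LinearMap.ker L).map E.subtype with hE'
    have h3 : Module.finrank ℂ E' = Module.finrank ℂ (LinearMap.ker L) :=
      LinearEquiv.finrank_eq (Submodule.equivSubtypeMap E (LinearMap.ker L)).symm
    refine hA.le_of_subspace (E := E') (by omega) fun ξ hξ => ?_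
    obtain ⟨u, hu, rfl⟩ := hξ
    exact (h u u.2).trans (hAB _ (LinearMap.mem_ker.1 hu))
  · rw [hB.eq_zero _ (not_lt.1 hj)]
    exact hA.nonneg j

end CourantFischer

/-! ### Gram matrices -/

section Gram

open Matrix Polynomial

variable {H : Type*} [NormedAddCommGroup H] [InnerProductSpace ℂ H]

/-- The two matrices are B*B and BB*. The Gram matrix has size n in every fibre, whereas d varies
with x, so it is the form suited to selection. -/
theorem charpoly_gram [CompleteSpace H] {n d : ℕ} {U : Submodule ℂ H} (hdn : d ≤ n)
    {e : Fin d → H} (he : Orthonormal ℂ e) (hU : U = Submodule.span ℂ (Set.range e))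
    {h : Fin n → H} (hh : ∀ i, h i ∈ U) :
    (Matrix.of fun i j => inner ℂ (h i) (h j)).charpoly =
      X ^ (n - d) * (Matrix.of fun a b => inner ℂ (e a) (frameOp h (e b))).charpoly := by
  set B : Matrix (Fin d) (Fin n) ℂ := Matrix.of fun a i => inner ℂ (e a) (h i) with hB
  have h1 : (Matrix.of fun i j => inner ℂ (h i) (h j)) = Bᴴ * B := by
    ext i j
    simp only [of_apply, mul_apply, conjTranspose_apply, hB]
    have hj := hh j
    rw [hU] at hj
    obtain ⟨c, hc⟩ := (Submodule.mem_span_range_iff_exists_fun ℂ).1 hj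
    have h2 : ∀ a, inner ℂ (e a) (h j) = c a := fun a => by
      rw [← hc, he.inner_right_fintype]
    simp only [h2]
    rw [← hc, inner_sum]
    refine Finset.sum_congr rfl fun a _ => ?_
    rw [inner_smul_right, RCLike.star_def, inner_conj_symm, mul_comm]
  have h2 : (Matrix.of fun a b => inner ℂ (e a) (frameOp h (e b))) = B * Bᴴ := by
    ext a b
    simp only [of_apply, mul_apply, conjTranspose_apply, hB, frameOp_inner, RCLike.star_def,
      inner_conj_symm]
  rw [h1, h2, charpoly_mul_comm_of_le _ _ (by simpa using hdn)]
  simp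

theorem prod_X_sub_C_eq {μ : ℕ → ℝ} {n d : ℕ} (hdn : d ≤ n) (hμ : ∀ j, d ≤ j → μ j = 0) :
    ∏ j : Fin n, (X - C (μ j : ℂ)) = X ^ (n - d) * ∏ j : Fin d, (X - C (μ j : ℂ)) := by
  rw [Fin.prod_univ_eq_prod_range (fun j => X - C (μ j : ℂ)) n,
    Fin.prod_univ_eq_prod_range (fun j => X - C (μ j : ℂ)) d,
    ← Finset.prod_range_mul_prod_Ico _ hdn, mul_comm]
  congr 1
  rw [Finset.prod_congr rfl (g := fun _ => (X : ℂ[X])) fun j hj => by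
    rw [hμ j (Finset.mem_Ico.1 hj).1]; simp]
  simp

theorem eq_of_prod_X_sub_C_eq {μ ν : ℕ → ℝ} {n : ℕ} (hμ : Antitone μ) (hν : Antitone ν)
    (hμ0 : ∀ j, 0 ≤ μ j) (hν0 : ∀ j, 0 ≤ ν j) (hμn : ∀ j, n ≤ j → μ j = 0)
    (hνn : ∀ j, n ≤ j → ν j = 0)
    (h : ∏ j : Fin n, (X - C (μ j : ℂ)) = ∏ j : Fin n, (X - C (ν j : ℂ))) : μ = ν := by
  classical
  refine eq_of_encard_eq hμ hν hμ0 hν0 fun t ht => ?_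
  have key : ∀ ρ : ℕ → ℝ, (∀ j, n ≤ j → ρ j = 0) →
      {j | ρ j = t}.encard = ((∏ j : Fin n, (X - C (ρ j : ℂ))).roots.count (t : ℂ) : ℕ∞) := by
    intro ρ hρ
    have e1 : {j | ρ j = t} = ((Finset.univ.filter fun j : Fin n => ρ j = t).map
        Fin.valEmbedding : Finset ℕ) := by
      ext j
      simp only [Set.mem_ofPred_eq, Finset.coe_map, Set.mem_image, Finset.mem_coe,
        Finset.mem_filter, Finset.mem_univ, true_and]
      refine ⟨fun hj => ⟨⟨j, ?_⟩, hj, rfl⟩, ?_⟩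
      · by_contra hjn
        have := hρ j (not_lt.1 hjn)
        linarith
      · rintro ⟨i, hi, rfl⟩; exact hi
    rw [e1, Set.encard_coe_eq_coe_finsetCard, Finset.card_map]
    congr 1
    have e2 : (∏ j : Fin n, (X - C (ρ j : ℂ))).roots =
        Finset.univ.val.map fun j : Fin n => (ρ j : ℂ) :=
      Polynomial.roots_multiset_prod_X_sub_C (Finset.univ.val.map fun j : Fin n => (ρ j : ℂ)) ▸ by
        rw [Multiset.map_map]; rfl
    rw [e2, Multiset.count_map, Finset.card_def, Finset.filter_val]
    congr 1
    refine Multiset.filter_congr fun j _ => ?_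
    rw [eq_comm, Complex.ofReal_inj]
  rw [key μ hμn, key ν hνn, h]

theorem IsEigenExpansion.charpoly_gram [CompleteSpace H] {n d : ℕ} {U : Submodule ℂ H} (hdn : d ≤ n)
    {e : Fin d → H} (hU : U = Submodule.span ℂ (Set.range e)) {h : Fin n → H} (hh : ∀ i, h i ∈ U)
    {μ : ℕ → ℝ} (he : IsEigenExpansion (frameOp h) μ e) :
    (Matrix.of fun i j => inner ℂ (h i) (h j)).charpoly = ∏ j : Fin n, (X - C (μ j : ℂ)) := by
  rw [SIFrame.charpoly_gram hdn he.orthonormal hU hh, prod_X_sub_C_eq hdn he.eq_zero]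
  congr 1
  rw [← charpoly_diagonal]
  congr 1
  ext a b
  rw [of_apply, he.apply_basis, inner_smul_right, orthonormal_iff_ite.1 he.orthonormal,
    diagonal_apply]
  by_cases hab : a = b <;> simp [hab]

theorem span_range_eq_of_finrank {d : ℕ} {U : Submodule ℂ H} [FiniteDimensional ℂ U]
    (hd : Module.finrank ℂ U = d) {e : Fin d → H} (he : Orthonormal ℂ e) (heU : ∀ j, e j ∈ U) :
    U = Submodule.span ℂ (Set.range e) := by
  refine (Submodule.eq_of_le_of_finrank_eq (Submodule.span_le.2 ?_) ?_).symm
  · rintro _ ⟨j, rfl⟩; exact heU j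
  · rw [finrank_span_eq_card he.linearIndependent, Fintype.card_fin, hd]

theorem eigenvalueSeq_of_charpoly_gram [CompleteSpace H] {n : ℕ} {U : Submodule ℂ H}
    [FiniteDimensional ℂ U] (hdn : Module.finrank ℂ U ≤ n) {h : Fin n → H} (hh : ∀ i, h i ∈ U)
    {μ : ℕ → ℝ} (hμ : Antitone μ) (hμ0 : ∀ j, 0 ≤ μ j) (hμn : ∀ j, n ≤ j → μ j = 0)
    (hc : (Matrix.of fun i j => inner ℂ (h i) (h j)).charpoly = ∏ j : Fin n, (X - C (μ j : ℂ))) :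
    ∃ e : Fin (Module.finrank ℂ U) → H, IsEigenExpansion (frameOp h) μ e := by
  obtain ⟨ν, e, heU, he⟩ := exists_isEigenExpansion hh rfl
  have h1 := he.charpoly_gram hdn (span_range_eq_of_finrank rfl he.orthonormal heU) hh
  have h2 : μ = ν := eq_of_prod_X_sub_C_eq hμ he.antitone hμ0 he.nonneg hμn
    (fun j hj => he.eq_zero j (hdn.trans hj)) (hc.symm.trans h1)
  exact ⟨e, h2 ▸ he⟩

end Gram

/-! ### Spectra of oblique duals of a finite family -/

section FiniteDual

open Matrix Polynomial

variable {H : Type*} [NormedAddCommGroup H] [InnerProductSpace ℂ H]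

/-- The hypothesis says that the orthogonal projection to U' is injective on U. -/
theorem finrank_le_of_disjoint_orthogonal {U U' : Submodule ℂ H} [FiniteDimensional ℂ U]
    [FiniteDimensional ℂ U'] (h : ∀ ξ ∈ U, ξ ∈ U'ᗮ → ξ = 0) :
    Module.finrank ℂ U ≤ Module.finrank ℂ U' := by
  set P : U →ₗ[ℂ] U' := (U'.orthogonalProjectionOnto : H →ₗ[ℂ] U') ∘ₗ U.subtype with hP
  refine LinearMap.finrank_le_finrank_of_injective (f := P) ?_
  rw [← LinearMap.ker_eq_bot, LinearMap.ker_eq_bot']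
  intro ξ hξ
  refine Subtype.ext (h ξ ξ.2 ?_)
  exact U'.orthogonalProjectionOnto_eq_zero_iff.1 hξ

/-- The relations `∑ c i f i = 0`. -/
def relations {n : ℕ} (f : Fin n → H) : Submodule ℂ (EuclideanSpace ℂ (Fin n)) :=
  LinearMap.ker ((Fintype.linearCombination ℂ f) ∘ₗ
    (WithLp.linearEquiv 2 ℂ (Fin n → ℂ)).toLinearMap)

theorem mem_relations {n : ℕ} {f : Fin n → H} {c : EuclideanSpace ℂ (Fin n)} :
    c ∈ relations f ↔ ∑ i, c i • f i = 0 := Iff.rfl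

/-- The coefficients `⟨g i, η⟩`. -/
def coeffs {n : ℕ} (g : Fin n → H) (η : H) : EuclideanSpace ℂ (Fin n) :=
  WithLp.toLp 2 fun i => inner ℂ (g i) η

theorem norm_coeffs_sq {n : ℕ} (g : Fin n → H) (η : H) :
    ‖coeffs g η‖ ^ 2 = ∑ i, ‖inner ℂ (g i) η‖ ^ 2 := EuclideanSpace.norm_sq_eq _

variable [CompleteSpace H]

/-- `f` spans `UW`, and `g` is the canonical `UV`-dual of `f`. -/
structure IsFiniteCanonicalDual {n : ℕ} (UV UW : Submodule ℂ H) (f g : Fin n → H) : Prop where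
  f_mem : ∀ i, f i ∈ UW
  g_mem : ∀ i, g i ∈ UV
  exists_preimage : ∃ w : Fin n → H, ∀ i, w i ∈ UW ∧ g i - w i ∈ UWᗮ ∧ frameOp f (w i) = f i
  repr : ∀ v ∈ UV, ∑ i, inner ℂ (f i) v • g i = v
  disjoint : ∀ ξ ∈ UW, ξ ∈ UVᗮ → ξ = 0

namespace IsFiniteCanonicalDual

variable {n : ℕ} {UV UW : Submodule ℂ H} {f g h : Fin n → H}

/-- The adjoint form of `repr`. -/
theorem sum_sub_mem_orthogonal (D : IsFiniteCanonicalDual UV UW f g) (η : H) :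
    ∑ i, inner ℂ (g i) η • f i - η ∈ UVᗮ := by
  rw [Submodule.mem_orthogonal]
  intro v hv
  conv_lhs => rw [inner_sub_right]
  rw [sub_eq_zero]
  conv_rhs => rw [← D.repr v hv]
  rw [inner_sum, sum_inner]
  refine Finset.sum_congr rfl fun i _ => ?_
  rw [inner_smul_right, inner_smul_left, inner_conj_symm, mul_comm]

theorem reconstruct (D : IsFiniteCanonicalDual UV UW f g) {ξ : H} (hξ : ξ ∈ UW) :
    ∑ i, inner ℂ (g i) ξ • f i = ξ := by
  refine sub_eq_zero.1 (D.disjoint _ ?_ (D.sum_sub_mem_orthogonal ξ))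
  exact UW.sub_mem (Submodule.sum_mem _ fun i _ => UW.smul_mem _ (D.f_mem i)) hξ

theorem eq_zero_of_mem_orthogonal (D : IsFiniteCanonicalDual UV UW f g) {v : H} (hv : v ∈ UV)
    (hv' : v ∈ UWᗮ) : v = 0 := by
  rw [← D.repr v hv]
  refine Finset.sum_eq_zero fun i _ => ?_
  rw [hv' _ (D.f_mem i), zero_smul]

theorem finrank_eq [FiniteDimensional ℂ UV] [FiniteDimensional ℂ UW]
    (D : IsFiniteCanonicalDual UV UW f g) : Module.finrank ℂ UW = Module.finrank ℂ UV :=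
  le_antisymm (finrank_le_of_disjoint_orthogonal D.disjoint)
    (finrank_le_of_disjoint_orthogonal fun _ hv hv' => D.eq_zero_of_mem_orthogonal hv hv')

theorem span_eq (D : IsFiniteCanonicalDual UV UW f g) : Submodule.span ℂ (Set.range f) = UW := by
  refine le_antisymm (Submodule.span_le.2 ?_) fun ξ hξ => ?_
  · rintro _ ⟨i, rfl⟩; exact D.f_mem i
  · rw [← D.reconstruct hξ]
    exact Submodule.sum_mem _ fun i _ => Submodule.smul_mem _ _ (Submodule.subset_span ⟨i, rfl⟩)

theorem finrank_le (D : IsFiniteCanonicalDual UV UW f g) : Module.finrank ℂ UW ≤ n := by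
  rw [← D.span_eq]
  exact (finrank_range_le_card (R := ℂ) f).trans_eq (Fintype.card_fin n)

/-- S annihilates ∑ c_i w_i, so this sum is orthogonal to every f_i; as g_i - w_i is in UWᗮ, ∑ c_i
g_i lies in both UV and UWᗮ, which meet in 0. -/
theorem sum_smul_eq_zero (D : IsFiniteCanonicalDual UV UW f g) {c : EuclideanSpace ℂ (Fin n)}
    (hc : c ∈ relations f) : ∑ i, c i • g i = 0 := by
  rw [mem_relations] at hc
  obtain ⟨w, hw⟩ := D.exists_preimage
  have h1 : frameOp f (∑ i, c i • w i) = 0 := by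
    rw [map_sum, ← hc]
    exact Finset.sum_congr rfl fun i _ => by rw [map_smul, (hw i).2.2]
  have h2 : ∀ i, inner ℂ (f i) (∑ i, c i • w i) = 0 := by
    intro i
    have h3 := frameOp_inner_self f (∑ i, c i • w i)
    rw [h1, inner_zero_right, eq_comm, Complex.ofReal_eq_zero,
      Finset.sum_eq_zero_iff_of_nonneg fun i _ => sq_nonneg _] at h3
    simpa using h3 i (Finset.mem_univ i)
  refine D.eq_zero_of_mem_orthogonal
    (Submodule.sum_mem _ fun i _ => UV.smul_mem _ (D.g_mem i)) ?_
  have h4 : ∑ i, c i • g i = ∑ i, c i • (g i - w i) + ∑ i, c i • w i := by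
    rw [← Finset.sum_add_distrib]
    exact Finset.sum_congr rfl fun i _ => by rw [smul_sub, sub_add_cancel]
  rw [h4]
  refine UWᗮ.add_mem (Submodule.sum_mem _ fun i _ => Submodule.smul_mem _ _ (hw i).2.1) ?_
  rw [← D.span_eq, Submodule.mem_orthogonal]
  intro u hu
  obtain ⟨b, rfl⟩ := (Submodule.mem_span_range_iff_exists_fun ℂ).1 hu
  rw [sum_inner]
  exact Finset.sum_eq_zero fun i _ => by rw [inner_smul_left, h2, mul_zero]

theorem finrank_relations (D : IsFiniteCanonicalDual UV UW f g) :
    Module.finrank ℂ (relations f) = n - Module.finrank ℂ UW := by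
  have h1 := LinearMap.finrank_range_add_finrank_ker ((Fintype.linearCombination ℂ f) ∘ₗ
    (WithLp.linearEquiv 2 ℂ (Fin n → ℂ)).toLinearMap)
  rw [LinearEquiv.range_comp, Fintype.range_linearCombination, D.span_eq,
    finrank_euclideanSpace_fin] at h1
  change _ + Module.finrank ℂ (relations f) = n at h1
  omega

theorem inner_coeffs (D : IsFiniteCanonicalDual UV UW f g) {c : EuclideanSpace ℂ (Fin n)}
    (hc : c ∈ relations f) (η : H) : inner ℂ (coeffs g η) c = 0 := by
  have h1 := congrArg (inner ℂ η) (D.sum_smul_eq_zero hc)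
  rw [inner_sum, inner_zero_right] at h1
  rw [PiLp.inner_apply, ← h1]
  refine Finset.sum_congr rfl fun i _ => ?_
  rw [inner_smul_right, ← inner_conj_symm η (g i)]
  rfl

theorem coeffs_sub_mem (D : IsFiniteCanonicalDual UV UW f g) (hh : ∀ i, h i ∈ UV)
    (hd : ∀ ξ ∈ UW, ∑ i, inner ℂ (h i) ξ • f i = ξ) (η : H) :
    coeffs (fun i => h i - g i) η ∈ relations f := by
  rw [mem_relations]
  -- An element of UW with the same inner products against UV as η, to which the dual identities
  -- apply.
  set ξ := ∑ i, inner ℂ (g i) η • f i with hξ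
  have hξW : ξ ∈ UW := Submodule.sum_mem _ fun i _ => UW.smul_mem _ (D.f_mem i)
  have h1 : ∀ i, inner ℂ (h i - g i) η = inner ℂ (h i) ξ - inner ℂ (g i) ξ := by
    intro i
    rw [← inner_sub_left, eq_comm, ← sub_eq_zero, ← inner_sub_right]
    exact D.sum_sub_mem_orthogonal η _ (UV.sub_mem (hh i) (D.g_mem i))
  change ∑ i, inner ℂ (h i - g i) η • f i = 0
  simp only [h1, sub_smul, Finset.sum_sub_distrib]
  rw [hd ξ hξW, D.reconstruct hξW, sub_self]

/-- Pythagoras: the coefficients of h - g are relations, and those of g are orthogonal to relations.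
As quadratic forms, S_h = S_g + Z*Z. -/
theorem norm_coeffs_eq (D : IsFiniteCanonicalDual UV UW f g) (hh : ∀ i, h i ∈ UV)
    (hd : ∀ ξ ∈ UW, ∑ i, inner ℂ (h i) ξ • f i = ξ) (η : H) :
    ‖coeffs h η‖ ^ 2 = ‖coeffs g η‖ ^ 2 + ‖coeffs (fun i => h i - g i) η‖ ^ 2 := by
  have h1 : coeffs h η = coeffs g η + coeffs (fun i => h i - g i) η := by
    ext i
    change inner ℂ (h i) η = inner ℂ (g i) η + inner ℂ (h i - g i) η
    rw [← inner_add_left, add_sub_cancel]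
  rw [h1, sq, sq, sq]
  exact norm_add_sq_eq_norm_sq_add_norm_sq_of_inner_eq_zero _ _
    (D.inner_coeffs (D.coeffs_sub_mem hh hd η) η)

theorem re_inner_frameOp (g : Fin n → H) (η : H) :
    (inner ℂ η (frameOp g η)).re = ‖coeffs g η‖ ^ 2 := by
  rw [frameOp_inner_self, Complex.ofReal_re, norm_coeffs_sq]

theorem eigenvalue_bounds {N N' : ℕ} (D : IsFiniteCanonicalDual UV UW f g) (hh : ∀ i, h i ∈ UV)
    (hd : ∀ ξ ∈ UW, ∑ i, inner ℂ (h i) ξ • f i = ξ) {l μ : ℕ → ℝ} {e : Fin N → H} {e' : Fin N' → H}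
    (hl : IsEigenExpansion (frameOp g) l e) (hμ : IsEigenExpansion (frameOp h) μ e') (j : ℕ) :
    l j ≤ μ j ∧ μ (j + (n - Module.finrank ℂ UW)) ≤ l j := by
  refine ⟨hl.le_of_le hμ (fun ξ => ?_) j, ?_⟩
  · rw [re_inner_frameOp, re_inner_frameOp, D.norm_coeffs_eq hh hd]
    exact le_add_of_nonneg_right (sq_nonneg _)
  · rw [← D.finrank_relations]
    let Z : H →ₗ[ℂ] relations f :=
      { toFun := fun η => ⟨coeffs (fun i => h i - g i) η, D.coeffs_sub_mem hh hd η⟩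
        map_add' := fun a b => by
          ext i
          exact inner_add_right _ _ _
        map_smul' := fun c a => by
          ext i
          exact inner_smul_right _ _ _ }
    refine hl.le_of_finrank hμ Z (fun ξ hξ => ?_) j
    have h1 : coeffs (fun i => h i - g i) ξ = 0 := congrArg Subtype.val hξ
    rw [re_inner_frameOp, re_inner_frameOp, D.norm_coeffs_eq hh hd, h1]
    simp

theorem exists_dual_charpoly_gram [FiniteDimensional ℂ UV] [FiniteDimensional ℂ UW]
    (D : IsFiniteCanonicalDual UV UW f g) {d : ℕ} (hd : Module.finrank ℂ UV = d) {l μ : ℕ → ℝ}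
    {e : Fin d → H} (heU : ∀ j, e j ∈ UV) (hl : IsEigenExpansion (frameOp g) l e)
    (hμ : Antitone μ) (hμd : ∀ j, d ≤ j → μ j = 0) (hle : ∀ j, j < d → l j ≤ μ j)
    (hge : ∀ j, j + (n - d) < d → μ (j + (n - d)) ≤ l j) :
    ∃ h : Fin n → H, (∀ i, h i ∈ UV) ∧ (∀ ξ ∈ UW, ∑ i, inner ℂ (h i) ξ • f i = ξ) ∧
      (Matrix.of fun i j => inner ℂ (h i) (h j)).charpoly = ∏ j : Fin n, (X - C (μ j : ℂ)) := by
  have hdn : d ≤ n := by rw [← hd, ← D.finrank_eq]; exact D.finrank_le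
  obtain ⟨S, hS⟩ := exists_rank_perturbation (n - d) (fun i : Fin d => l i) (fun i : Fin d => μ i)
    (fun i j hij => hl.antitone hij) (fun i j hij => hμ hij) (fun i => hle i i.2)
    (fun i j hij => (hμ hij).trans (hge i (hij.trans_lt j.2)))
  have hr : Module.finrank ℂ (relations f) = n - d := by
    rw [D.finrank_relations, D.finrank_eq, hd]
  set b := (stdOrthonormalBasis ℂ (relations f)).reindex (finCongr hr) with hb
  set κ : Fin (n - d) → EuclideanSpace ℂ (Fin n) := fun s => (b s : EuclideanSpace ℂ (Fin n))
    with hκ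
  have hκo : Orthonormal ℂ κ := b.orthonormal.comp_linearIsometry (relations f).subtypeₗᵢ
  have hκm : ∀ s, κ s ∈ relations f := fun s => (b s).2
  set p : Fin (n - d) → H := fun s => ∑ j, star (S s j) • e j with hp
  have hpe : ∀ s j, inner ℂ (p s) (e j) = S s j := fun s j => by
    rw [hp, hl.orthonormal.inner_left_fintype]
    simp
  -- The coefficients of `h` are those of `g` plus ∑ ⟨p_s, ·⟩ κ_s with κ an orthonormal basis of the
  -- relations. The added part leaves reconstruction intact and contributes exactly S*S in the basis
  -- `e`.
  set h : Fin n → H := fun i => g i + ∑ s, star (κ s i) • p s with hh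
  have hpU : ∀ s, p s ∈ UV := fun s => Submodule.sum_mem _ fun j _ => UV.smul_mem _ (heU j)
  have hhU : ∀ i, h i ∈ UV := fun i =>
    UV.add_mem (D.g_mem i) (Submodule.sum_mem _ fun s _ => UV.smul_mem _ (hpU s))
  have hco : ∀ ξ, coeffs h ξ = coeffs g ξ + ∑ s, inner ℂ (p s) ξ • κ s := by
    intro ξ
    ext i
    change inner ℂ (h i) ξ = _
    simp only [hh, inner_add_left, sum_inner, inner_smul_left, PiLp.add_apply]
    congr 1
    rw [WithLp.ofLp_sum, Finset.sum_apply]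
    refine Finset.sum_congr rfl fun s _ => ?_
    simp [mul_comm]
  refine ⟨h, hhU, fun ξ hξ => ?_, ?_⟩
  · have h1 : ∑ s, inner ℂ (p s) ξ • κ s ∈ relations f :=
      Submodule.sum_mem _ fun s _ => Submodule.smul_mem _ _ (hκm s)
    rw [mem_relations] at h1
    have h2 : ∀ i, inner ℂ (h i) ξ = inner ℂ (g i) ξ + (∑ s, inner ℂ (p s) ξ • κ s) i := fun i =>
      congrArg (fun c : EuclideanSpace ℂ (Fin n) => c i) (hco ξ)
    simp only [h2, add_smul, Finset.sum_add_distrib]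
    rw [h1, D.reconstruct hξ, add_zero]
  · rw [charpoly_gram hdn hl.orthonormal (span_range_eq_of_finrank hd hl.orthonormal heU) hhU,
      prod_X_sub_C_eq hdn hμd]
    congr 1
    rw [← hS]
    congr 1
    ext a c
    have h1 : inner ℂ (e a) (frameOp h (e c)) = inner ℂ (coeffs h (e a)) (coeffs h (e c)) := by
      rw [frameOp_inner, PiLp.inner_apply]
      refine Finset.sum_congr rfl fun i _ => ?_
      rw [← inner_conj_symm (e a) (h i), mul_comm]
      rfl
    have h2 : inner ℂ (coeffs g (e a)) (coeffs g (e c)) = inner ℂ (e a) (frameOp g (e c)) := by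
      rw [frameOp_inner, PiLp.inner_apply]
      refine Finset.sum_congr rfl fun i _ => ?_
      rw [← inner_conj_symm (e a) (g i), mul_comm]
      rfl
    have h3 : ∀ j, ∑ s, inner ℂ (p s) (e j) • κ s ∈ relations f := fun j =>
      Submodule.sum_mem _ fun s _ => Submodule.smul_mem _ _ (hκm s)
    rw [of_apply, h1, hco, hco, inner_add_left, inner_add_right, inner_add_right,
      D.inner_coeffs (h3 c), ← inner_conj_symm (∑ s, inner ℂ (p s) (e a) • κ s) (coeffs g (e c)),
      D.inner_coeffs (h3 a), h2, map_zero, add_zero, zero_add, hκo.inner_sum, hl.apply_basis, inner_smul_right,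
      orthonormal_iff_ite.1 hl.orthonormal, Matrix.add_apply, diagonal_apply, mul_apply]
    congr 1
    · by_cases hac : a = c <;> simp [hac]
    · refine Finset.sum_congr rfl fun s _ => ?_
      rw [hpe, hpe, conjTranspose_apply]
      rfl

end IsFiniteCanonicalDual

end FiniteDual

/-! ### Measurable selection from closed sets with finite-dimensional sections -/

section Selection

open Set

universe u

theorem isClosed_image_fst {X Y : Type*} [TopologicalSpace X] [TopologicalSpace Y]
    {C : Set (X × Y)} (hC : IsClosed C) {K : Set Y} (hK : IsCompact K) (hCK : ∀ p ∈ C, p.2 ∈ K) :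
    IsClosed (Prod.fst '' C) := by
  have : CompactSpace K := isCompact_iff_compactSpace.1 hK
  have h1 : Prod.fst '' C = Prod.fst '' ((fun p : X × K => (p.1, (p.2 : Y))) ⁻¹' C) := by
    ext x
    constructor
    · rintro ⟨p, hp, rfl⟩
      exact ⟨(p.1, ⟨p.2, hCK p hp⟩), hp, rfl⟩
    · rintro ⟨p, hp, rfl⟩
      exact ⟨_, hp, rfl⟩
  rw [h1]
  exact isClosedMap_fst_of_compactSpace _ (hC.preimage (by fun_prop))

theorem exists_measurable_selection_real {Θ : Type*} [TopologicalSpace Θ] [MeasurableSpace Θ]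
    [BorelSpace Θ] {C : Set (Θ × ℝ)} (hC : IsClosed C) {R : ℝ} (hR : ∀ p ∈ C, p.2 ∈ Icc (-R) R) :
    ∃ s : Θ → ℝ, Measurable s ∧ ∀ θ, (∃ y, (θ, y) ∈ C) → (θ, s θ) ∈ C := by
  have hbdd : ∀ θ, BddBelow {t | (θ, t) ∈ C} := fun θ => ⟨-R, fun t ht => (hR _ ht).1⟩
  have hmem : ∀ θ, (∃ y, (θ, y) ∈ C) → (θ, sInf {t | (θ, t) ∈ C}) ∈ C := fun θ hθ =>
    (hC.preimage (Continuous.prodMk_right θ)).csInf_mem hθ (hbdd θ)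
  refine ⟨fun θ => sInf {t | (θ, t) ∈ C}, measurable_of_Iic fun a => ?_, hmem⟩
  have h1 : IsClosed (Prod.fst '' C) := isClosed_image_fst hC isCompact_Icc hR
  have h2 : IsClosed (Prod.fst '' (C ∩ {p | p.2 ≤ a})) :=
    isClosed_image_fst (hC.inter (isClosed_le continuous_snd continuous_const)) isCompact_Icc
      fun p hp => hR p hp.1
  -- Over an empty section the infimum is 0, which accounts for the second piece.
  have h3 : (fun θ => sInf {t | (θ, t) ∈ C}) ⁻¹' Iic a =
      Prod.fst '' (C ∩ {p | p.2 ≤ a}) ∪ ((Prod.fst '' C)ᶜ ∩ {_θ | 0 ≤ a}) := by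
    ext θ
    by_cases hθ : ∃ y, (θ, y) ∈ C
    · have h4 : θ ∈ Prod.fst '' C := hθ.elim fun y hy => ⟨_, hy, rfl⟩
      simp only [mem_preimage, mem_Iic, mem_union, mem_inter_iff, mem_compl_iff, h4,
        not_true_eq_false, false_and, or_false]
      constructor
      · exact fun h => ⟨_, ⟨hmem θ hθ, h⟩, rfl⟩
      · rintro ⟨⟨_, t⟩, ⟨ht, hta⟩, rfl⟩
        exact (csInf_le (hbdd _) ht).trans hta
    · have h4 : θ ∉ Prod.fst '' C := by rintro ⟨⟨_, t⟩, ht, rfl⟩; exact hθ ⟨t, ht⟩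
      have h5 : θ ∉ Prod.fst '' (C ∩ {p | p.2 ≤ a}) := fun h =>
        h4 (image_mono inter_subset_left h)
      have h6 : {t | (θ, t) ∈ C} = ∅ := eq_empty_of_forall_notMem fun t ht => hθ ⟨t, ht⟩
      simp [h4, h5, h6]
  rw [h3]
  exact h2.measurableSet.union (h1.measurableSet.compl.inter (MeasurableSet.const _))

/-- Lexicographic minimum: the first coordinate is the least point of a closed projection, and then
joins the parameters for the others. Hence Θ varies in the induction. -/
theorem exists_measurable_selection_of_bounded (D : ℕ) : ∀ {Θ : Type u} [TopologicalSpace Θ]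
    [SecondCountableTopology Θ] [MeasurableSpace Θ] [BorelSpace Θ] {C : Set (Θ × (Fin D → ℝ))},
    IsClosed C → ∀ {R : ℝ}, (∀ p ∈ C, ∀ i, p.2 i ∈ Icc (-R) R) →
      ∃ s : Θ → Fin D → ℝ, Measurable s ∧ ∀ θ, (∃ y, (θ, y) ∈ C) → (θ, s θ) ∈ C := by
  induction D with
  | zero =>
    intro Θ _ _ _ _ C _ R _
    exact ⟨fun _ => 0, measurable_const, fun θ ⟨y, hy⟩ => Subsingleton.elim y 0 ▸ hy⟩
  | succ D ih =>
    intro Θ _ _ _ _ C hC R hR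
    set C₂ : Set ((Θ × ℝ) × (Fin D → ℝ)) := {p | (p.1.1, Fin.cons p.1.2 p.2) ∈ C} with hC₂
    have hcl : IsClosed C₂ := hC.preimage
      (f := fun p : (Θ × ℝ) × (Fin D → ℝ) => (p.1.1, (Fin.cons p.1.2 p.2 : Fin (D + 1) → ℝ)))
      ((continuous_fst.comp continuous_fst).prodMk
        ((continuous_snd.comp continuous_fst).finCons continuous_snd))
    have hb₂ : ∀ p ∈ C₂, ∀ i, p.2 i ∈ Icc (-R) R := fun p hp i => by
      simpa using hR _ hp i.succ
    have hcl₁ : IsClosed (Prod.fst '' C₂) :=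
      isClosed_image_fst hcl (isCompact_univ_pi fun _ => isCompact_Icc (a := -R) (b := R))
        fun p hp i _ => hb₂ p hp i
    obtain ⟨s₀, hs₀, h₀⟩ := exists_measurable_selection_real hcl₁ (R := R) (by
      rintro _ ⟨p, hp, rfl⟩
      simpa using hR _ hp 0)
    obtain ⟨s₁, hs₁, h₁⟩ := ih hcl hb₂
    refine ⟨fun θ => Fin.cons (s₀ θ) (s₁ (θ, s₀ θ)), ?_, ?_⟩
    · refine measurable_pi_lambda _ fun i => ?_
      refine Fin.cases ?_ (fun i => ?_) i
      · simpa using hs₀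
      · simp only [Fin.cons_succ]
        exact (measurable_pi_apply i).comp (hs₁.comp (measurable_id.prodMk hs₀))
    · rintro θ ⟨y, hy⟩
      obtain ⟨p, hp, hpe⟩ := h₀ θ ⟨y 0, ((θ, y 0), Fin.tail y), by
        simpa [hC₂, Fin.cons_self_tail] using hy, rfl⟩
      exact h₁ (θ, s₀ θ) ⟨p.2, by rw [← hpe]; exact hp⟩

theorem exists_measurable_selection_pi {D : ℕ} {Θ : Type u} [TopologicalSpace Θ]
    [SecondCountableTopology Θ] [MeasurableSpace Θ] [BorelSpace Θ] {C : Set (Θ × (Fin D → ℝ))}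
    (hC : IsClosed C) :
    ∃ s : Θ → Fin D → ℝ, Measurable s ∧ ∀ θ, (∃ y, (θ, y) ∈ C) → (θ, s θ) ∈ C := by
  set B : ℕ → Set (Θ × (Fin D → ℝ)) := fun r => C ∩ {p | ∀ i, p.2 i ∈ Icc (-(r : ℝ)) r} with hB
  have hBc : ∀ r, IsClosed (B r) := fun r => hC.inter <| by
    rw [Set.ofPred_forall]
    exact isClosed_iInter fun i => isClosed_Icc.preimage ((continuous_apply i).comp continuous_snd)
  have hE : ∀ r, IsClosed (Prod.fst '' B r) := fun r =>
    isClosed_image_fst (hBc r) (isCompact_univ_pi fun _ => isCompact_Icc (a := -(r : ℝ)) (b := r))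
      fun p hp i _ => hp.2 i
  choose s hs hsB using fun r =>
    exists_measurable_selection_of_bounded D (hBc r) (R := r) fun p hp => hp.2
  classical
  -- The second alternative lets `Nat.find` be defined over empty sections as well.
  have hex : ∀ θ, ∃ r, θ ∈ Prod.fst '' B r ∨ θ ∉ ⋃ r, Prod.fst '' B r := fun θ => by
    by_cases h : θ ∈ ⋃ r, Prod.fst '' B r
    · obtain ⟨r, hr⟩ := mem_iUnion.1 h
      exact ⟨r, Or.inl hr⟩
    · exact ⟨0, Or.inr h⟩
  refine ⟨fun θ => s (Nat.find (hex θ)) θ, Measurable.find hs (fun r => ?_) hex, ?_⟩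
  · exact (hE r).measurableSet.union (MeasurableSet.iUnion fun r => (hE r).measurableSet).compl
  · rintro θ ⟨y, hy⟩
    have h1 : θ ∈ ⋃ r, Prod.fst '' B r := by
      obtain ⟨r, hr⟩ := exists_nat_ge ‖y‖
      refine mem_iUnion.2 ⟨r, (θ, y), ⟨hy, fun i => abs_le.1 ?_⟩, rfl⟩
      exact (norm_le_pi_norm y i).trans hr
    obtain ⟨⟨_, y'⟩, hp, rfl⟩ := (Nat.find_spec (hex θ)).resolve_right (not_not.2 h1)
    exact (hsB _ _ ⟨y', hp⟩).1

theorem exists_measurable_selection {Θ : Type u} [TopologicalSpace Θ]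
    [SecondCountableTopology Θ] [MeasurableSpace Θ] [BorelSpace Θ] {Y : Type*}
    [NormedAddCommGroup Y] [NormedSpace ℝ Y] [FiniteDimensional ℝ Y] [MeasurableSpace Y]
    [BorelSpace Y] {C : Set (Θ × Y)} (hC : IsClosed C) :
    ∃ s : Θ → Y, Measurable s ∧ ∀ θ, (∃ y, (θ, y) ∈ C) → (θ, s θ) ∈ C := by
  have L : Y ≃L[ℝ] (Fin (Module.finrank ℝ Y) → ℝ) :=
    ContinuousLinearEquiv.ofFinrankEq (by simp)
  obtain ⟨s, hs, h⟩ := exists_measurable_selection_pi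
    (C := {p : Θ × (Fin (Module.finrank ℝ Y) → ℝ) | (p.1, L.symm p.2) ∈ C})
    (hC.preimage (f := fun p : Θ × (Fin (Module.finrank ℝ Y) → ℝ) => (p.1, L.symm p.2))
      (by fun_prop))
  refine ⟨fun θ => L.symm (s θ), L.symm.continuous.measurable.comp hs, ?_⟩
  rintro θ ⟨y, hy⟩
  exact h θ ⟨L y, by simpa using hy⟩

end Selection

/-! ### Measurable choice of duals with prescribed Gram spectrum -/

section MeasurableDual

open Matrix Polynomial

variable {H : Type*} [NormedAddCommGroup H] [InnerProductSpace ℂ H] {n N : ℕ}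

/-- The family `h i = ∑ c i a φ a` is dual to `f` on the span of `f`, and its Gram matrix has
the eigenvalues `μ j`. -/
def IsGramDual (f : Fin n → H) (φ : Fin N → H) (μ : ℕ → ℝ) (c : Fin n → Fin N → ℂ) : Prop :=
  (∀ ξ ∈ Submodule.span ℂ (Set.range f), ∑ i, inner ℂ (∑ a, c i a • φ a) ξ • f i = ξ) ∧
  (Matrix.of fun i j => inner ℂ (∑ a, c i a • φ a) (∑ a, c j a • φ a)).charpoly =
    ∏ j : Fin n, (X - C (μ j : ℂ))

/-- The error in reconstructing f_a lies in the span of f, so it vanishes once it is orthogonal to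
each f_j. Duality thus depends on finitely many inner products. -/
theorem sum_inner_smul_eq_iff {f h : Fin n → H} :
    (∀ ξ ∈ Submodule.span ℂ (Set.range f), ∑ i, inner ℂ (h i) ξ • f i = ξ) ↔
      ∀ a j, ∑ i, inner ℂ (h i) (f a) * inner ℂ (f j) (f i) = inner ℂ (f j) (f a) := by
  constructor
  · intro H a j
    conv_rhs => rw [← H (f a) (Submodule.subset_span ⟨a, rfl⟩), inner_sum]
    exact Finset.sum_congr rfl fun i _ => (inner_smul_right _ _ _).symm
  · intro H ξ hξ
    have h1 : ∀ a, ∑ i, inner ℂ (h i) (f a) • f i = f a := by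
      intro a
      set η := ∑ i, inner ℂ (h i) (f a) • f i - f a with hη
      have h2 : ∀ j, inner ℂ (f j) η = 0 := fun j => by
        rw [hη, inner_sub_right, inner_sum, ← H a j, sub_eq_zero]
        exact Finset.sum_congr rfl fun i _ => inner_smul_right _ _ _
      have h3 : inner ℂ η η = 0 := by
        conv_lhs => rw [hη, inner_sub_left, sum_inner]
        rw [h2 a, sub_zero]
        exact Finset.sum_eq_zero fun i _ => by rw [inner_smul_left, h2 i, mul_zero]
      exact sub_eq_zero.1 (inner_self_eq_zero.1 h3)
    induction hξ using Submodule.span_induction with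
    | mem x hx => obtain ⟨a, rfl⟩ := hx; exact h1 a
    | zero => simp
    | add x y _ _ hx hy =>
      simp only [inner_add_right, add_smul, Finset.sum_add_distrib]
      rw [hx, hy]
    | smul t x _ hx =>
      simp only [inner_smul_right, mul_smul, ← Finset.smul_sum]
      rw [hx]

theorem isGramDual_iff {f : Fin n → H} {φ : Fin N → H} {μ : ℕ → ℝ} {c : Fin n → Fin N → ℂ} :
    IsGramDual f φ μ c ↔
      (∀ a j, ∑ i, (∑ b, star (c i b) * inner ℂ (φ b) (f a)) * inner ℂ (f j) (f i) =
        inner ℂ (f j) (f a)) ∧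
      ∀ t : ℂ, (Matrix.scalar (Fin n) t - Matrix.of fun i j =>
        ∑ b, ∑ b', star (c i b) * (c j b' * inner ℂ (φ b) (φ b'))).det =
          ∏ j : Fin n, (t - (μ j : ℂ)) := by
  refine and_congr ?_ ?_
  · rw [sum_inner_smul_eq_iff]
    simp only [sum_inner, inner_smul_left, RCLike.star_def]
  · have h1 : (Matrix.of fun i j => inner ℂ (∑ a, c i a • φ a) (∑ a, c j a • φ a)) =
        Matrix.of fun i j => ∑ b, ∑ b', star (c i b) * (c j b' * inner ℂ (φ b) (φ b')) := by
      ext i j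
      simp only [of_apply, sum_inner, inner_smul_left, inner_sum, inner_smul_right,
        RCLike.star_def, Finset.mul_sum]
      rw [Finset.sum_comm]
      exact Finset.sum_congr rfl fun b _ => Finset.sum_congr rfl fun b' _ => mul_left_comm _ _ _
    rw [h1]
    constructor
    · intro h t
      rw [← Matrix.eval_charpoly, h, eval_prod]
      simp
    · intro h
      refine Polynomial.funext fun t => ?_
      rw [Matrix.eval_charpoly, h, eval_prod]
      simp

/-- By `isGramDual_iff` the admissible pairs (inner products and μ, coefficients) form a closed set
K. Its selector is composed with the measurable map θ collecting the data at x. -/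
theorem exists_aemeasurable_isGramDual {X : Type*} [MeasurableSpace X] {ν : Measure X}
    {f : X → Fin n → H} {φ : X → Fin N → H} {μ : X → ℕ → ℝ}
    (hf : ∀ i, AEStronglyMeasurable (fun x => f x i) ν)
    (hφ : ∀ a, AEStronglyMeasurable (fun x => φ x a) ν)
    (hμ : ∀ j, AEMeasurable (fun x => μ x j) ν) :
    ∃ c : X → Fin n → Fin N → ℂ, AEMeasurable c ν ∧
      ∀ x, (∃ c', IsGramDual (f x) (φ x) (μ x) c') → IsGramDual (f x) (φ x) (μ x) (c x) := by
  let K : Set (((Fin N → Fin n → ℂ) × (Fin n → Fin n → ℂ) × (Fin N → Fin N → ℂ) × (Fin n → ℝ)) ×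
      (Fin n → Fin N → ℂ)) := {p |
    (∀ a j, ∑ i, (∑ b, star (p.2 i b) * p.1.1 b a) * p.1.2.1 j i = p.1.2.1 j a) ∧
      ∀ t : ℂ, (Matrix.scalar (Fin n) t - Matrix.of fun i j =>
        ∑ b, ∑ b', star (p.2 i b) * (p.2 j b' * p.1.2.2.1 b b')).det =
          ∏ j : Fin n, (t - (p.1.2.2.2 j : ℂ))}
  have hK : IsClosed K := by
    simp only [K, Set.ofPred_and, Set.ofPred_forall]
    refine IsClosed.inter ?_ ?_
    · exact isClosed_iInter fun a => isClosed_iInter fun j => isClosed_eq (by fun_prop) (by fun_prop)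
    · refine isClosed_iInter fun t => isClosed_eq (Continuous.matrix_det ?_) (by fun_prop)
      refine continuous_const.sub (continuous_matrix fun i j => ?_)
      simp only [of_apply]
      fun_prop
  obtain ⟨s, hs, hsK⟩ := exists_measurable_selection hK
  let θ : X → (Fin N → Fin n → ℂ) × (Fin n → Fin n → ℂ) × (Fin N → Fin N → ℂ) × (Fin n → ℝ) := fun x =>
    (fun b a => inner ℂ (φ x b) (f x a), fun j i => inner ℂ (f x j) (f x i),
    fun b b' => inner ℂ (φ x b) (φ x b'), fun j => μ x j)
  have hθ : AEMeasurable θ ν := by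
    refine AEMeasurable.prodMk (aemeasurable_pi_lambda _ fun b => aemeasurable_pi_lambda _ fun a =>
      ((hφ b).inner (hf a)).aemeasurable) (AEMeasurable.prodMk (aemeasurable_pi_lambda _ fun j =>
      aemeasurable_pi_lambda _ fun i => ((hf j).inner (hf i)).aemeasurable)
      (AEMeasurable.prodMk (aemeasurable_pi_lambda _ fun b => aemeasurable_pi_lambda _ fun b' =>
      ((hφ b).inner (hφ b')).aemeasurable) (aemeasurable_pi_lambda _ fun j => hμ j)))
  refine ⟨fun x => s (θ x), hs.comp_aemeasurable hθ, fun x ⟨c', hc'⟩ => ?_⟩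
  exact isGramDual_iff.2 (hsK (θ x) ⟨c', isGramDual_iff.1 hc'⟩)

end MeasurableDual

/-! ### Comparison of the top eigenvalue with the norms of the family -/

section NormBounds

variable {H : Type*} [NormedAddCommGroup H] [InnerProductSpace ℂ H] [CompleteSpace H] {n N : ℕ}
  {h : Fin n → H} {μ : ℕ → ℝ} {e : Fin N → H}

/-- From ‖h_i‖⁴ ≤ ⟨h_i, S h_i⟩ ≤ μ_0‖h_i‖². -/
theorem IsEigenExpansion.norm_sq_le (he : IsEigenExpansion (frameOp h) μ e) (i : Fin n) :
    ‖h i‖ ^ 2 ≤ μ 0 := by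
  have h1 : ∑ j, ‖inner ℂ (h j) (h i)‖ ^ 2 = ∑ j : Fin N, μ j * ‖inner ℂ (e j) (h i)‖ ^ 2 := by
    have := (frameOp_inner_self h (h i)).symm.trans (he.inner_self (h i))
    exact_mod_cast this
  have h2 : ∑ j : Fin N, μ j * ‖inner ℂ (e j) (h i)‖ ^ 2 ≤ μ 0 * ‖h i‖ ^ 2 := by
    refine le_trans (Finset.sum_le_sum fun j _ =>
      mul_le_mul_of_nonneg_right (he.antitone (Nat.zero_le j)) (sq_nonneg _)) ?_
    rw [← Finset.mul_sum]
    exact mul_le_mul_of_nonneg_left (he.orthonormal.sum_inner_products_le _) (he.nonneg 0)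
  have h3 : (‖h i‖ ^ 2) ^ 2 ≤ ∑ j, ‖inner ℂ (h j) (h i)‖ ^ 2 := by
    have h4 : ‖inner ℂ (h i) (h i)‖ = ‖h i‖ ^ 2 := by
      rw [inner_self_eq_norm_sq_to_K]; simp
    rw [← h4]
    exact Finset.single_le_sum (f := fun j => ‖inner ℂ (h j) (h i)‖ ^ 2)
      (fun j _ => sq_nonneg _) (Finset.mem_univ i)
  have h5 : ‖h i‖ ^ 2 * ‖h i‖ ^ 2 ≤ μ 0 * ‖h i‖ ^ 2 := by
    rw [← sq]; exact h3.trans (h1.trans_le h2)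
  rcases (sq_nonneg ‖h i‖).eq_or_lt with h6 | h6
  · rw [← h6]; exact he.nonneg 0
  · exact le_of_mul_le_mul_right h5 h6

theorem IsEigenExpansion.le_sum_norm_sq (he : IsEigenExpansion (frameOp h) μ e) :
    μ 0 ≤ ∑ i, ‖h i‖ ^ 2 := by
  by_cases hN : 0 < N
  · have h1 := frameOp_inner_self h (e ⟨0, hN⟩)
    rw [he.apply_basis, inner_smul_right, inner_self_eq_norm_sq_to_K, he.orthonormal.1] at h1
    have h2 : μ 0 = ∑ i, ‖inner ℂ (h i) (e ⟨0, hN⟩)‖ ^ 2 := by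
      simp only [RCLike.ofReal_one, one_pow, mul_one] at h1
      exact_mod_cast h1
    rw [h2]
    refine Finset.sum_le_sum fun i _ => ?_
    have h3 := norm_inner_le_norm (𝕜 := ℂ) (h i) (e ⟨0, hN⟩)
    rw [he.orthonormal.1, mul_one] at h3
    gcongr
  · rw [he.eq_zero 0 (not_lt.1 hN)]
    positivity

end NormBounds

/-! ### Fibers of the canonical dual and of shift generated duals -/

section Fibers

variable {k n N M : ℕ} {Φ : Fin N → L2 k} {Ψ : Fin M → L2 k} {V W : Submodule ℂ (L2 k)}
  {F G : Fin n → L2 k}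

theorem isFiniteCanonicalDual_fiber (hV : V = shiftSpan (Set.range Φ))
    (hW : W = shiftSpan (Set.range Ψ)) (hVW : IsCompl V Wᗮ) (hF : IsFrameFor (translates F) W) :
    ∀ᵐ x ∂(torusMeasure k), IsFiniteCanonicalDual (fiberSpan Φ x) (fiberSpan Ψ x)
      (fun i => Gam (F i) x) (fun i => Gam (canonicalDual V W hVW F i) x) := by
  obtain ⟨hFb, hgb, hgV, hFW, ⟨w, hw⟩, hrep⟩ := canonicalDual_spec hV hW hVW hF
  set g := canonicalDual V W hVW F with hg
  have mV : ∀ {f}, f ∈ V → ∀ᵐ x ∂(torusMeasure k), Gam f x ∈ fiberSpan Φ x := fun hf =>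
    mem_shiftSpan_iff.1 (hV ▸ hf)
  have mW : ∀ {f}, f ∈ W → ∀ᵐ x ∂(torusMeasure k), Gam f x ∈ fiberSpan Ψ x := fun hf =>
    mem_shiftSpan_iff.1 (hW ▸ hf)
  have mWo : ∀ {f}, f ∈ Wᗮ → ∀ᵐ x ∂(torusMeasure k), Gam f x ∈ (fiberSpan Ψ x)ᗮ := fun hf =>
    mem_shiftSpan_orthogonal.1 (hW ▸ hf)
  have hΦ : ∀ a, Φ a ∈ V := fun a => by
    rw [hV, mem_shiftSpan_iff]
    exact Filter.Eventually.of_forall fun x => Gam_mem_fiberSpan Φ a x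
  -- Used for disjointness: a vector of J_W(x) orthogonal to J_V(x) is orthogonal to both parts of
  -- each generator Ψ_b, hence to J_W(x) itself.
  have hdec : ∀ b, ∃ v ∈ V, Ψ b - v ∈ Wᗮ := fun b => by
    obtain ⟨v, hv, u, hu, hvu⟩ := Submodule.mem_sup.1
      (hVW.sup_eq_top ▸ Submodule.mem_top : Ψ b ∈ V ⊔ Wᗮ)
    exact ⟨v, hv, by rw [← hvu, add_sub_cancel_left]; exact hu⟩
  choose v hv hvo using hdec
  filter_upwards [ae_all_iff.2 fun i => mW (hFW i), ae_all_iff.2 fun i => mV (hgV i),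
    ae_all_iff.2 fun i => mW (hw i).1, ae_all_iff.2 fun i => mWo (hw i).2.1,
    ae_all_iff.2 fun i => Gam_add (w i) (g i - w i), ae_all_iff.2 fun i => Gam_mixed hFb hFb (w i),
    ae_all_iff.2 fun a => Gam_mixed hgb hFb (Φ a), ae_all_iff.2 fun b => mV (hv b),
    ae_all_iff.2 fun b => mWo (hvo b), ae_all_iff.2 fun b => Gam_add (v b) (Ψ b - v b)]
    with x h1 h2 h3 h4 h5 h6 h7 h8 h9 h10
  refine ⟨h1, h2, ⟨fun i => Gam (w i) x, fun i => ⟨h3 i, ?_, ?_⟩⟩, fun ξ hξ => ?_, fun ξ hξ hξ' => ?_⟩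
  · have := h5 i
    rw [add_sub_cancel] at this
    rw [this, add_sub_cancel_left]
    exact h4 i
  · have := h6 i
    change Gam (frameOp (translates F) (w i)) x = _ at this
    rw [(hw i).2.2] at this
    rw [this, frameOp_apply]
  · unfold fiberSpan at hξ
    induction hξ using Submodule.span_induction with
    | mem x hx =>
      obtain ⟨a, rfl⟩ := hx
      have := h7 a
      rw [hrep _ (hΦ a)] at this
      exact this.symm
    | zero => simp
    | add x y _ _ hx hy =>
      simp only [inner_add_right, add_smul, Finset.sum_add_distrib]
      rw [hx, hy]
    | smul t x _ hx =>
      simp only [inner_smul_right, mul_smul, ← Finset.smul_sum]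
      rw [hx]
  · have h11 : ξ ∈ (fiberSpan Ψ x)ᗮ := by
      rw [mem_fiberSpan_orthogonal]
      intro b
      have := h10 b
      rw [add_sub_cancel] at this
      rw [this, inner_add_left, hξ' _ (h8 b), zero_add]
      exact Submodule.inner_left_of_mem_orthogonal hξ (h9 b)
    exact (Submodule.mem_bot ℂ).1
      ((Submodule.orthogonal_disjoint (fiberSpan Ψ x)).le_bot ⟨hξ, h11⟩)

/-- Passing to fibres needs the identity only for the finitely many generators of W, so the
exceptional sets combine; linearity extends it to the fibre. -/
theorem isSGDual_iff (hV : V = shiftSpan (Set.range Φ)) (hW : W = shiftSpan (Set.range Ψ))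
    (hFb : IsBddFam F) :
    IsSGDual V W F G ↔ IsBddFam G ∧ ∀ᵐ x ∂(torusMeasure k),
      (∀ i, Gam (G i) x ∈ fiberSpan Φ x) ∧
      ∀ ξ ∈ fiberSpan Ψ x, ∑ i, inner ℂ (Gam (G i) x) ξ • Gam (F i) x = ξ := by
  have hΨ : ∀ b, Ψ b ∈ W := fun b => by
    rw [hW, mem_shiftSpan_iff]
    exact Filter.Eventually.of_forall fun x => Gam_mem_fiberSpan Ψ b x
  constructor
  · rintro ⟨hGV, hG⟩
    rw [isObliqueDual_iff hFb.isBessel] at hG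
    have hGb := isBddFam_of_isBessel hG.2.1
    refine ⟨hGb, ?_⟩
    have h0 : ∀ i, ∀ᵐ x ∂(torusMeasure k), Gam (G i) x ∈ fiberSpan Φ x := fun i =>
      mem_shiftSpan_iff.1 (hV ▸ hGV i)
    filter_upwards [ae_all_iff.2 h0, ae_all_iff.2 fun b => Gam_mixed hFb hGb (Ψ b)] with x h1 h2
    refine ⟨h1, fun ξ hξ => ?_⟩
    unfold fiberSpan at hξ
    induction hξ using Submodule.span_induction with
    | mem x hx =>
      obtain ⟨b, rfl⟩ := hx
      have := h2 b
      rw [hG.2.2 _ (hΨ b)] at this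
      exact this.symm
    | zero => simp
    | add x y _ _ hx hy =>
      simp only [inner_add_right, add_smul, Finset.sum_add_distrib]
      rw [hx, hy]
    | smul t x _ hx =>
      simp only [inner_smul_right, mul_smul, ← Finset.smul_sum]
      rw [hx]
  · rintro ⟨hGb, hG⟩
    have hGV : ∀ i, G i ∈ shiftSpan (Set.range Φ) := fun i => by
      rw [mem_shiftSpan_iff]
      filter_upwards [hG] with x hx using hx.1 i
    refine ⟨fun i => hV ▸ hGV i, (isObliqueDual_iff hFb.isBessel).2 ⟨fun p => ?_, hGb.isBessel,
      fun f hf => Gam_injective ?_⟩⟩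
    · rw [hV]; exact shiftOp_mem_shiftSpan _ (hGV _)
    · rw [hW, mem_shiftSpan_iff] at hf
      filter_upwards [hG, hf, Gam_mixed hFb hGb f] with x h1 h2 h3
      rw [h3, h1.2 _ h2]

theorem exists_Gam_eq_combination {c : Space k → Fin n → Fin N → ℂ}
    (hc : AEMeasurable c (torusMeasure k)) {C : ℝ}
    (hC : ∀ᵐ x ∂(torusMeasure k), ∀ i, ‖∑ a, c x i a • Gam (Φ a) x‖ ≤ C) :
    ∃ G : Fin n → L2 k, ∀ᵐ x ∂(torusMeasure k), ∀ i, Gam (G i) x = ∑ a, c x i a • Gam (Φ a) x := by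
  have h1 : ∀ i, ∃ g : L2 k, ∀ᵐ x ∂(torusMeasure k), Gam g x = ∑ a, c x i a • Gam (Φ a) x := by
    intro i
    refine exists_Gam_eq (MemLp.of_bound ?_ C ?_)
    · refine Finset.aestronglyMeasurable_fun_sum _ fun a _ => ?_
      have h2 : AEMeasurable (fun x => c x i a) (torusMeasure k) :=
        (measurable_pi_apply a).comp_aemeasurable ((measurable_pi_apply i).comp_aemeasurable hc)
      exact h2.aestronglyMeasurable.smul (aestronglyMeasurable_Gam (Φ a))
    · filter_upwards [hC] with x hx using hx i
  choose G hG using h1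
  exact ⟨G, ae_all_iff.2 hG⟩

theorem finrank_fiberSpan_eq (hV : V = shiftSpan (Set.range Φ)) :
    ∀ᵐ x ∂(torusMeasure k), fiberDim V x = Module.finrank ℂ (fiberSpan Φ x) := by
  subst hV
  filter_upwards [rangeFunction_shiftSpan Φ] with x hx
  rw [fiberDim, hx]

end Fibers

end SIFrame
end

/-- Sequences are indexed from `0`: `μ x j` is `μ_{j+1}(x)`. -/
theorem mainTheorem2 {k n : ℕ} (V W : Submodule ℂ (L2 k)) (hV : IsFSI V) (hW : IsFSI W)
    (hVW : IsCompl V Wᗮ) (F : Fin n → L2 k) (hF : IsFrameFor (translates F) W)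
    (μ : Space k → ℕ → ℝ)
    (hμ_meas : ∀ j, AEMeasurable (fun x => μ x j) (torusMeasure k))
    (hμ_seq : ∀ x ∈ torus k, Antitone (μ x) ∧ (∀ j, 0 ≤ μ x j) ∧ Summable (μ x)) :
    (∃ G : Fin n → L2 k, IsSGDual V W F G ∧
      ∀ᵐ x ∂(torusMeasure k),
        μ x = eigenvalueSeq (fiber (frameOp (translates G)) x) ∧
        μ x = eigenvalueSeq (frameOp (fun i => Gam (G i) x))) ↔
    ((∃ C : ℝ, ∀ᵐ x ∂(torusMeasure k), μ x 0 ≤ C) ∧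
      ∀ᵐ x ∂(torusMeasure k),
        (x ∉ Spec V → ∀ j, μ x j = 0) ∧
        (x ∈ Spec V →
          (∀ j, fiberDim V x ≤ j → μ x j = 0) ∧
          ((2 * fiberDim V x : ℤ) - n ≤ 0 →
            ∀ j, j < fiberDim V x →
              fineSpectrum (canonicalDual V W hVW F) x j ≤ μ x j) ∧
          (1 ≤ (2 * fiberDim V x : ℤ) - n →
            (∀ j, j < fiberDim V x →
              fineSpectrum (canonicalDual V W hVW F) x j ≤ μ x j) ∧
            (∀ j : ℕ, (j : ℤ) < 2 * fiberDim V x - n →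
              μ x (n - fiberDim V x + j) ≤
                fineSpectrum (canonicalDual V W hVW F) x j)))) := by
  obtain ⟨N, Φ, hΦ⟩ := hV.exists_generators
  obtain ⟨M, Ψ, hΨ⟩ := hW.exists_generators
  obtain ⟨hFb, hgb, -, -, -, -⟩ := canonicalDual_spec hΦ hΨ hVW hF
  have hbase : ∀ᵐ x ∂(torusMeasure k), x ∈ torus k ∧
      fiberDim V x = Module.finrank ℂ (fiberSpan Φ x) ∧
      IsFiniteCanonicalDual (fiberSpan Φ x) (fiberSpan Ψ x) (fun i => Gam (F i) x)
        (fun i => Gam (canonicalDual V W hVW F i) x) ∧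
      ∃ e : Fin (Module.finrank ℂ (fiberSpan Φ x)) → SeqSpace k, (∀ j, e j ∈ fiberSpan Φ x) ∧
        IsEigenExpansion (frameOp fun i => Gam (canonicalDual V W hVW F i) x)
          (fineSpectrum (canonicalDual V W hVW F) x) e := by
    filter_upwards [ae_mem_torus, finrank_fiberSpan_eq hΦ,
      isFiniteCanonicalDual_fiber hΦ hΨ hVW hF, fiber_frameOp hgb] with x h1 h2 h3 h4
    obtain ⟨l, e, he, hl⟩ := exists_isEigenExpansion h3.g_mem rfl
    refine ⟨h1, h2, h3, e, he, ?_⟩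
    rw [fineSpectrum, h4, hl.eigenvalueSeq_eq]
    exact hl
  constructor
  · rintro ⟨G, hG, hGμ⟩
    obtain ⟨hGb, hGd⟩ := (isSGDual_iff hΦ hΨ hFb).1 hG
    have key : ∀ᵐ x ∂(torusMeasure k),
        ∃ e : Fin (Module.finrank ℂ (fiberSpan Φ x)) → SeqSpace k,
          IsEigenExpansion (frameOp fun i => Gam (G i) x) (μ x) e := by
      filter_upwards [hGd, hGμ] with x h1 h2
      obtain ⟨ν, e, -, hν⟩ := exists_isEigenExpansion h1.1 rfl
      refine ⟨e, ?_⟩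
      rw [h2.2, hν.eigenvalueSeq_eq]
      exact hν
    refine ⟨?_, ?_⟩
    · obtain ⟨C, hC, hb⟩ := hGb
      refine ⟨∑ _i : Fin n, C ^ 2, ?_⟩
      filter_upwards [hb, key] with x h1 ⟨e, he⟩
      exact he.le_sum_norm_sq.trans (Finset.sum_le_sum fun i _ =>
        pow_le_pow_left₀ (norm_nonneg _) (h1 i) 2)
    · filter_upwards [hbase, hGd, key] with x ⟨h1, h2, D, e, he, hl⟩ h3 ⟨e', he'⟩
      have hb := D.eigenvalue_bounds h3.1 h3.2 hl he'
      rw [D.finrank_eq, ← h2] at hb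
      have hz : ∀ j, fiberDim V x ≤ j → μ x j = 0 := fun j hj => he'.eq_zero j (h2 ▸ hj)
      have hdn : fiberDim V x ≤ n := by rw [h2, ← D.finrank_eq]; exact D.finrank_le
      refine ⟨fun hx j => hz j ?_, fun hx => ⟨hz, fun _ j _ => (hb j).1,
        fun _ => ⟨fun j _ => (hb j).1, fun j _ => ?_⟩⟩⟩
      · have : fiberDim V x = 0 := by
          by_contra hc
          exact hx ⟨h1, hc⟩
        omega
      · rw [add_comm]; exact (hb j).2
  · rintro ⟨⟨C, hC⟩, hμ⟩
    have hexists : ∀ᵐ x ∂(torusMeasure k), (∀ j, n ≤ j → μ x j = 0) ∧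
        ∃ c, IsGramDual (fun i => Gam (F i) x) (fun a => Gam (Φ a) x) (μ x) c := by
      filter_upwards [hbase, hμ] with x ⟨h1, h2, D, e, he, hl⟩ ⟨h3, h4⟩
      have hdn : fiberDim V x ≤ n := by rw [h2, ← D.finrank_eq]; exact D.finrank_le
      have h5 : (∀ j, fiberDim V x ≤ j → μ x j = 0) ∧
          (∀ j, j < fiberDim V x → fineSpectrum (canonicalDual V W hVW F) x j ≤ μ x j) ∧
          ∀ j, j + (n - fiberDim V x) < fiberDim V x → μ x (j + (n - fiberDim V x)) ≤
            fineSpectrum (canonicalDual V W hVW F) x j := by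
        by_cases hx : x ∈ Spec V
        · obtain ⟨h6, h7, h8⟩ := h4 hx
          refine ⟨h6, ?_, fun j hj => ?_⟩
          · rcases le_or_gt (2 * fiberDim V x - n : ℤ) 0 with h9 | h9
            · exact h7 h9
            · exact (h8 h9).1
          · rw [add_comm]
            -- An index in the range of the upper bound exists only when 2d - n ≥ 1, so case (b) is
            -- available; for 2d ≤ n the bound is vacuous.
            exact (h8 (by omega)).2 j (by omega)
        · have h6 : fiberDim V x = 0 := by
            by_contra hc
            exact hx ⟨h1, hc⟩
          exact ⟨fun j _ => h3 hx j, fun j hj => by omega, fun j hj => by omega⟩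
      rw [h2] at h5 hdn
      obtain ⟨h, hh, hd, hch⟩ := D.exists_dual_charpoly_gram rfl he hl (hμ_seq x h1).1 h5.1
        h5.2.1 h5.2.2
      refine ⟨fun j hj => h5.1 j (hdn.trans hj), ?_⟩
      choose c hc using fun i => (Submodule.mem_span_range_iff_exists_fun ℂ).1 (hh i)
      refine ⟨c, ?_, ?_⟩
      · rw [D.span_eq]; simpa only [hc] using hd
      · simpa only [hc] using hch
    obtain ⟨c, hcm, hc⟩ := exists_aemeasurable_isGramDual (ν := torusMeasure k)
      (fun i => aestronglyMeasurable_Gam (F i)) (fun a => aestronglyMeasurable_Gam (Φ a)) hμ_meas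
    have hspan : ∀ x i, ∑ a, c x i a • Gam (Φ a) x ∈ fiberSpan Φ x := fun x i =>
      Submodule.sum_mem _ fun a _ => Submodule.smul_mem _ _ (Gam_mem_fiberSpan Φ a x)
    have hexp : ∀ᵐ x ∂(torusMeasure k),
        (∀ ξ ∈ fiberSpan Ψ x, ∑ i, inner ℂ (∑ a, c x i a • Gam (Φ a) x) ξ • Gam (F i) x = ξ) ∧
        ∃ e : Fin (Module.finrank ℂ (fiberSpan Φ x)) → SeqSpace k,
          IsEigenExpansion (frameOp fun i => ∑ a, c x i a • Gam (Φ a) x) (μ x) e := by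
      filter_upwards [hbase, hexists] with x ⟨h1, h2, D, _⟩ ⟨h3, h4⟩
      obtain ⟨h5, h6⟩ := hc x h4
      rw [D.span_eq] at h5
      refine ⟨h5, eigenvalueSeq_of_charpoly_gram ?_ (hspan x) (hμ_seq x h1).1 (hμ_seq x h1).2.1
        h3 h6⟩
      rw [← D.finrank_eq]; exact D.finrank_le
    -- The selected coefficients may be unbounded; the combinations are not, because their norms are
    -- controlled by the top eigenvalue.
    have hbdd : ∀ᵐ x ∂(torusMeasure k), ∀ i, ‖∑ a, c x i a • Gam (Φ a) x‖ ≤ Real.sqrt C := by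
      filter_upwards [hexp, hC] with x ⟨_, e, he⟩ h1 i
      exact Real.le_sqrt_of_sq_le ((he.norm_sq_le i).trans h1)
    obtain ⟨G, hG⟩ := exists_Gam_eq_combination hcm hbdd
    have hGb : IsBddFam G := ⟨Real.sqrt C, Real.sqrt_nonneg C, by
      filter_upwards [hG, hbdd] with x h1 h2 i
      rw [h1]; exact h2 i⟩
    refine ⟨G, (isSGDual_iff hΦ hΨ hFb).2 ⟨hGb, ?_⟩, ?_⟩
    · filter_upwards [hG, hexp] with x h1 ⟨h2, _⟩
      simp only [h1]
      exact ⟨hspan x, h2⟩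
    · filter_upwards [hG, hexp, fiber_frameOp hGb] with x h1 ⟨_, e, he⟩ h3
      rw [h3]
      simp only [h1]
      rw [he.eigenvalueSeq_eq]
      exact ⟨rfl, rfl⟩
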